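/- **Setting.** For units $i=1,2,\dots$ let $Z_i$ be a real running variable and $Y_{i,t}(d_0,d_1)$, $t,d_0,d_1\in\{0,1\}$, real potential outcomes; the vectors $(Z_i,(Y_{i,t}(d_0,d_1))_{t,d_0,d_1})$ are i.i.d. The cutoff is $0$; the confounding policy is $D_{i,0}=\mathbf 1\{Z_i\ge 0\}$ in both periods and the treatment is $D_{i,1}=\mathbf 1\{Z_i\ge 0,\,t=1\}$, so the observed change $\Delta Y_i=Y_{i,1}-Y_{i,0}$ equals $\Delta Y_i(1)=Y_{i,1}(1,1)-Y_{i,0}(1,0)$ if $Z_i\ge 0$ and $\Delta Y_i(0)=Y_{i,1}(0,0)-Y_{i,0}(0,0)$ if $Z_i<0$. Assume that for some $\kappa_0>0$, on $(-\kappa_0,\kappa_0)$: $E[\Delta Y_i^4\mid Z_i=z]$ is bounded; $Z_i$ has a density that is continuous and bounded away from zero; $\mu_-(z)=E[\Delta Y_i(0)\mid Z_i=z]$ and $\mu_+(z)=E[\Delta Y_i(1)\mid Z_i=z]$ are $S$ times continuously differentiable; $\sigma_-^2(z)=V[\Delta Y_i(0)\mid Z_i=z]$ and $\sigma_+^2(z)=V[\Delta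 Y_i(1)\mid Z_i=z]$ are continuous and bounded away from zero. Let $K:\mathbb R\to\mathbb R$ be bounded, nonnegative, even, zero outside $[-\kappa,\kappa]$ ($\kappa>0$), and positive and continuous on $(0,\kappa)$. The estimand is $\tau_\nu=\lim_{z\to0^+}\mu^{(\nu)}(z)-\lim_{z\to0^-}\mu^{(\nu)}(z)$ with $\mu(z)=E[\Delta Y_i\mid Z_i=z]$. **Estimator.** Write $K_h(u)=K(u/h)/h$, $r_p(x)=(1,x,\dots,x^p)'$, and let $e_\nu$ be the unit vector (of conformable length) that selects the coefficient of $x^\nu$. On the right side, with $w_i(h)=\mathbf 1\{Z_i\ge0\}K_h(Z_i)$ (on the left side, with $\mathbf 1\{Z_i<0\}$), put $$\Gamma_p(h)=\tfrac1n\sum_{i\le n} w_i(h)r_p(Z_i/h)r_p(Z_i/h)',\qquad \vartheta_{p,r}(h)=\tfrac1n\sum_{i\le n} w_i(h)r_p(Z_i/h)(Z_i/h)^r,$$ $$\Psi_{p,q}(h,b)=\tfrac1n\sum_{i\le n} w_i(h)w_i(b)\,V[\Delta Y_i\mid Z_i]\,r_p(Z_i/h)r_q(Z_i/b)',$$ $$\hat\delta_p(h)=\arg\min_\delta\sum_{i\le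 n} w_i(h)(\Delta Y_i-r_p(Z_i)'\delta)^2=\mathrm{diag}(1,h^{-1},\dots,h^{-p})\,\Gamma_p(h)^{-1}\tfrac1n\sum_{i\le n} w_i(h)r_p(Z_i/h)\Delta Y_i,$$ $\hat\mu^{(\nu)}_p(h)=\nu!\,e_\nu'\hat\delta_p(h)$ and $\mathcal B_{\nu,p,r}(h)=\nu!\,e_\nu'\Gamma_p(h)^{-1}\vartheta_{p,r}(h)$, with a subscript $\pm$ for the side. For $\nu\le p<q$ the bias-corrected estimator is $$\hat\tau^{bc}_{\nu,p,q}(h,b)=\hat\mu^{(\nu)}_{+,p}(h)-\hat\mu^{(\nu)}_{-,p}(h)-h^{p+1-\nu}\Big[\tfrac{\hat\mu^{(p+1)}_{+,q}(b)}{(p+1)!}\mathcal B_{+,\nu,p,p+1}(h)-\tfrac{\hat\mu^{(p+1)}_{-,q}(b)}{(p+1)!}\mathcal B_{-,\nu,p,p+1}(h)\Big],$$ and $\mathbf V^{bc}_{\nu,p,q}=\mathcal V^{bc}_{+,\nu,p,q}+\mathcal V^{bc}_{-,\nu,p,q}$, where on each side $$\mathcal V^{bc}_{\nu,p,q}(h,b)=\mathcal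 V_{\nu,p}(h)+h^{2(p+1-\nu)}\mathcal V_{p+1,q}(b)\tfrac{\mathcal B_{\nu,p,p+1}(h)^2}{(p+1)!^2}-2h^{p+1-\nu}\mathcal C_{\nu,p,q}(h,b)\tfrac{\mathcal B_{\nu,p,p+1}(h)}{(p+1)!},$$ $$\mathcal V_{\nu,p}(h)=\tfrac{\nu!^2}{nh^{2\nu}}e_\nu'\Gamma_p(h)^{-1}\Psi_{p,p}(h,h)\Gamma_p(h)^{-1}e_\nu,\qquad \mathcal C_{\nu,p,q}(h,b)=\tfrac{\nu!(p+1)!}{nh^\nu b^{p+1}}e_\nu'\Gamma_p(h)^{-1}\Psi_{p,q}(h,b)\Gamma_q(b)^{-1}e_{p+1}.$$ **Theorem 1 (robust bias-corrected asymptotic normality).** Let $\nu\le p<q$ be natural numbers and $S\ge q+1$, and let $h_n,b_n>0$ satisfy $\kappa\max\{h_n,b_n\}<\kappa_0$, $n\min\{h_n,b_n\}\to\infty$ and $$n\,\min\{h_n^{2p+3},b_n^{2p+3}\}\,\max\{h_n^2,b_n^{2(q-p)}\}\to0 .$$ Then $$T^{rbc}_{\nu,p,q}(h_n,b_n)=\frac{\hat\tau^{bc}_{\nu,p,q}(h_n,b_n)-\tau_\nu}{\sqrt{\mathbf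 V^{bc}_{\nu,p,q}(h_n,b_n)}}\xrightarrow{d}\mathcal N(0,1).$$ -/

import Mathlib

open MeasureTheory ProbabilityTheory Filter Topology Matrix
open scoped Nat

noncomputable section

namespace DiDC

/-! ### Potential outcomes and the sharp design

`Y i t d₀ d₁` is the potential outcome of unit `i` in period `t ∈ {0, 1}` when the confounding policy
is set to `d₀ ∈ {0, 1}` and the treatment of interest to `d₁ ∈ {0, 1}`; `Z i` is the running variable
of unit `i`, and the cutoff is `0`. -/

/-- Assignment rule of the confounding policy, `1{z ≥ 0}` in both periods. -/
def policyD0 (z : ℝ) : ℝ := if 0 ≤ z then 1 else 0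

/-- Assignment rule of the treatment of interest, `1{z ≥ 0, t = 1}`. -/
def policyD1 (z : ℝ) (t : Fin 2) : ℝ := if 0 ≤ z ∧ t = 1 then 1 else 0

/-- The observed outcome in period `t` of a unit with running variable `z` and potential outcomes
`y t d₀ d₁`. -/
def observed (z : ℝ) (y : Fin 2 → Fin 2 → Fin 2 → ℝ) (t : Fin 2) : ℝ :=
  (y t 1 1 * policyD0 z + y t 0 1 * (1 - policyD0 z)) * policyD1 z t
    + (y t 1 0 * policyD0 z + y t 0 0 * (1 - policyD0 z)) * (1 - policyD1 z t)

/-- The datum of unit `i`: its running variable together with all its potential outcomes. -/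
def datum {Ω : Type*} (Z : ℕ → Ω → ℝ) (Y : ℕ → Fin 2 → Fin 2 → Fin 2 → Ω → ℝ) (i : ℕ) (ω : Ω) :
    ℝ × (Fin 2 → Fin 2 → Fin 2 → ℝ) :=
  (Z i ω, fun t d₀ d₁ => Y i t d₀ d₁ ω)

/-- The units form a random sample: measurable, independent and identically distributed data. -/
structure IsRandomSample {Ω : Type*} [MeasurableSpace Ω] (P : Measure Ω)
    (Z : ℕ → Ω → ℝ) (Y : ℕ → Fin 2 → Fin 2 → Fin 2 → Ω → ℝ) : Prop where
  measurable : ∀ i, Measurable (datum Z Y i)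
  indep : iIndepFun (fun i => datum Z Y i) P
  identDistrib : ∀ i, IdentDistrib (datum Z Y i) (datum Z Y 0) P P

/-- The observed change of the outcome over time, `ΔY i = Y i 1 - Y i 0`. -/
def deltaY {Ω : Type*} (Z : ℕ → Ω → ℝ) (Y : ℕ → Fin 2 → Fin 2 → Fin 2 → Ω → ℝ) (i : ℕ) (ω : Ω) : ℝ :=
  observed (Z i ω) (fun t d₀ d₁ => Y i t d₀ d₁ ω) 1
    - observed (Z i ω) (fun t d₀ d₁ => Y i t d₀ d₁ ω) 0

/-- The change over time for a unit above the cutoff, `ΔY i (1) = Y i 1 (1,1) - Y i 0 (1,0)`. -/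
def deltaYTreated {Ω : Type*} (Y : ℕ → Fin 2 → Fin 2 → Fin 2 → Ω → ℝ) (i : ℕ) (ω : Ω) : ℝ :=
  Y i 1 1 1 ω - Y i 0 1 0 ω

/-- The change over time for a unit below the cutoff, `ΔY i (0) = Y i 1 (0,0) - Y i 0 (0,0)`. -/
def deltaYControl {Ω : Type*} (Y : ℕ → Fin 2 → Fin 2 → Fin 2 → Ω → ℝ) (i : ℕ) (ω : Ω) : ℝ :=
  Y i 1 0 0 ω - Y i 0 0 0 ω

/-- In the sharp design the observed change is `ΔY(1)` above the cutoff and `ΔY(0)` below it. -/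
theorem deltaY_eq {Ω : Type*} (Z : ℕ → Ω → ℝ) (Y : ℕ → Fin 2 → Fin 2 → Fin 2 → Ω → ℝ) (i : ℕ)
    (ω : Ω) :
    deltaY Z Y i ω = if 0 ≤ Z i ω then deltaYTreated Y i ω else deltaYControl Y i ω := by
  by_cases h : 0 ≤ Z i ω <;>
    simp [deltaY, observed, policyD0, policyD1, deltaYTreated, deltaYControl, h]

/-! ### Conditional moments given the running variable

`condDistrib X Z P z` is the conditional law of `X` given `Z = z`. -/

/-- `E[X | Z = z]` exists and equals `m z`, for almost every value `z` of `Z` in `U`. -/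
def HasCondMeanOn {Ω : Type*} [MeasurableSpace Ω] (P : Measure Ω) [IsFiniteMeasure P]
    (X Z : Ω → ℝ) (U : Set ℝ) (m : ℝ → ℝ) : Prop :=
  ∀ᵐ z ∂((P.map Z).restrict U),
    Integrable (fun x => x) (condDistrib X Z P z) ∧ ∫ x, x ∂(condDistrib X Z P z) = m z

/-- `V[X | Z = z]` exists and equals `s z`, for almost every value `z` of `Z` in `U`. -/
def HasCondVarOn {Ω : Type*} [MeasurableSpace Ω] (P : Measure Ω) [IsFiniteMeasure P]
    (X Z : Ω → ℝ) (U : Set ℝ) (s : ℝ → ℝ) : Prop :=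
  ∀ᵐ z ∂((P.map Z).restrict U),
    MemLp (fun x => x) 2 (condDistrib X Z P z) ∧
      variance (fun x => x) (condDistrib X Z P z) = s z

/-- `E[X ^ 4 | Z = z]` exists and is bounded by a constant, for almost every value `z` of `Z`
in `U`. -/
def HasBoundedCondFourthMomentOn {Ω : Type*} [MeasurableSpace Ω] (P : Measure Ω)
    [IsFiniteMeasure P] (X Z : Ω → ℝ) (U : Set ℝ) : Prop :=
  ∃ C : ℝ, ∀ᵐ z ∂((P.map Z).restrict U),
    Integrable (fun x => x ^ 4) (condDistrib X Z P z) ∧ ∫ x, x ^ 4 ∂(condDistrib X Z P z) ≤ C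

/-- On `U` the law of `Z` has a density with respect to Lebesgue measure that is continuous and
bounded away from zero. -/
def HasRegularDensityOn {Ω : Type*} [MeasurableSpace Ω] (P : Measure Ω) (Z : Ω → ℝ)
    (U : Set ℝ) : Prop :=
  ∃ f : ℝ → ℝ, ContinuousOn f U ∧ (∃ c : ℝ, 0 < c ∧ ∀ z ∈ U, c ≤ f z) ∧
    (P.map Z).restrict U = (volume.restrict U).withDensity fun z => ENNReal.ofReal (f z)

/-- The regularity conditions on the neighbourhood `(-κ₀, κ₀)` of the cutoff. Here `Z` is the running
variable, `X` the observed change, `X₀` and `X₁` its versions below and above the cutoff, `μm`, `μp`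
the regression functions of `X₀`, `X₁`, and `sm`, `sp` their conditional variance functions. -/
structure IsSmoothDesign {Ω : Type*} [MeasurableSpace Ω] (P : Measure Ω) [IsFiniteMeasure P]
    (Z X X₀ X₁ : Ω → ℝ) (κ₀ : ℝ) (S : ℕ) (μm μp sm sp : ℝ → ℝ) : Prop where
  radius_pos : 0 < κ₀
  fourthMoment : HasBoundedCondFourthMomentOn P X Z (Set.Ioo (-κ₀) κ₀)
  density : HasRegularDensityOn P Z (Set.Ioo (-κ₀) κ₀)
  mean_control : HasCondMeanOn P X₀ Z (Set.Ioo (-κ₀) κ₀) μm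
  mean_treated : HasCondMeanOn P X₁ Z (Set.Ioo (-κ₀) κ₀) μp
  smooth_control : ContDiffOn ℝ (S : WithTop ℕ∞) μm (Set.Ioo (-κ₀) κ₀)
  smooth_treated : ContDiffOn ℝ (S : WithTop ℕ∞) μp (Set.Ioo (-κ₀) κ₀)
  var_control : HasCondVarOn P X₀ Z (Set.Ioo (-κ₀) κ₀) sm
  var_treated : HasCondVarOn P X₁ Z (Set.Ioo (-κ₀) κ₀) sp
  cont_var_control : ContinuousOn sm (Set.Ioo (-κ₀) κ₀)
  cont_var_treated : ContinuousOn sp (Set.Ioo (-κ₀) κ₀)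
  var_control_lower : ∃ c : ℝ, 0 < c ∧ ∀ z ∈ Set.Ioo (-κ₀) κ₀, c ≤ sm z
  var_treated_lower : ∃ c : ℝ, 0 < c ∧ ∀ z ∈ Set.Ioo (-κ₀) κ₀, c ≤ sp z

/-- A symmetric kernel on `ℝ` that vanishes outside `[-κ, κ]`, is bounded and nonnegative, and is
positive and continuous on `(0, κ)`. -/
structure IsKernel (K : ℝ → ℝ) (κ : ℝ) : Prop where
  radius_pos : 0 < κ
  bounded : ∃ C : ℝ, ∀ u, K u ≤ C
  nonneg : ∀ u, 0 ≤ K u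
  support : ∀ u, κ < |u| → K u = 0
  symm : ∀ u, K (-u) = K u
  pos : ∀ u ∈ Set.Ioo 0 κ, 0 < K u
  cont : ContinuousOn K (Set.Ioo 0 κ)

/-! ### The estimand -/

/-- The function that is `g` on `[0, ∞)` and `f` on `(-∞, 0)`. -/
def glue (f g : ℝ → ℝ) (z : ℝ) : ℝ := if 0 ≤ z then g z else f z

/-- The estimand `τ_ν = Δμ₊^(ν) - Δμ₋^(ν)`, the difference between the right and the left limit at
the cutoff of the `ν`-th derivative of the regression function `Δμ(z) = E[ΔY | Z = z]`. -/
def estimand (ν : ℕ) (Δμ : ℝ → ℝ) : ℝ :=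
  limUnder (𝓝[>] (0 : ℝ)) (iteratedDeriv ν Δμ) - limUnder (𝓝[<] (0 : ℝ)) (iteratedDeriv ν Δμ)

/-! ### Local polynomial estimation

The set `A` is the side of the cutoff that is used: `Set.Ici 0` or `Set.Iio 0`. -/

/-- The unit vector `e_ν` of length `p + 1`, for `ν ≤ p`. -/
def unitVec (p ν : ℕ) : Fin (p + 1) → ℝ := fun j => if (j : ℕ) = ν then 1 else 0

/-- The matrix `Z_p(h)`, with rows `r_p(Z_i / h)'`, where `r_p(x) = (1, x, …, x ^ p)'`. -/
def polyMat {n : ℕ} (p : ℕ) (h : ℝ) (z : Fin n → ℝ) : Matrix (Fin n) (Fin (p + 1)) ℝ :=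
  Matrix.of fun i j => (z i / h) ^ (j : ℕ)

/-- The vector `S_r(h) = ((Z_1 / h) ^ r, …, (Z_n / h) ^ r)'`. -/
def powVec {n : ℕ} (r : ℕ) (h : ℝ) (z : Fin n → ℝ) : Fin n → ℝ := fun i => (z i / h) ^ r

/-- The weight `1(x ∈ A) K_h(x)`, where `K_h(x) = K(x / h) / h`. -/
def weight (A : Set ℝ) (K : ℝ → ℝ) (h : ℝ) : ℝ → ℝ := A.indicator fun x => K (x / h) / h

/-- The diagonal matrix `W(h)` of weights. -/
def weightMat {n : ℕ} (A : Set ℝ) (K : ℝ → ℝ) (h : ℝ) (z : Fin n → ℝ) :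
    Matrix (Fin n) (Fin n) ℝ :=
  Matrix.diagonal fun i => weight A K h (z i)

/-- `H_p(h) = diag(1, h⁻¹, …, h⁻ᵖ)`. -/
def scaleMat (p : ℕ) (h : ℝ) : Matrix (Fin (p + 1)) (Fin (p + 1)) ℝ :=
  Matrix.diagonal fun j => (h ^ (j : ℕ))⁻¹

/-- `Γ_p(h) = Z_p(h)' W(h) Z_p(h) / n`. -/
def Gam {n : ℕ} (A : Set ℝ) (K : ℝ → ℝ) (p : ℕ) (h : ℝ) (z : Fin n → ℝ) :
    Matrix (Fin (p + 1)) (Fin (p + 1)) ℝ :=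
  (n : ℝ)⁻¹ • ((polyMat p h z)ᵀ * weightMat A K h z * polyMat p h z)

/-- `ϑ_{p,r}(h) = Z_p(h)' W(h) S_r(h) / n`. -/
def Theta {n : ℕ} (A : Set ℝ) (K : ℝ → ℝ) (p r : ℕ) (h : ℝ) (z : Fin n → ℝ) : Fin (p + 1) → ℝ :=
  (n : ℝ)⁻¹ • (((polyMat p h z)ᵀ * weightMat A K h z) *ᵥ powVec r h z)

/-- `Ψ_{p,q}(h,b) = Z_p(h)' W(h) Σ W(b) Z_q(b) / n`, with
`Σ = diag(V[ΔY_1 | Z_1], …, V[ΔY_n | Z_n])`, where `V[ΔY_i | Z_i] = s(Z_i)`. -/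
def Psi {n : ℕ} (A : Set ℝ) (K : ℝ → ℝ) (s : ℝ → ℝ) (p q : ℕ) (h b : ℝ) (z : Fin n → ℝ) :
    Matrix (Fin (p + 1)) (Fin (q + 1)) ℝ :=
  (n : ℝ)⁻¹ • ((polyMat p h z)ᵀ * weightMat A K h z * Matrix.diagonal (fun i => s (z i))
    * weightMat A K b z * polyMat q b z)

/-- The weighted least squares criterion
`∑ᵢ 1(Z_i ∈ A) (ΔY_i - r_p(Z_i)' δ)² K_h(Z_i)` of the `p`-th order local polynomial fit. -/
def wlsLoss {n : ℕ} (A : Set ℝ) (K : ℝ → ℝ) (p : ℕ) (h : ℝ) (z y : Fin n → ℝ)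
    (δ : Fin (p + 1) → ℝ) : ℝ :=
  ∑ i, weight A K h (z i) * (y i - ∑ j : Fin (p + 1), (z i) ^ (j : ℕ) * δ j) ^ 2

/-- The coefficients of the `p`-th order local polynomial fit,
`δ̂_p(h) = H_p(h) Γ_p(h)⁻¹ Z_p(h)' W(h) ΔY / n`. -/
def deltaHat {n : ℕ} (A : Set ℝ) (K : ℝ → ℝ) (p : ℕ) (h : ℝ) (z y : Fin n → ℝ) :
    Fin (p + 1) → ℝ :=
  scaleMat p h *ᵥ ((Gam A K p h z)⁻¹ *ᵥ
    ((n : ℝ)⁻¹ • (((polyMat p h z)ᵀ * weightMat A K h z) *ᵥ y)))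

/-- `deltaHat` is the unique minimizer of the weighted least squares criterion whenever `Γ_p(h)` is
invertible. -/
theorem wlsLoss_deltaHat_lt {n : ℕ} (A : Set ℝ) (K : ℝ → ℝ) (hK : ∀ u, 0 ≤ K u) (p : ℕ) (h : ℝ)
    (hh : 0 < h) (z y : Fin n → ℝ) (hΓ : IsUnit (Gam A K p h z).det) (δ : Fin (p + 1) → ℝ)
    (hδ : δ ≠ deltaHat A K p h z y) :
    wlsLoss A K p h z y (deltaHat A K p h z y) < wlsLoss A K p h z y δ := by
  set M : Matrix (Fin n) (Fin (p + 1)) ℝ := polyMat p h z with hM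
  set w : Fin n → ℝ := fun i => weight A K h (z i) with hw
  have hw0 : ∀ i, 0 ≤ w i := fun i =>
    Set.indicator_nonneg (fun x _ => div_nonneg (hK _) hh.le) _
  set g : Fin (p + 1) → ℝ := (Gam A K p h z)⁻¹ *ᵥ
    ((n : ℝ)⁻¹ • (((polyMat p h z)ᵀ * weightMat A K h z) *ᵥ y)) with hg
  have hn : (n : ℝ) ≠ 0 := by
    intro h0
    rw [Gam, h0, _root_.inv_zero, zero_smul, Matrix.det_zero] at hΓ
    exact not_isUnit_zero hΓ
  have hfit : ∀ (d : Fin (p + 1) → ℝ) (i : Fin n),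
      ∑ j : Fin (p + 1), (z i) ^ (j : ℕ) * d j = (M *ᵥ (fun j : Fin (p + 1) => h ^ (j : ℕ) * d j : Fin (p + 1) → ℝ)) i := by
    intro d i
    simp only [Matrix.mulVec, dotProduct, hM, polyMat, Matrix.of_apply]
    refine Finset.sum_congr rfl fun j _ => ?_
    rw [div_pow]
    field_simp
  have hscale : (fun j : Fin (p + 1) => h ^ (j : ℕ) * deltaHat A K p h z y j) = g := by
    ext j
    rw [deltaHat, ← hg, scaleMat, Matrix.mulVec_diagonal]
    field_simp
  have hnormal : (Mᵀ * weightMat A K h z) *ᵥ (y - M *ᵥ g) = 0 := by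
    have h1 : Gam A K p h z *ᵥ g = (n : ℝ)⁻¹ • ((Mᵀ * weightMat A K h z) *ᵥ y) := by
      rw [hg, Matrix.mulVec_mulVec, Matrix.mul_nonsing_inv _ hΓ, Matrix.one_mulVec]
    rw [Gam, Matrix.smul_mulVec] at h1
    have h2 := smul_right_injective _ (inv_ne_zero hn) h1
    rw [Matrix.mulVec_sub, Matrix.mulVec_mulVec, ← h2, sub_self]
  set d : Fin (p + 1) → ℝ := (fun j : Fin (p + 1) => h ^ (j : ℕ) * δ j) - g with hd
  have hd0 : d ≠ 0 := by
    intro h0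
    apply hδ
    ext j
    have h1 := congrFun (sub_eq_zero.mp h0) j
    rw [← hscale] at h1
    exact mul_left_cancel₀ (pow_ne_zero _ hh.ne') h1
  have hcross : ∑ i, w i * (y i - (M *ᵥ g) i) * (M *ᵥ d) i = 0 := by
    have h1 : d ⬝ᵥ ((Mᵀ * weightMat A K h z) *ᵥ (y - M *ᵥ g)) = 0 := by
      rw [hnormal, dotProduct_zero]
    rw [← Matrix.mulVec_mulVec, Matrix.dotProduct_mulVec, Matrix.vecMul_transpose, weightMat]
      at h1
    rw [← h1, dotProduct]
    refine Finset.sum_congr rfl fun i _ => ?_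
    rw [Matrix.mulVec_diagonal, Pi.sub_apply]
    ring
  have hpos : 0 < ∑ i, w i * ((M *ᵥ d) i) ^ 2 := by
    refine lt_of_le_of_ne (Finset.sum_nonneg fun i _ => mul_nonneg (hw0 i) (sq_nonneg _)) ?_
    intro h0
    have h1 := (Finset.sum_eq_zero_iff_of_nonneg
      (fun i _ => mul_nonneg (hw0 i) (sq_nonneg _))).mp h0.symm
    have h2 : weightMat A K h z *ᵥ (M *ᵥ d) = 0 := by
      ext i
      rw [weightMat, Matrix.mulVec_diagonal, Pi.zero_apply]
      rcases mul_eq_zero.mp (h1 i (Finset.mem_univ i)) with h3 | h3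
      · exact mul_eq_zero_of_left h3 _
      · exact mul_eq_zero_of_right _ (pow_eq_zero_iff two_ne_zero |>.mp h3)
    apply hd0
    have h3 : Gam A K p h z *ᵥ d = 0 := by
      rw [Gam, Matrix.smul_mulVec, ← Matrix.mulVec_mulVec, ← Matrix.mulVec_mulVec, h2,
        Matrix.mulVec_zero, smul_zero]
    calc d = ((Gam A K p h z)⁻¹ * Gam A K p h z) *ᵥ d := by
          rw [Matrix.nonsing_inv_mul _ hΓ, Matrix.one_mulVec]
      _ = 0 := by rw [← Matrix.mulVec_mulVec, h3, Matrix.mulVec_zero]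
  have hsplit : wlsLoss A K p h z y δ = wlsLoss A K p h z y (deltaHat A K p h z y)
      + ∑ i, w i * ((M *ᵥ d) i) ^ 2 := by
    have h1 : ∀ i, (M *ᵥ (fun j : Fin (p + 1) => h ^ (j : ℕ) * δ j : Fin (p + 1) → ℝ)) i = (M *ᵥ g) i + (M *ᵥ d) i := by
      intro i
      rw [hd, Matrix.mulVec_sub, Pi.sub_apply]
      ring
    have h2 : wlsLoss A K p h z y δ = ∑ i, (w i * (y i - (M *ᵥ g) i) ^ 2
        - 2 * (w i * (y i - (M *ᵥ g) i) * (M *ᵥ d) i) + w i * ((M *ᵥ d) i) ^ 2) := by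
      rw [wlsLoss]
      refine Finset.sum_congr rfl fun i _ => ?_
      rw [hfit, h1]
      ring
    have h3 : wlsLoss A K p h z y (deltaHat A K p h z y)
        = ∑ i, w i * (y i - (M *ᵥ g) i) ^ 2 := by
      rw [wlsLoss]
      refine Finset.sum_congr rfl fun i _ => ?_
      rw [hfit, hscale]
    rw [h2, h3, Finset.sum_add_distrib, Finset.sum_sub_distrib, ← Finset.mul_sum, hcross]
    ring
  rw [hsplit]
  linarith

/-- The estimator `Δμ̂_p^(ν)(h) = ν! e_ν' δ̂_p(h)` of the `ν`-th derivative at the cutoff. -/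
def muHat {n : ℕ} (A : Set ℝ) (K : ℝ → ℝ) (ν p : ℕ) (h : ℝ) (z y : Fin n → ℝ) : ℝ :=
  (ν ! : ℝ) * (unitVec p ν ⬝ᵥ deltaHat A K p h z y)

/-- `𝓑_{ν,p,r}(h) = ν! e_ν' Γ_p(h)⁻¹ ϑ_{p,r}(h)`. -/
def biasB {n : ℕ} (A : Set ℝ) (K : ℝ → ℝ) (ν p r : ℕ) (h : ℝ) (z : Fin n → ℝ) : ℝ :=
  (ν ! : ℝ) * (unitVec p ν ⬝ᵥ ((Gam A K p h z)⁻¹ *ᵥ Theta A K p r h z))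

/-- `𝓥_{ν,p}(h) = ν!² e_ν' Γ_p(h)⁻¹ Ψ_{p,p}(h,h) Γ_p(h)⁻¹ e_ν / (n h^(2ν))`. -/
def varV {n : ℕ} (A : Set ℝ) (K : ℝ → ℝ) (s : ℝ → ℝ) (ν p : ℕ) (h : ℝ) (z : Fin n → ℝ) : ℝ :=
  1 / ((n : ℝ) * h ^ (2 * ν)) * (ν ! : ℝ) ^ 2 *
    (unitVec p ν ⬝ᵥ (((Gam A K p h z)⁻¹ * Psi A K s p p h h z * (Gam A K p h z)⁻¹) *ᵥ unitVec p ν))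

/-- `𝓒_{ν,p,q}(h,b) = ν! (p+1)! e_ν' Γ_p(h)⁻¹ Ψ_{p,q}(h,b) Γ_q(b)⁻¹ e_{p+1} / (n h^ν b^(p+1))`. -/
def covC {n : ℕ} (A : Set ℝ) (K : ℝ → ℝ) (s : ℝ → ℝ) (ν p q : ℕ) (h b : ℝ) (z : Fin n → ℝ) : ℝ :=
  1 / ((n : ℝ) * h ^ ν * b ^ (p + 1)) * (ν ! : ℝ) * ((p + 1)! : ℝ) *
    (unitVec p ν ⬝ᵥ
      (((Gam A K p h z)⁻¹ * Psi A K s p q h b z * (Gam A K q b z)⁻¹) *ᵥ unitVec q (p + 1)))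

/-- The variance `𝓥^bc_{ν,p,q}(h,b)` of the bias-corrected estimator on one side of the cutoff. -/
def varVbc {n : ℕ} (A : Set ℝ) (K : ℝ → ℝ) (s : ℝ → ℝ) (ν p q : ℕ) (h b : ℝ)
    (z : Fin n → ℝ) : ℝ :=
  varV A K s ν p h z
    + h ^ (2 * (p + 1 - ν)) * varV A K s (p + 1) q b z
        * ((biasB A K ν p (p + 1) h z) ^ 2 / ((p + 1)! : ℝ) ^ 2)
    - 2 * h ^ (p + 1 - ν) * covC A K s ν p q h b z
        * (biasB A K ν p (p + 1) h z / ((p + 1)! : ℝ))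

/-- The local polynomial estimator `τ̂_{ν,p}(h) = Δμ̂₊^(ν)(h) - Δμ̂₋^(ν)(h)`. -/
def tauHat {n : ℕ} (K : ℝ → ℝ) (ν p : ℕ) (h : ℝ) (z y : Fin n → ℝ) : ℝ :=
  muHat (Set.Ici 0) K ν p h z y - muHat (Set.Iio 0) K ν p h z y

/-- The estimated leading bias `B̂_{ν,p,q}(h,b)`, in which the derivatives of order `p + 1` come from
local polynomial fits of order `q` with bandwidth `b`. -/
def biasHat {n : ℕ} (K : ℝ → ℝ) (ν p q : ℕ) (h b : ℝ) (z y : Fin n → ℝ) : ℝ :=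
  muHat (Set.Ici 0) K (p + 1) q b z y / ((p + 1)! : ℝ) * biasB (Set.Ici 0) K ν p (p + 1) h z
    - muHat (Set.Iio 0) K (p + 1) q b z y / ((p + 1)! : ℝ) * biasB (Set.Iio 0) K ν p (p + 1) h z

/-- The bias-corrected estimator `τ̂^bc_{ν,p,q}(h,b) = τ̂_{ν,p}(h) - h^(p+1-ν) B̂_{ν,p,q}(h,b)`. -/
def tauBC {n : ℕ} (K : ℝ → ℝ) (ν p q : ℕ) (h b : ℝ) (z y : Fin n → ℝ) : ℝ :=
  tauHat K ν p h z y - h ^ (p + 1 - ν) * biasHat K ν p q h b z y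

/-- The variance `V^bc_{ν,p,q}(h,b)`, the sum of the variances on the two sides of the cutoff. -/
def varBC {n : ℕ} (K : ℝ → ℝ) (s : ℝ → ℝ) (ν p q : ℕ) (h b : ℝ) (z : Fin n → ℝ) : ℝ :=
  varVbc (Set.Ici 0) K s ν p q h b z + varVbc (Set.Iio 0) K s ν p q h b z

/-- The robust bias-corrected t-statistic `T^rbc_{ν,p,q}(h,b)`, centred at `τ`. -/
def tStat {n : ℕ} (K : ℝ → ℝ) (s : ℝ → ℝ) (τ : ℝ) (ν p q : ℕ) (h b : ℝ) (z y : Fin n → ℝ) : ℝ :=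
  (tauBC K ν p q h b z y - τ) / Real.sqrt (varBC K s ν p q h b z)

end DiDC

end

noncomputable section

namespace DiDC

/-! Given the running variables the statistic is linear in the outcomes: the bias-corrected
estimator is `∑ a i * ΔY i` with weights depending on `Z` only (`tauBC_eq_sum`), and `varBC` is
exactly its conditional variance `∑ a i ^ 2 * σ² (Z i)` (`varBC_eq_sum`). The outcomes are
conditionally independent, with bounded fourth moments and variances bounded below near the cutoff.
A conditional Lyapunov argument for characteristic functions (`norm_exp_mul_prod_charFun_sub_le`)
therefore needs two facts only, on an event of probability tending to one: `max |a i| = o(‖a‖₂)` and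
`∑ a i * μ (Z i) - τ = o(‖a‖₂)`. Characteristic functions are bounded by one, so integrating over
the running variables costs at most twice the probability of the complement
(`tendsto_charFun_studentized`).

Write `m = min h b`. Exactness on polynomials and Taylor expansion bound the bias by a multiple of
`h^(p+1-ν) (h + b^(q-p))`, and `|a i|` is at most of order `h^(p+1-ν) / (n m^(p+2))`. The crux is
the lower bound `‖a‖₂² ≥ c h^(2(p+1-ν)) / (n m^(2p+3))` of `exists_le_sum_sq_corrected`, which must
hold whatever the ratio `h / b` does. It comes by duality, pairing `a` with a power of `z` cut off
to a window, in three regimes of `h / b`. With it the two quotients are of order `(n m)^(-1/2)` and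
`(n m^(2p+3))^(1/2) (h + b^(q-p))`, which the rate conditions send to zero.

When `b` is much smaller than `h`, the estimated bias dominates, and its coefficient
`𝓑_{ν,p,p+1}(h)` must stay away from zero. The entries of `Γ⁻¹ ϑ` are, up to sign, the lower
coefficients of the monic orthogonal polynomial of degree `p + 1` of the kernel-weighted sample.
That measure lives on one side of the cutoff, so the roots are real, lie on that side and keep a
distance from zero; the coefficients are then sums of products of one sign
(`IsSideMeasure.pow_le_abs_coeff`).

All constants depend on the sample only through numbers of observations in a window and in finitely
many boxes. These are controlled by Chebyshev's inequality (`exists_tendsto_goodSet`), so no limit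
of `Γ_p` is needed. -/

/-! ### Estimators and variances as sums over the observations -/

/-- The weight that the local polynomial estimator `muHat` of the `ν`-th derivative puts on the
`i`-th outcome. -/
def lpWeight {n : ℕ} (A : Set ℝ) (K : ℝ → ℝ) (ν p : ℕ) (h : ℝ) (z : Fin n → ℝ) (i : Fin n) : ℝ :=
  (ν ! : ℝ) * (h ^ ν)⁻¹ *
    (unitVec p ν ⬝ᵥ ((Gam A K p h z)⁻¹ *ᵥ fun j : Fin (p + 1) => (z i / h) ^ (j : ℕ)))
    * weight A K h (z i) * (n : ℝ)⁻¹

theorem Gam_apply {n : ℕ} (A : Set ℝ) (K : ℝ → ℝ) (p : ℕ) (h : ℝ) (z : Fin n → ℝ)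
    (j k : Fin (p + 1)) :
    Gam A K p h z j k
      = ∑ i, weight A K h (z i) * (n : ℝ)⁻¹ * ((z i / h) ^ (j : ℕ) * (z i / h) ^ (k : ℕ)) := by
  rw [Gam, Matrix.smul_apply, Matrix.mul_apply, smul_eq_mul, Finset.mul_sum]
  simp only [polyMat, weightMat, Matrix.mul_diagonal, Matrix.transpose_apply, Matrix.of_apply]
  exact Finset.sum_congr rfl fun i _ => by ring

theorem Theta_apply {n : ℕ} (A : Set ℝ) (K : ℝ → ℝ) (p r : ℕ) (h : ℝ) (z : Fin n → ℝ)
    (j : Fin (p + 1)) :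
    Theta A K p r h z j
      = ∑ i, weight A K h (z i) * (n : ℝ)⁻¹ * ((z i / h) ^ (j : ℕ) * (z i / h) ^ r) := by
  simp only [Theta, polyMat, weightMat, powVec, Pi.smul_apply, Matrix.mulVec, dotProduct,
    Matrix.mul_diagonal, Matrix.transpose_apply, Matrix.of_apply, smul_eq_mul, Finset.mul_sum]
  exact Finset.sum_congr rfl fun i _ => by ring

theorem Gam_transpose {n : ℕ} (A : Set ℝ) (K : ℝ → ℝ) (p : ℕ) (h : ℝ) (z : Fin n → ℝ) :
    (Gam A K p h z)ᵀ = Gam A K p h z := by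
  ext j k
  rw [Matrix.transpose_apply, Gam_apply, Gam_apply]
  exact Finset.sum_congr rfl fun i _ => by ring

theorem unitVec_dotProduct (p ν : ℕ) (hν : ν ≤ p) (v : Fin (p + 1) → ℝ) :
    unitVec p ν ⬝ᵥ v = v ⟨ν, Nat.lt_succ_of_le hν⟩ := by
  simp only [unitVec, dotProduct, ite_mul, one_mul, zero_mul]
  rw [Finset.sum_eq_single (⟨ν, Nat.lt_succ_of_le hν⟩ : Fin (p + 1))]
  · simp
  · intro b _ hb
    rw [if_neg]
    intro h
    exact hb (Fin.ext h)
  · simp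

theorem polyMat_row {n : ℕ} (p : ℕ) (h : ℝ) (z : Fin n → ℝ) (i : Fin n) :
    polyMat p h z i = fun j : Fin (p + 1) => (z i / h) ^ (j : ℕ) := rfl

/-- The common shape of `muHat` and `biasB`. Only transposition is used, so the formula also covers
a singular `Γ`, whose `⁻¹` is zero. -/
theorem dotProduct_inv_mulVec_wls {n m : ℕ} (e : Fin m → ℝ) (G : Matrix (Fin m) (Fin m) ℝ)
    (M : Matrix (Fin n) (Fin m) ℝ) (w y : Fin n → ℝ) (c : ℝ) :
    e ⬝ᵥ (G *ᵥ (c • ((Mᵀ * Matrix.diagonal w) *ᵥ y)))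
      = ∑ i, (e ⬝ᵥ (G *ᵥ M i)) * w i * c * y i := by
  rw [Matrix.mulVec_smul, dotProduct_smul, Matrix.dotProduct_mulVec, Matrix.dotProduct_mulVec,
    ← Matrix.vecMul_vecMul, Matrix.vecMul_transpose]
  simp only [dotProduct, smul_eq_mul, Matrix.vecMul_diagonal, Finset.mul_sum]
  refine Finset.sum_congr rfl fun i _ => ?_
  have : (M *ᵥ (e ᵥ* G)) i = ∑ x, e x * (G *ᵥ M i) x := by
    change (M i) ⬝ᵥ (e ᵥ* G) = e ⬝ᵥ (G *ᵥ M i)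
    rw [Matrix.dotProduct_mulVec, dotProduct_comm]
  rw [this]
  ring

theorem muHat_eq_sum {n : ℕ} (A : Set ℝ) (K : ℝ → ℝ) (ν p : ℕ) (hν : ν ≤ p) (h : ℝ)
    (z y : Fin n → ℝ) :
    muHat A K ν p h z y = ∑ i, lpWeight A K ν p h z i * y i := by
  have h1 : ∀ v : Fin (p + 1) → ℝ,
      unitVec p ν ⬝ᵥ (scaleMat p h *ᵥ v) = (h ^ ν)⁻¹ * (unitVec p ν ⬝ᵥ v) := fun v => by
    rw [unitVec_dotProduct p ν hν, unitVec_dotProduct p ν hν, scaleMat, Matrix.mulVec_diagonal]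
  rw [muHat, deltaHat, h1, weightMat, dotProduct_inv_mulVec_wls, Finset.mul_sum, Finset.mul_sum]
  refine Finset.sum_congr rfl fun i _ => ?_
  rw [lpWeight, polyMat_row]
  ring

/-- The bias constant is the estimator applied to the monomial `z ^ r`; this makes the correction
term expressible through the weights alone. -/
theorem biasB_eq_sum {n : ℕ} (A : Set ℝ) (K : ℝ → ℝ) (ν p r : ℕ) (hν : ν ≤ r) (h : ℝ)
    (hh : 0 < h) (z : Fin n → ℝ) :
    h ^ (r - ν) * biasB A K ν p r h z = ∑ i, lpWeight A K ν p h z i * z i ^ r := by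
  rw [biasB, Theta, weightMat, dotProduct_inv_mulVec_wls, Finset.mul_sum, Finset.mul_sum]
  refine Finset.sum_congr rfl fun i _ => ?_
  rw [lpWeight, polyMat_row, powVec, div_pow]
  obtain ⟨k, rfl⟩ := Nat.exists_eq_add_of_le hν
  rw [Nat.add_sub_cancel_left, pow_add h ν k]
  field_simp

/-- Since `Σ` is diagonal, sandwich variances and covariances are sums of products of weights. The
symmetry of `G'` carries `e'` over to the row `N i`. -/
theorem dotProduct_sandwich {n m l : ℕ} (e : Fin m → ℝ) (e' : Fin l → ℝ)
    (G : Matrix (Fin m) (Fin m) ℝ) (G' : Matrix (Fin l) (Fin l) ℝ) (hG' : G'ᵀ = G')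
    (M : Matrix (Fin n) (Fin m) ℝ) (N : Matrix (Fin n) (Fin l) ℝ) (w s w' : Fin n → ℝ) (c : ℝ) :
    e ⬝ᵥ ((G * (c • (Mᵀ * Matrix.diagonal w * Matrix.diagonal s * Matrix.diagonal w' * N)) * G')
        *ᵥ e')
      = ∑ i, c * ((e ⬝ᵥ (G *ᵥ M i)) * w i) * ((e' ⬝ᵥ (G' *ᵥ N i)) * w' i) * s i := by
  have h1 : (Matrix.diagonal s * Matrix.diagonal w' * N) *ᵥ (G' *ᵥ e')
      = fun i => s i * w' i * (e' ⬝ᵥ (G' *ᵥ N i)) := by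
    ext i
    rw [← Matrix.mulVec_mulVec, Matrix.diagonal_mul_diagonal, Matrix.mulVec_diagonal]
    congr 1
    change N i ⬝ᵥ (G' *ᵥ e') = _
    rw [Matrix.dotProduct_mulVec, dotProduct_comm, ← Matrix.mulVec_transpose, hG']
  have h2 : (G * (c • (Mᵀ * Matrix.diagonal w * Matrix.diagonal s * Matrix.diagonal w' * N)) * G')
        *ᵥ e' = G *ᵥ (c • ((Mᵀ * Matrix.diagonal w) *ᵥ
          ((Matrix.diagonal s * Matrix.diagonal w' * N) *ᵥ (G' *ᵥ e')))) := by
    rw [Matrix.mulVec_mulVec, Matrix.mulVec_mulVec, ← Matrix.smul_mulVec, Matrix.mulVec_mulVec]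
    simp only [Matrix.mul_assoc, Matrix.smul_mul]
  rw [h2, h1, dotProduct_inv_mulVec_wls]
  exact Finset.sum_congr rfl fun i _ => by ring

theorem varV_eq_sum {n : ℕ} (A : Set ℝ) (K s : ℝ → ℝ) (ν p : ℕ) (h : ℝ) (hh : 0 < h)
    (z : Fin n → ℝ) :
    varV A K s ν p h z = ∑ i, lpWeight A K ν p h z i ^ 2 * s (z i) := by
  have hG : ((Gam A K p h z)⁻¹)ᵀ = (Gam A K p h z)⁻¹ := by
    rw [Matrix.transpose_nonsing_inv, Gam_transpose]
  rw [varV, Psi, weightMat, dotProduct_sandwich _ _ _ _ hG, Finset.mul_sum]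
  refine Finset.sum_congr rfl fun i _ => ?_
  rw [lpWeight, polyMat_row]
  have hn : (n : ℝ) ≠ 0 := by
    have := i.pos
    positivity
  field_simp
  ring

theorem covC_eq_sum {n : ℕ} (A : Set ℝ) (K s : ℝ → ℝ) (ν p q : ℕ) (h b : ℝ) (hh : 0 < h)
    (hb : 0 < b) (z : Fin n → ℝ) :
    covC A K s ν p q h b z
      = ∑ i, lpWeight A K ν p h z i * lpWeight A K (p + 1) q b z i * s (z i) := by
  have hG : ((Gam A K q b z)⁻¹)ᵀ = (Gam A K q b z)⁻¹ := by
    rw [Matrix.transpose_nonsing_inv, Gam_transpose]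
  rw [covC, Psi, weightMat, weightMat, dotProduct_sandwich _ _ _ _ hG, Finset.mul_sum]
  refine Finset.sum_congr rfl fun i _ => ?_
  rw [lpWeight, lpWeight, polyMat_row, polyMat_row]
  have hn : (n : ℝ) ≠ 0 := by
    have := i.pos
    positivity
  field_simp

/-- The weight that the bias-corrected estimator of one side puts on the `i`-th outcome. -/
def bcWeight {n : ℕ} (A : Set ℝ) (K : ℝ → ℝ) (ν p q : ℕ) (h b : ℝ) (z : Fin n → ℝ)
    (i : Fin n) : ℝ :=
  lpWeight A K ν p h z i
    - (∑ j, lpWeight A K ν p h z j * z j ^ (p + 1)) / ((p + 1)! : ℝ)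
      * lpWeight A K (p + 1) q b z i

/-- The three terms of `varVbc` are the expansion of the square of `bcWeight`, hence the
studentization is by the exact conditional variance. -/
theorem varVbc_eq_sum {n : ℕ} (A : Set ℝ) (K s : ℝ → ℝ) (ν p q : ℕ) (hν : ν ≤ p) (h b : ℝ)
    (hh : 0 < h) (hb : 0 < b) (z : Fin n → ℝ) :
    varVbc A K s ν p q h b z = ∑ i, bcWeight A K ν p q h b z i ^ 2 * s (z i) := by
  rw [varVbc, varV_eq_sum _ _ _ _ _ _ hh, varV_eq_sum _ _ _ _ _ _ hb,
    covC_eq_sum _ _ _ _ _ _ _ _ hh hb]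
  simp only [bcWeight]
  rw [← biasB_eq_sum A K ν p (p + 1) (by omega) h hh z]
  set B := biasB A K ν p (p + 1) h z
  have : ∀ i, (lpWeight A K ν p h z i
      - h ^ (p + 1 - ν) * B / ((p + 1)! : ℝ) * lpWeight A K (p + 1) q b z i) ^ 2 * s (z i)
      = lpWeight A K ν p h z i ^ 2 * s (z i)
        + (h ^ (p + 1 - ν) * B / ((p + 1)! : ℝ)) ^ 2
          * (lpWeight A K (p + 1) q b z i ^ 2 * s (z i))
        - 2 * (h ^ (p + 1 - ν) * B / ((p + 1)! : ℝ))
          * (lpWeight A K ν p h z i * lpWeight A K (p + 1) q b z i * s (z i)) := fun i => by ring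
  simp only [this, Finset.sum_sub_distrib, Finset.sum_add_distrib, ← Finset.mul_sum]
  rw [pow_mul']
  ring

/-- The weight that the bias-corrected estimator puts on the `i`-th outcome. -/
def tauWeight {n : ℕ} (K : ℝ → ℝ) (ν p q : ℕ) (h b : ℝ) (z : Fin n → ℝ) (i : Fin n) : ℝ :=
  bcWeight (Set.Ici 0) K ν p q h b z i - bcWeight (Set.Iio 0) K ν p q h b z i

theorem tauBC_eq_sum {n : ℕ} (K : ℝ → ℝ) (ν p q : ℕ) (hν : ν ≤ p) (hpq : p < q) (h b : ℝ)
    (hh : 0 < h) (z y : Fin n → ℝ) :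
    tauBC K ν p q h b z y = ∑ i, tauWeight K ν p q h b z i * y i := by
  rw [tauBC, tauHat, biasHat]
  simp only [tauWeight, bcWeight]
  rw [← biasB_eq_sum _ K ν p (p + 1) (by omega) h hh z,
    ← biasB_eq_sum _ K ν p (p + 1) (by omega) h hh z]
  simp only [muHat_eq_sum _ _ _ _ hν, muHat_eq_sum _ _ (p + 1) q hpq]
  simp only [sub_mul, Finset.sum_sub_distrib, mul_assoc, ← Finset.mul_sum]
  ring

theorem lpWeight_of_notMem {n : ℕ} (A : Set ℝ) (K : ℝ → ℝ) (ν p : ℕ) (h : ℝ) (z : Fin n → ℝ)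
    (i : Fin n) (hi : z i ∉ A) : lpWeight A K ν p h z i = 0 := by
  simp [lpWeight, weight, hi]

theorem bcWeight_of_notMem {n : ℕ} (A : Set ℝ) (K : ℝ → ℝ) (ν p q : ℕ) (h b : ℝ)
    (z : Fin n → ℝ) (i : Fin n) (hi : z i ∉ A) : bcWeight A K ν p q h b z i = 0 := by
  simp [bcWeight, lpWeight_of_notMem _ _ _ _ _ _ _ hi]

/-- Weights of the two sides have disjoint supports, so the cross term vanishes. -/
theorem tauWeight_sq {n : ℕ} (K : ℝ → ℝ) (ν p q : ℕ) (h b : ℝ) (z : Fin n → ℝ) (i : Fin n) :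
    tauWeight K ν p q h b z i ^ 2
      = bcWeight (Set.Ici 0) K ν p q h b z i ^ 2 + bcWeight (Set.Iio 0) K ν p q h b z i ^ 2 := by
  rw [tauWeight]
  rcases le_or_gt 0 (z i) with hz | hz
  · rw [bcWeight_of_notMem (Set.Iio 0) K ν p q h b z i (by simpa using hz)]
    ring
  · rw [bcWeight_of_notMem (Set.Ici 0) K ν p q h b z i (by simpa using hz)]
    ring

theorem varBC_eq_sum {n : ℕ} (K s : ℝ → ℝ) (ν p q : ℕ) (hν : ν ≤ p) (h b : ℝ)
    (hh : 0 < h) (hb : 0 < b) (z : Fin n → ℝ) :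
    varBC K s ν p q h b z = ∑ i, tauWeight K ν p q h b z i ^ 2 * s (z i) := by
  rw [varBC, varVbc_eq_sum _ _ _ _ _ _ hν _ _ hh hb, varVbc_eq_sum _ _ _ _ _ _ hν _ _ hh hb]
  simp only [tauWeight_sq, add_mul, Finset.sum_add_distrib]

/-- For `k ≤ p` the vector `ϑ_{p,k}` is the `k`-th column of `Γ_p`, so `Γ_p⁻¹ ϑ_{p,k}` is a unit
vector: local polynomial fits are exact on polynomials. -/
theorem sum_lpWeight_mul_pow {n : ℕ} (A : Set ℝ) (K : ℝ → ℝ) (ν p k : ℕ) (hν : ν ≤ p)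
    (hk : k ≤ p) (h : ℝ) (hh : 0 < h) (z : Fin n → ℝ) (hΓ : IsUnit (Gam A K p h z).det) :
    ∑ i, lpWeight A K ν p h z i * z i ^ k = if k = ν then (ν ! : ℝ) else 0 := by
  have h1 : (fun i => (z i / h) ^ k)
      = polyMat p h z *ᵥ Pi.single (⟨k, Nat.lt_succ_of_le hk⟩ : Fin (p + 1)) (1 : ℝ) := by
    ext i
    simp [polyMat]
  have h2 : (Gam A K p h z)⁻¹ *ᵥ Theta A K p k h z
      = Pi.single (⟨k, Nat.lt_succ_of_le hk⟩ : Fin (p + 1)) (1 : ℝ) := by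
    have : Theta A K p k h z
        = Gam A K p h z *ᵥ Pi.single (⟨k, Nat.lt_succ_of_le hk⟩ : Fin (p + 1)) (1 : ℝ) := by
      unfold Theta powVec Gam
      rw [h1, Matrix.mulVec_mulVec, Matrix.smul_mulVec]
    rw [this, Matrix.mulVec_mulVec, Matrix.nonsing_inv_mul _ hΓ, Matrix.one_mulVec]
  have h3 : ∑ i, lpWeight A K ν p h z i * z i ^ k
      = h ^ k * (h ^ ν)⁻¹ * biasB A K ν p k h z := by
    rw [biasB, Theta, weightMat, dotProduct_inv_mulVec_wls, Finset.mul_sum, Finset.mul_sum]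
    refine Finset.sum_congr rfl fun i _ => ?_
    rw [lpWeight, polyMat_row, powVec, div_pow]
    field_simp
  rw [h3, biasB, h2, unitVec_dotProduct p ν hν, Pi.single_apply]
  simp only [Fin.mk.injEq]
  split_ifs with h4 h5 h5
  · subst h4
    field_simp
  · exact absurd h4.symm h5
  · exact absurd h5.symm h4
  · simp

/-! ### Coercivity of the Gram form of a one-sided discrete measure -/

/-- The `j`-th of `d + 1` disjoint compact subintervals of `(0, κ)`. -/
def box (κ : ℝ) (d : ℕ) (j : Fin (d + 1)) : Set ℝ :=
  Set.Icc (κ * (2 * (j : ℕ) + 1) / (2 * d + 4)) (κ * (2 * (j : ℕ) + 2) / (2 * d + 4))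

theorem box_lt_box {κ : ℝ} (hκ : 0 < κ) {d : ℕ} {j k : Fin (d + 1)} (hjk : j < k) {x y : ℝ}
    (hx : x ∈ box κ d j) (hy : y ∈ box κ d k) : x < y := by
  refine hx.2.trans_lt (lt_of_lt_of_le ?_ hy.1)
  have : ((j : ℕ) : ℝ) + 1 ≤ (k : ℕ) := by exact_mod_cast hjk
  gcongr ?_ / _
  exact mul_lt_mul_of_pos_left (by linarith) hκ

theorem le_of_mem_box {κ : ℝ} (hκ : 0 < κ) {d : ℕ} {j : Fin (d + 1)} {x : ℝ}
    (hx : x ∈ box κ d j) : κ / (2 * d + 4) ≤ x := by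
  refine le_trans ?_ hx.1
  gcongr ?_ / _
  exact le_mul_of_one_le_right hκ.le (by linarith [Nat.cast_nonneg (α := ℝ) (j : ℕ)])

theorem le_of_mem_box' {κ : ℝ} (hκ : 0 < κ) {d : ℕ} {j : Fin (d + 1)} {x : ℝ}
    (hx : x ∈ box κ d j) : x ≤ κ * (2 * d + 2) / (2 * d + 4) := by
  refine hx.2.trans ?_
  have : ((j : ℕ) : ℝ) ≤ d := by exact_mod_cast Nat.lt_succ_iff.mp j.2
  gcongr

theorem left_mem_box {κ : ℝ} (hκ : 0 < κ) {d : ℕ} (j : Fin (d + 1)) :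
    κ * (2 * (j : ℕ) + 1) / (2 * d + 4) ∈ box κ d j := by
  refine ⟨le_rfl, ?_⟩
  gcongr
  norm_num

/-- The values of a polynomial of degree at most `d` at points of the `d + 1` boxes control its
coefficients. -/
theorem exists_sum_sq_coeff_le {κ : ℝ} (hκ : 0 < κ) (d : ℕ) :
    ∃ c : ℝ, 0 < c ∧ ∀ y : Fin (d + 1) → ℝ, (∀ j, y j ∈ box κ d j) → ∀ g : Fin (d + 1) → ℝ,
      c * ∑ k, g k ^ 2 ≤ ∑ j, (∑ k : Fin (d + 1), g k * y j ^ (k : ℕ)) ^ 2 := by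
  set S : Set (Fin (d + 1) → ℝ) := {g | ∑ k, g k ^ 2 = 1} with hS
  have hScomp : IsCompact S := by
    refine Metric.isCompact_of_isClosed_isBounded
      (isClosed_eq (by fun_prop) continuous_const) ?_
    refine (Metric.isBounded_closedBall (x := (0 : Fin (d + 1) → ℝ)) (r := 1)).subset ?_
    intro g hg
    rw [mem_closedBall_zero_iff, pi_norm_le_iff_of_nonneg zero_le_one]
    intro k
    rw [Real.norm_eq_abs, ← sq_le_one_iff_abs_le_one]
    have h1 : g k ^ 2 ≤ ∑ k, g k ^ 2 :=
      Finset.single_le_sum (f := fun k => g k ^ 2) (fun i _ => sq_nonneg (g i))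
        (Finset.mem_univ k)
    exact h1.trans_eq hg
  -- By homogeneity the unit sphere suffices. The nodes also range over a compact set, which makes
  -- the minimum uniform in them.
  have hcomp : IsCompact (S ×ˢ Set.univ.pi (box κ d)) :=
    hScomp.prod (isCompact_univ_pi fun _ => isCompact_Icc)
  set F : (Fin (d + 1) → ℝ) × (Fin (d + 1) → ℝ) → ℝ :=
    fun w => ∑ j, (∑ k : Fin (d + 1), w.1 k * w.2 j ^ (k : ℕ)) ^ 2 with hF
  have hFc : Continuous F := by fun_prop
  have hne : (S ×ˢ Set.univ.pi (box κ d)).Nonempty := by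
    refine ⟨(Pi.single 0 1, fun j => κ * (2 * (j : ℕ) + 1) / (2 * d + 4)), ?_,
      fun j _ => left_mem_box hκ j⟩
    change ∑ k, (Pi.single 0 1 : Fin (d + 1) → ℝ) k ^ 2 = 1
    rw [Finset.sum_eq_single 0]
    · simp
    · intro b _ hb
      simp [hb]
    · simp
  obtain ⟨w, hw, hmin⟩ := hcomp.exists_isMinOn hne hFc.continuousOn
  -- Nodes in distinct boxes are distinct, so a polynomial of degree at most `d` vanishing at all `d
  -- + 1` of them is zero (Vandermonde).
  have hpos : 0 < F w := by
    refine lt_of_le_of_ne (Finset.sum_nonneg fun j _ => sq_nonneg _) fun h0 => ?_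
    have h1 := (Finset.sum_eq_zero_iff_of_nonneg (fun j _ => sq_nonneg _)).mp h0.symm
    have hinj : Function.Injective w.2 := by
      have : StrictMono w.2 := fun j k hjk =>
        box_lt_box hκ hjk (hw.2 j (Set.mem_univ _)) (hw.2 k (Set.mem_univ _))
      exact this.injective
    have h2 : w.1 = 0 := Matrix.eq_zero_of_forall_index_sum_mul_pow_eq_zero hinj fun j =>
      pow_eq_zero_iff two_ne_zero |>.mp (h1 j (Finset.mem_univ j))
    have h3 : ∑ k, w.1 k ^ 2 = 1 := hw.1
    simp [h2] at h3
  refine ⟨F w, hpos, fun y hy g => ?_⟩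
  rcases (Finset.sum_nonneg fun k _ => sq_nonneg (g k)).eq_or_lt with h0 | h0
  · rw [← h0, mul_zero]
    exact Finset.sum_nonneg fun j _ => sq_nonneg _
  set N := ∑ k, g k ^ 2 with hN
  have hsq : 0 < Real.sqrt N := Real.sqrt_pos.mpr h0
  have hmem : ((fun k => g k / Real.sqrt N), y) ∈ S ×ˢ Set.univ.pi (box κ d) := by
    refine ⟨?_, fun j _ => hy j⟩
    change ∑ k, (g k / Real.sqrt N) ^ 2 = 1
    simp only [div_pow, Real.sq_sqrt h0.le, ← Finset.sum_div]
    exact div_self h0.ne'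
  have h1 : F w ≤ F ((fun k => g k / Real.sqrt N), y) := hmin hmem
  have h2 : F ((fun k => g k / Real.sqrt N), y)
      = (∑ j, (∑ k : Fin (d + 1), g k * y j ^ (k : ℕ)) ^ 2) / N := by
    rw [hF, Finset.sum_div]
    refine Finset.sum_congr rfl fun j _ => ?_
    simp only [div_mul_eq_mul_div, ← Finset.sum_div, div_pow, Real.sq_sqrt h0.le]
  rw [h2, le_div_iff₀ h0] at h1
  exact h1

open scoped Classical in
/-- A finite measure with masses `ω i` at the points `x i` that lives on the side `s = ±1` of the
origin, inside `[-κ, κ]`, has total mass at most `M`, and mass at least `m` in every box. -/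
structure IsSideMeasure {n : ℕ} (s κ : ℝ) (d : ℕ) (m M : ℝ) (ω x : Fin n → ℝ) : Prop where
  sign : s = 1 ∨ s = -1
  nonneg : ∀ i, 0 ≤ ω i
  supp_nonneg : ∀ i, ω i ≠ 0 → 0 ≤ s * x i
  supp_le : ∀ i, ω i ≠ 0 → s * x i ≤ κ
  mass_le : ∑ i, ω i ≤ M
  box_mass : ∀ j : Fin (d + 1), m ≤ ∑ i with s * x i ∈ box κ d j, ω i

theorem IsSideMeasure.abs_le {n : ℕ} {s κ : ℝ} {d : ℕ} {m M : ℝ} {ω x : Fin n → ℝ}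
    (H : IsSideMeasure s κ d m M ω x) (i : Fin n) (hi : ω i ≠ 0) : |x i| ≤ κ := by
  have h1 := H.supp_nonneg i hi
  have h2 := H.supp_le i hi
  rcases H.sign with h | h <;> rw [h] at h1 h2 <;> rw [_root_.abs_le] <;> constructor <;> linarith

-- The extra factor `s * x` is what the location of the roots of the orthogonal polynomial requires;
-- the plain Gram bound follows from `s * x ≤ κ`. The constant precedes the sample and the side, so
-- one choice serves all of them.
open scoped Classical in
theorem exists_form_ge {κ : ℝ} (hκ : 0 < κ) (d : ℕ) {m : ℝ} (hm : 0 < m) :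
    ∃ c : ℝ, 0 < c ∧ ∀ (n : ℕ) (s M : ℝ) (ω x : Fin n → ℝ), IsSideMeasure s κ d m M ω x →
      ∀ g : Fin (d + 1) → ℝ,
        c * ∑ k, g k ^ 2 ≤ ∑ i, ω i * (s * x i) * (∑ k : Fin (d + 1), g k * x i ^ (k : ℕ)) ^ 2 := by
  obtain ⟨c, hc, hcg⟩ := exists_sum_sq_coeff_le hκ d
  refine ⟨m * (κ / (2 * d + 4)) * c / (d + 1), by positivity, fun n s M ω x H g => ?_⟩
  set f : Fin n → ℝ := fun i => ω i * (s * x i) * (∑ k : Fin (d + 1), g k * x i ^ (k : ℕ)) ^ 2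
    with hf
  have hf0 : ∀ i, 0 ≤ f i := by
    intro i
    by_cases hi : ω i = 0
    · simp [hf, hi]
    · exact mul_nonneg (mul_nonneg (H.nonneg i) (H.supp_nonneg i hi)) (sq_nonneg _)
  -- Coefficients of the reflected polynomial, which move the case `s = -1` to the positive
  -- half-line.
  set g' : Fin (d + 1) → ℝ := fun k => s ^ (k : ℕ) * g k with hg'
  have hs2 : s * s = 1 := by rcases H.sign with h | h <;> rw [h] <;> norm_num
  have hg'sq : ∑ k, g' k ^ 2 = ∑ k, g k ^ 2 := by
    refine Finset.sum_congr rfl fun k _ => ?_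
    rw [hg', mul_pow, ← pow_mul, mul_comm (k : ℕ) 2, pow_mul, sq, hs2, one_pow, one_mul]
  have hval : ∀ t : ℝ, ∑ k : Fin (d + 1), g' k * (s * t) ^ (k : ℕ)
      = ∑ k : Fin (d + 1), g k * t ^ (k : ℕ) := by
    intro t
    refine Finset.sum_congr rfl fun k _ => ?_
    calc g' k * (s * t) ^ (k : ℕ) = (s * s) ^ (k : ℕ) * (g k * t ^ (k : ℕ)) := by
          rw [hg', mul_pow, mul_pow]; ring
      _ = _ := by rw [hs2, one_pow, one_mul]
  set P : ℝ → ℝ := fun t => (∑ k : Fin (d + 1), g k * t ^ (k : ℕ)) ^ 2 with hP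
  have hbox : ∀ j : Fin (d + 1), ∃ y, s * y ∈ box κ d j ∧
      m * (κ / (2 * d + 4)) * P y ≤ ∑ i with s * x i ∈ box κ d j, f i := by
    intro j
    have hne : (Finset.univ.filter fun i => s * x i ∈ box κ d j).Nonempty := by
      by_contra h0
      rw [Finset.not_nonempty_iff_eq_empty] at h0
      have := H.box_mass j
      rw [h0, Finset.sum_empty] at this
      linarith
    -- The node of each box is an observation that minimizes the squared polynomial there; the whole
    -- mass of the box then counts with this value.
    obtain ⟨i₀, hi₀, hmin⟩ := Finset.exists_min_image _ (fun i => P (x i)) hne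
    refine ⟨x i₀, (Finset.mem_filter.mp hi₀).2, ?_⟩
    calc m * (κ / (2 * d + 4)) * P (x i₀)
        ≤ (∑ i with s * x i ∈ box κ d j, ω i) * (κ / (2 * d + 4)) * P (x i₀) := by
          gcongr
          exact H.box_mass j
      _ = ∑ i with s * x i ∈ box κ d j, ω i * (κ / (2 * d + 4)) * P (x i₀) := by
          rw [Finset.sum_mul, Finset.sum_mul]
      _ ≤ ∑ i with s * x i ∈ box κ d j, f i := by
          refine Finset.sum_le_sum fun i hi => ?_
          have h1 := le_of_mem_box hκ (Finset.mem_filter.mp hi).2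
          have h2 := hmin i hi
          have h3 : 0 ≤ s * x i := le_trans (by positivity) h1
          exact mul_le_mul (mul_le_mul_of_nonneg_left h1 (H.nonneg i)) h2 (sq_nonneg _)
            (mul_nonneg (H.nonneg i) h3)
  choose y hy hyle using hbox
  have h1 : c * ∑ k, g k ^ 2 ≤ ∑ j, P (y j) := by
    rw [← hg'sq]
    refine (hcg (fun j => s * y j) hy g').trans_eq ?_
    exact Finset.sum_congr rfl fun j _ => by rw [hval]
  -- Each box is bounded by the full sum; this accounts for the factor `d + 1` in the constant.
  have h2 : m * (κ / (2 * d + 4)) * ∑ j, P (y j) ≤ (d + 1) * ∑ i, f i := by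
    rw [Finset.mul_sum]
    calc ∑ j, m * (κ / (2 * d + 4)) * P (y j) ≤ ∑ j : Fin (d + 1), ∑ i, f i :=
          Finset.sum_le_sum fun j _ => (hyle j).trans
            (Finset.sum_le_sum_of_subset_of_nonneg (Finset.filter_subset _ _)
              fun i _ _ => hf0 i)
      _ = (d + 1) * ∑ i, f i := by simp
  have h3 : m * (κ / (2 * d + 4)) * (c * ∑ k, g k ^ 2) ≤ (d + 1) * ∑ i, f i :=
    (mul_le_mul_of_nonneg_left h1 (by positivity)).trans h2
  calc m * (κ / (2 * d + 4)) * c / (d + 1) * ∑ k, g k ^ 2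
      = m * (κ / (2 * d + 4)) * (c * ∑ k, g k ^ 2) / (d + 1) := by ring
    _ ≤ ∑ i, f i := by
      rw [div_le_iff₀ (by positivity)]
      linarith

theorem IsSideMeasure.gram_ge {n : ℕ} {s κ : ℝ} {d : ℕ} {m M : ℝ} {ω x : Fin n → ℝ}
    (H : IsSideMeasure s κ d m M ω x) (hκ : 0 < κ) {c : ℝ} (g : Fin (d + 1) → ℝ)
    (hc : c * ∑ k, g k ^ 2
      ≤ ∑ i, ω i * (s * x i) * (∑ k : Fin (d + 1), g k * x i ^ (k : ℕ)) ^ 2) :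
    c / κ * ∑ k, g k ^ 2 ≤ ∑ i, ω i * (∑ k : Fin (d + 1), g k * x i ^ (k : ℕ)) ^ 2 := by
  rw [div_mul_eq_mul_div, div_le_iff₀ hκ, Finset.sum_mul]
  refine hc.trans (Finset.sum_le_sum fun i _ => ?_)
  by_cases hi : ω i = 0
  · simp [hi]
  · have := mul_le_mul_of_nonneg_left (H.supp_le i hi)
      (mul_nonneg (H.nonneg i) (sq_nonneg (∑ k : Fin (d + 1), g k * x i ^ (k : ℕ))))
    linarith

theorem sq_sum_mul_pow_le {κ : ℝ} {d : ℕ} (g : Fin (d + 1) → ℝ) {t : ℝ} (ht : |t| ≤ κ) :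
    (∑ k : Fin (d + 1), g k * t ^ (k : ℕ)) ^ 2
      ≤ (∑ k, g k ^ 2) * ∑ k : Fin (d + 1), (κ ^ 2) ^ (k : ℕ) := by
  refine (Finset.sum_mul_sq_le_sq_mul_sq _ _ _).trans ?_
  gcongr with k
  rw [← pow_mul, mul_comm, pow_mul, ← sq_abs t]
  gcongr

theorem IsSideMeasure.gram_le {n : ℕ} {s κ : ℝ} {d : ℕ} {m M : ℝ} {ω x : Fin n → ℝ}
    (H : IsSideMeasure s κ d m M ω x) (g : Fin (d + 1) → ℝ) :
    ∑ i, ω i * (∑ k : Fin (d + 1), g k * x i ^ (k : ℕ)) ^ 2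
      ≤ M * (∑ k : Fin (d + 1), (κ ^ 2) ^ (k : ℕ)) * ∑ k, g k ^ 2 := by
  calc ∑ i, ω i * (∑ k : Fin (d + 1), g k * x i ^ (k : ℕ)) ^ 2
      ≤ ∑ i, (ω i * ((∑ k, g k ^ 2) * ∑ k : Fin (d + 1), (κ ^ 2) ^ (k : ℕ))) := by
        refine Finset.sum_le_sum fun i _ => ?_
        by_cases hi : ω i = 0
        · simp [hi]
        · exact mul_le_mul_of_nonneg_left (sq_sum_mul_pow_le g (H.abs_le i hi)) (H.nonneg i)
    _ = (∑ i, ω i) * ((∑ k, g k ^ 2) * ∑ k : Fin (d + 1), (κ ^ 2) ^ (k : ℕ)) := by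
        rw [← Finset.sum_mul]
    _ ≤ M * ((∑ k, g k ^ 2) * ∑ k : Fin (d + 1), (κ ^ 2) ^ (k : ℕ)) := by
        gcongr
        exact H.mass_le
    _ = _ := by ring

/-- A symmetric positive definite form with lower bound `c` is inverted with bound `c⁻¹`. -/
theorem isUnit_det_of_form_ge {d : ℕ} {c : ℝ} (hc : 0 < c) (G : Matrix (Fin d) (Fin d) ℝ)
    (hG : ∀ g : Fin d → ℝ, c * ∑ k, g k ^ 2 ≤ g ⬝ᵥ (G *ᵥ g)) : IsUnit G.det := by
  rw [isUnit_iff_ne_zero]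
  intro h0
  obtain ⟨v, hv, hGv⟩ := Matrix.exists_mulVec_eq_zero_iff.mpr h0
  have h1 := hG v
  rw [hGv, dotProduct_zero] at h1
  apply hv
  have h2 : ∑ k, v k ^ 2 = 0 :=
    le_antisymm (nonpos_of_mul_nonpos_right h1 hc) (Finset.sum_nonneg fun k _ => sq_nonneg _)
  ext k
  exact pow_eq_zero_iff two_ne_zero |>.mp
    ((Finset.sum_eq_zero_iff_of_nonneg fun k _ => sq_nonneg (v k)).mp h2 k (Finset.mem_univ k))

/-- With `u = G⁻¹ v`, coercivity and Cauchy–Schwarz give `c |u|² ≤ u · v ≤ R |u|`. -/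
theorem abs_inv_mulVec_le {d : ℕ} {c R : ℝ} (hc : 0 < c) (hR : 0 ≤ R)
    (G : Matrix (Fin d) (Fin d) ℝ)
    (hG : ∀ g : Fin d → ℝ, c * ∑ k, g k ^ 2 ≤ g ⬝ᵥ (G *ᵥ g)) (v : Fin d → ℝ)
    (hv : ∑ k, v k ^ 2 ≤ R ^ 2) (j : Fin d) : |(G⁻¹ *ᵥ v) j| ≤ R / c := by
  set u := G⁻¹ *ᵥ v with hu
  have h1 : G *ᵥ u = v := by
    rw [hu, Matrix.mulVec_mulVec, Matrix.mul_nonsing_inv _ (isUnit_det_of_form_ge hc G hG),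
      Matrix.one_mulVec]
  have h2 := hG u
  rw [h1] at h2
  set N := ∑ k, u k ^ 2 with hN
  have hN0 : 0 ≤ N := Finset.sum_nonneg fun k _ => sq_nonneg _
  have h3 : (u ⬝ᵥ v) ^ 2 ≤ N * R ^ 2 :=
    (Finset.sum_mul_sq_le_sq_mul_sq _ _ _).trans (mul_le_mul_of_nonneg_left hv hN0)
  have h4 : (c * N) ^ 2 ≤ N * R ^ 2 :=
    (pow_le_pow_left₀ (by positivity) h2 2).trans h3
  have h5 : c ^ 2 * N ≤ R ^ 2 := by
    rcases hN0.eq_or_lt with h0 | h0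
    · rw [← h0, mul_zero]
      positivity
    · have : N * (c ^ 2 * N) ≤ N * R ^ 2 := by linarith [h4, mul_pow c N 2]
      exact le_of_mul_le_mul_left this h0
  have h6 : u j ^ 2 ≤ N :=
    Finset.single_le_sum (f := fun k => u k ^ 2) (fun i _ => sq_nonneg (u i)) (Finset.mem_univ j)
  rw [le_div_iff₀ hc]
  refine abs_le_of_sq_le_sq' ?_ hR |>.2
  rw [mul_pow, sq_abs]
  nlinarith [sq_nonneg c]

/-! ### Orthogonal polynomials and the nonvanishing of the bias constant -/

/-- The coefficients of a monic polynomial whose roots are all on the side `s = ±1` of the origin, at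
distance at least `ε` from it. -/
theorem pow_le_coeff_prod_X_sub_C {s ε : ℝ} (hs : s = 1 ∨ s = -1) (hε : 0 < ε) (r : Multiset ℝ)
    (hr : ∀ x ∈ r, ε ≤ s * x) (k : ℕ) (hk : k ≤ r.card) :
    ε ^ (r.card - k) ≤ (-s) ^ (r.card - k)
      * (r.map fun x => (Polynomial.X - Polynomial.C x : Polynomial ℝ)).prod.coeff k := by
  have hs2 : s * s = 1 := by rcases hs with h | h <;> rw [h] <;> norm_num
  induction r using Multiset.induction_on generalizing k with
  | empty =>
    simp only [Multiset.card_zero, nonpos_iff_eq_zero] at hk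
    subst hk
    simp
  | cons a t ih =>
    have iht := ih fun x hx => hr x (Multiset.mem_cons_of_mem hx)
    have ha := hr a (Multiset.mem_cons_self a t)
    set Q := (t.map fun x => (Polynomial.X - Polynomial.C x : Polynomial ℝ)).prod with hQ
    rw [Multiset.card_cons] at hk
    rw [Multiset.map_cons, Multiset.prod_cons, ← hQ, sub_mul, Polynomial.coeff_sub,
      Polynomial.coeff_C_mul, Multiset.card_cons]
    have hsecond : ∀ m, m ≤ t.card → ε * ε ^ (t.card - m)
        ≤ (-s) ^ (t.card + 1 - m) * (-(a * Q.coeff m)) := by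
      intro m hm
      have h1 : t.card + 1 - m = (t.card - m) + 1 := by omega
      rw [h1, pow_succ]
      calc ε * ε ^ (t.card - m) ≤ (s * a) * ((-s) ^ (t.card - m) * Q.coeff m) :=
            mul_le_mul ha (iht m hm) (by positivity) (by linarith)
        _ = _ := by ring
    rcases Nat.eq_zero_or_pos k with h0 | h0
    · subst h0
      have h1 := hsecond 0 (Nat.zero_le _)
      rw [Polynomial.coeff_X_mul_zero, zero_sub]
      refine le_trans (le_of_eq ?_) h1
      rw [Nat.sub_zero, Nat.sub_zero, pow_succ']
    · obtain ⟨m, rfl⟩ := Nat.exists_eq_succ_of_ne_zero h0.ne'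
      rw [Nat.succ_eq_add_one, Polynomial.coeff_X_mul]
      have h1 := iht m (by omega)
      -- After multiplication by the power of `-s`, both terms of the recursion for the coefficients
      -- of `(X - a) Q` are nonnegative: nothing cancels, and the term `X Q` alone supplies the
      -- bound.
      have h2 : 0 ≤ (-s) ^ (t.card + 1 - (m + 1)) * (-(a * Q.coeff (m + 1))) := by
        rcases Nat.lt_or_ge t.card (m + 1) with h3 | h3
        · have h4 : Q.coeff (m + 1) = 0 := by
            apply Polynomial.coeff_eq_zero_of_natDegree_lt
            rw [hQ, Polynomial.natDegree_multiset_prod_X_sub_C_eq_card]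
            exact h3
          rw [h4]
          simp
        · exact le_trans (by positivity) (hsecond (m + 1) h3)
      have h3 : t.card + 1 - (m + 1) = t.card - m := by omega
      rw [h3] at h2 ⊢
      rw [sub_eq_add_neg, mul_add]
      linarith

/-- If `X ^ (d + 1) - ∑ β_j X ^ j` is orthogonal to all polynomials of degree at most `d` with
respect to a measure on one side of the origin, its roots are real, lie on that side and stay away
from the origin; so the coefficients `β_j` stay away from zero. -/
theorem IsSideMeasure.pow_le_abs_coeff {n : ℕ} {s κ : ℝ} {d : ℕ} {m M : ℝ} {ω x : Fin n → ℝ}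
    (H : IsSideMeasure s κ d m M ω x) {c C : ℝ} (hc0 : 0 < c) (hC0 : 0 < C)
    (hc : ∀ g : Fin (d + 1) → ℝ, c * ∑ k, g k ^ 2
      ≤ ∑ i, ω i * (s * x i) * (∑ k : Fin (d + 1), g k * x i ^ (k : ℕ)) ^ 2)
    (hC : ∀ g : Fin (d + 1) → ℝ, ∑ i, ω i * (∑ k : Fin (d + 1), g k * x i ^ (k : ℕ)) ^ 2
      ≤ C * ∑ k, g k ^ 2)
    (β : Fin (d + 1) → ℝ)
    (hβ : ∀ k : Fin (d + 1),
      ∑ i, ω i * (x i ^ (d + 1) - ∑ j : Fin (d + 1), β j * x i ^ (j : ℕ)) * x i ^ (k : ℕ) = 0)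
    (j : Fin (d + 1)) : (c / C) ^ (d + 1 - (j : ℕ)) ≤ |β j| := by
  set R : Polynomial ℝ :=
    ∑ j : Fin (d + 1), Polynomial.C (β j) * Polynomial.X ^ (j : ℕ) with hR
  have hRdeg : R.degree < ((d + 1 : ℕ) : WithBot ℕ) := by
    refine (Polynomial.degree_sum_le _ _).trans_lt ?_
    rw [Finset.sup_lt_iff (WithBot.bot_lt_coe _)]
    intro k _
    refine (Polynomial.degree_C_mul_X_pow_le _ _).trans_lt ?_
    exact_mod_cast k.2
  set π : Polynomial ℝ := Polynomial.X ^ (d + 1) - R with hπ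
  have hmonic : π.Monic := Polynomial.monic_X_pow_sub hRdeg
  have hdeg : π.natDegree = d + 1 := by
    apply Polynomial.natDegree_eq_of_degree_eq_some
    rw [hπ, Polynomial.degree_sub_eq_left_of_degree_lt]
    · exact Polynomial.degree_X_pow _
    · rw [Polynomial.degree_X_pow]
      exact hRdeg
  have heval : ∀ t : ℝ, π.eval t = t ^ (d + 1) - ∑ j : Fin (d + 1), β j * t ^ (j : ℕ) := by
    intro t
    simp [hπ, hR, Polynomial.eval_finsetSum]
  have hcoeff : ∀ j : Fin (d + 1), π.coeff j = -β j := by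
    intro j
    have h1 : R.coeff j = β j := by
      rw [hR, Polynomial.finsetSum_coeff]
      simp only [Polynomial.coeff_C_mul, Polynomial.coeff_X_pow]
      rw [Finset.sum_eq_single j]
      · simp
      · intro b _ hb
        rw [if_neg, mul_zero]
        intro h
        exact hb (Fin.ext h.symm)
      · simp
    rw [hπ, Polynomial.coeff_sub, h1, Polynomial.coeff_X_pow, if_neg, zero_sub]
    exact (Nat.ne_of_lt j.2)
  set πc : Polynomial ℂ := π.map Complex.ofRealHom with hπc
  have hmonicc : πc.Monic := hmonic.map _
  have hdegc : πc.natDegree = d + 1 := by rw [hπc, hmonic.natDegree_map, hdeg]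
  -- Factor `π = (X - z) g` over `ℂ`. Orthogonality of `π` to the conjugate of `g` reads `∑ ω (x -
  -- z) |g(x)|² = 0`. Thus `z` is a weighted mean of the nodes: it is real, and `s z` is a quotient
  -- of the two forms bounded in `hc` and `hC`.
  have hroot : ∀ z ∈ πc.roots, ∃ t : ℝ, z = (t : ℂ) ∧ c / C ≤ s * t := by
    intro z hz
    rw [Polynomial.mem_roots hmonicc.ne_zero] at hz
    obtain ⟨g, hg⟩ := Polynomial.dvd_iff_isRoot.mpr hz
    have hgmonic : g.Monic := by
      have := hmonicc
      rw [hg] at this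
      exact (Polynomial.monic_X_sub_C z).of_mul_monic_left this
    have hgdeg : g.natDegree = d := by
      have h1 := hdegc
      rw [hg, (Polynomial.monic_X_sub_C z).natDegree_mul hgmonic,
        Polynomial.natDegree_X_sub_C] at h1
      omega
    set a : Fin (d + 1) → ℝ := fun k => (g.coeff k).re with ha
    set b : Fin (d + 1) → ℝ := fun k => (g.coeff k).im with hb
    set ga : ℝ → ℝ := fun t => ∑ k : Fin (d + 1), a k * t ^ (k : ℕ) with hga
    set gb : ℝ → ℝ := fun t => ∑ k : Fin (d + 1), b k * t ^ (k : ℕ) with hgb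
    have hgeval : ∀ t : ℝ, g.eval (t : ℂ) = (ga t : ℂ) + (gb t : ℂ) * Complex.I := by
      intro t
      rw [Polynomial.eval_eq_sum_range' (n := d + 1) (by omega), ← Fin.sum_univ_eq_sum_range
        (fun k => g.coeff k * (t : ℂ) ^ k), hga, hgb]
      push_cast
      rw [Finset.sum_mul, ← Finset.sum_add_distrib]
      refine Finset.sum_congr rfl fun k _ => ?_
      conv_lhs => rw [← Complex.re_add_im (g.coeff k)]
      rw [ha, hb]
      ring
    have hfac : ∀ t : ℝ, ((π.eval t : ℝ) : ℂ)
        = ((t : ℂ) - z) * ((ga t : ℂ) + (gb t : ℂ) * Complex.I) := by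
      intro t
      rw [← hgeval, ← Polynomial.eval_C (a := z) (x := (t : ℂ))]
      conv_lhs => rw [← Complex.ofRealHom_eq_coe, ← Polynomial.eval_map_apply, ← hπc, hg]
      simp
    have horth : ∀ e : Fin (d + 1) → ℝ,
        ∑ i, ω i * π.eval (x i) * (∑ k : Fin (d + 1), e k * x i ^ (k : ℕ)) = 0 := by
      intro e
      simp only [Finset.mul_sum]
      rw [Finset.sum_comm]
      refine Finset.sum_eq_zero fun k _ => ?_
      have h1 := hβ k
      rw [← mul_zero (e k), ← h1, Finset.mul_sum]
      refine Finset.sum_congr rfl fun i _ => ?_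
      rw [heval]
      ring
    set S : ℝ := ∑ i, ω i * (ga (x i) ^ 2 + gb (x i) ^ 2) with hS
    set T : ℝ := ∑ i, ω i * x i * (ga (x i) ^ 2 + gb (x i) ^ 2) with hT
    have hzero : (T : ℂ) - z * (S : ℂ) = 0 := by
      have h1 : ∑ i, (ω i : ℂ) * ((π.eval (x i) : ℝ) : ℂ)
          * ((ga (x i) : ℂ) - (gb (x i) : ℂ) * Complex.I) = 0 := by
        have h2 := horth a
        have h3 := horth b
        have h4 : ∑ i, (ω i : ℂ) * ((π.eval (x i) : ℝ) : ℂ)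
            * ((ga (x i) : ℂ) - (gb (x i) : ℂ) * Complex.I)
            = ((∑ i, ω i * π.eval (x i) * ga (x i) : ℝ) : ℂ)
              - ((∑ i, ω i * π.eval (x i) * gb (x i) : ℝ) : ℂ) * Complex.I := by
          push_cast
          rw [Finset.sum_mul, ← Finset.sum_sub_distrib]
          exact Finset.sum_congr rfl fun i _ => by ring
        rw [h4, h2, h3]
        simp
      rw [← h1, hT, hS]
      push_cast
      rw [Finset.mul_sum, ← Finset.sum_sub_distrib]
      refine Finset.sum_congr rfl fun i _ => ?_
      rw [hfac]
      linear_combination ((ω i : ℂ) * ((x i : ℂ) - z) * (gb (x i) : ℂ) ^ 2) * Complex.I_sq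
    set N : ℝ := (∑ k, a k ^ 2) + ∑ k, b k ^ 2 with hN
    -- The cofactor `g` is monic of degree `d`, so its last coefficient contributes `1`.
    have hNpos : 0 < N := by
      have h1 : a (Fin.last d) = 1 := by
        have : g.coeff d = 1 := by rw [← hgdeg]; exact hgmonic
        simp [ha, this]
      have h2 : a (Fin.last d) ^ 2 ≤ ∑ k, a k ^ 2 :=
        Finset.single_le_sum (f := fun k => a k ^ 2) (fun i _ => sq_nonneg (a i))
          (Finset.mem_univ _)
      have h3 : 0 ≤ ∑ k, b k ^ 2 := Finset.sum_nonneg fun k _ => sq_nonneg _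
      rw [h1] at h2
      linarith
    have hsT : c * N ≤ s * T := by
      rw [hN, mul_add]
      refine (add_le_add (hc a) (hc b)).trans_eq ?_
      rw [hT, Finset.mul_sum, ← Finset.sum_add_distrib]
      exact Finset.sum_congr rfl fun i _ => by ring
    have hSC : S ≤ C * N := by
      rw [hN, mul_add]
      refine le_trans (le_of_eq ?_) (add_le_add (hC a) (hC b))
      rw [hS, ← Finset.sum_add_distrib]
      exact Finset.sum_congr rfl fun i _ => by ring
    have hS0 : 0 ≤ S := Finset.sum_nonneg fun i _ => mul_nonneg (H.nonneg i) (by positivity)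
    have hSpos : 0 < S := by
      refine lt_of_le_of_ne hS0 fun h0 => ?_
      rw [← h0] at hzero
      have h1 : T = 0 := by simpa using hzero
      rw [h1] at hsT
      have := mul_pos hc0 hNpos
      linarith
    refine ⟨T / S, ?_, ?_⟩
    · push_cast
      rw [eq_div_iff (by exact_mod_cast hSpos.ne')]
      linear_combination -hzero
    · rw [← mul_div_assoc, div_le_div_iff₀ hC0 hSpos]
      calc c * S ≤ c * (C * N) := mul_le_mul_of_nonneg_left hSC hc0.le
        _ = c * N * C := by ring
        _ ≤ s * T * C := mul_le_mul_of_nonneg_right hsT hC0.le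
  set r : Multiset ℝ := πc.roots.map Complex.re with hr
  have hroots : πc.roots = r.map (fun t : ℝ => (t : ℂ)) := by
    rw [hr, Multiset.map_map]
    conv_lhs => rw [← Multiset.map_id πc.roots]
    refine Multiset.map_congr rfl fun z hz => ?_
    obtain ⟨t, rfl, _⟩ := hroot z hz
    simp
  clear_value r
  -- All complex roots being real, the factorization of `π` descends to `ℝ`.
  have hπr : π = (r.map fun t => (Polynomial.X - Polynomial.C t : Polynomial ℝ)).prod := by
    apply Polynomial.map_injective Complex.ofRealHom Complex.ofRealHom.injective
    rw [← hπc, (IsAlgClosed.splits πc).eq_prod_roots_of_monic hmonicc, hroots, Multiset.map_map,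
      Polynomial.map_multiset_prod, Multiset.map_map]
    simp
  have hcard : r.card = d + 1 := by
    rw [← hdeg, hπr, Polynomial.natDegree_multiset_prod_X_sub_C_eq_card]
  have hrε : ∀ t ∈ r, c / C ≤ s * t := by
    intro t ht
    rw [hr, Multiset.mem_map] at ht
    obtain ⟨z, hz, rfl⟩ := ht
    obtain ⟨t, rfl, h2⟩ := hroot z hz
    simpa using h2
  have hfin := pow_le_coeff_prod_X_sub_C H.sign (div_pos hc0 hC0) r hrε j
    (by rw [hcard]; exact j.2.le)
  rw [← hπr, hcard, hcoeff] at hfin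
  refine hfin.trans ((le_abs_self _).trans_eq ?_)
  have hs1 : |(-s)| = 1 := by rcases H.sign with h | h <;> rw [h] <;> simp
  rw [abs_mul, abs_pow, hs1, one_pow, one_mul, abs_neg]

/-! ### Size, support and moments of local polynomial weights -/

theorem weight_nonneg {A : Set ℝ} {K : ℝ → ℝ} (hK : ∀ u, 0 ≤ K u) {h : ℝ} (hh : 0 < h) (t : ℝ) :
    0 ≤ weight A K h t :=
  Set.indicator_nonneg (fun _ _ => div_nonneg (hK _) hh.le) _

theorem weight_le {A : Set ℝ} {K : ℝ → ℝ} {B : ℝ} (hB : 0 ≤ B) (hKB : ∀ u, K u ≤ B) {h : ℝ}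
    (hh : 0 < h) (t : ℝ) : weight A K h t ≤ B / h := by
  refine Set.indicator_le' (fun x _ => ?_) (fun x _ => div_nonneg hB hh.le) t
  exact div_le_div_of_nonneg_right (hKB _) hh.le

theorem abs_le_of_weight_ne_zero {A : Set ℝ} {K : ℝ → ℝ} {κ : ℝ} (hK : ∀ u, κ < |u| → K u = 0)
    {h : ℝ} (hh : 0 < h) {t : ℝ} (ht : weight A K h t ≠ 0) : t ∈ A ∧ |t| ≤ κ * h := by
  by_cases hA : t ∈ A
  · refine ⟨hA, not_lt.mp fun hlt => ht ?_⟩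
    rw [weight, Set.indicator_of_mem hA, hK, zero_div]
    rwa [abs_div, abs_of_pos hh, lt_div_iff₀ hh]
  · exact absurd (Set.indicator_of_notMem hA _) ht

theorem dotProduct_Gam_mulVec {n : ℕ} (A : Set ℝ) (K : ℝ → ℝ) (p : ℕ) (h : ℝ) (z : Fin n → ℝ)
    (g : Fin (p + 1) → ℝ) :
    g ⬝ᵥ (Gam A K p h z *ᵥ g) = ∑ i, weight A K h (z i) * (n : ℝ)⁻¹
      * (∑ k : Fin (p + 1), g k * (z i / h) ^ (k : ℕ)) ^ 2 := by
  simp only [dotProduct, Matrix.mulVec, Gam_apply, Finset.mul_sum, Finset.sum_mul]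
  calc ∑ j : Fin (p + 1), ∑ k : Fin (p + 1), ∑ i, g j * (weight A K h (z i) * (n : ℝ)⁻¹
        * ((z i / h) ^ (j : ℕ) * (z i / h) ^ (k : ℕ)) * g k)
      = ∑ j : Fin (p + 1), ∑ i, ∑ k : Fin (p + 1), g j * (weight A K h (z i) * (n : ℝ)⁻¹
        * ((z i / h) ^ (j : ℕ) * (z i / h) ^ (k : ℕ)) * g k) :=
        Finset.sum_congr rfl fun j _ => Finset.sum_comm
    _ = ∑ i, ∑ j : Fin (p + 1), ∑ k : Fin (p + 1), g j * (weight A K h (z i) * (n : ℝ)⁻¹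
        * ((z i / h) ^ (j : ℕ) * (z i / h) ^ (k : ℕ)) * g k) := Finset.sum_comm
    _ = _ := by
      refine Finset.sum_congr rfl fun i _ => ?_
      rw [sq, Finset.sum_mul_sum, Finset.mul_sum]
      refine Finset.sum_congr rfl fun j _ => ?_
      rw [Finset.mul_sum]
      exact Finset.sum_congr rfl fun k _ => by ring

/-- The properties of the weights of a local polynomial estimator of the `ν`-th derivative that the
asymptotic theory uses. -/
structure IsLPWeight {n : ℕ} (A : Set ℝ) (κ : ℝ) (ν p : ℕ) (h C : ℝ) (z w : Fin n → ℝ) :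
    Prop where
  supp : ∀ i, w i ≠ 0 → z i ∈ A ∧ |z i| ≤ κ * h
  bound : ∀ i, |w i| ≤ C * (h ^ (ν + 1))⁻¹ * (n : ℝ)⁻¹
  moment : ∀ k ≤ p, ∑ i, w i * z i ^ k = if k = ν then (ν ! : ℝ) else 0
  count : ((Finset.univ.filter fun i => |z i| ≤ κ * h).card : ℝ) ≤ C * (n * h)

/-- One pair of constants serves all samples, bandwidths and both sides. The last conclusion keeps
the coefficient of the bias correction away from zero, as the regime `b ≪ h` requires. -/
theorem exists_isLPWeight {κ : ℝ} (hκ : 0 < κ) (ν p : ℕ) (hν : ν ≤ p) {m M B N : ℝ} (hm : 0 < m)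
    (hM : 0 < M) (hB : 0 ≤ B) :
    ∃ C c : ℝ, 0 < C ∧ 0 < c ∧ ∀ (n : ℕ) (A : Set ℝ) (K : ℝ → ℝ) (s h : ℝ) (z : Fin n → ℝ),
      0 < h → (∀ u, 0 ≤ K u) → (∀ u, K u ≤ B) → (∀ u, κ < |u| → K u = 0) →
      IsSideMeasure s κ p m M (fun i => weight A K h (z i) * (n : ℝ)⁻¹) (fun i => z i / h) →
      ((Finset.univ.filter fun i => |z i| ≤ κ * h).card : ℝ) ≤ N * (n * h) →
      IsLPWeight A κ ν p h C z (lpWeight A K ν p h z) ∧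
        c * h ^ (p + 1 - ν) ≤ |∑ i, lpWeight A K ν p h z i * z i ^ (p + 1)| := by
  obtain ⟨c, hc, hform⟩ := exists_form_ge hκ p hm
  set R2 : ℝ := ∑ k : Fin (p + 1), (κ ^ 2) ^ (k : ℕ) with hR2
  have hR2pos : 0 < R2 := Finset.sum_pos (fun k _ => by positivity) Finset.univ_nonempty
  -- `R2` bounds `|r_p(x)|²` for `|x| ≤ κ`, and `c / κ` is the coercivity constant of `Γ`. `|N|`
  -- covers the count and `1` secures positivity. `M * R2` is the upper Gram bound from `gram_le`.
  refine ⟨(ν ! : ℝ) * (Real.sqrt R2 / (c / κ)) * B + |N| + 1,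
    (c / (M * R2)) ^ (p + 1 - ν), by positivity, by positivity, ?_⟩
  intro n A K s h z hh hK0 hKB hKsupp H hcount
  have hformn := hform n s M _ _ H
  have hgram : ∀ g : Fin (p + 1) → ℝ, c / κ * ∑ k, g k ^ 2 ≤ g ⬝ᵥ (Gam A K p h z *ᵥ g) := by
    intro g
    rw [dotProduct_Gam_mulVec]
    exact H.gram_ge hκ g (hformn g)
  have hcκ : 0 < c / κ := by positivity
  have hunit := isUnit_det_of_form_ge hcκ _ hgram
  refine ⟨⟨?_, ?_, ?_, ?_⟩, ?_⟩
  · intro i hi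
    refine abs_le_of_weight_ne_zero hKsupp hh (K := K) fun h0 => hi ?_
    rw [lpWeight, h0]
    ring
  · intro i
    have hn : (0 : ℝ) ≤ (n : ℝ)⁻¹ := by positivity
    by_cases hi : weight A K h (z i) = 0
    · rw [lpWeight, hi]
      simp only [mul_zero, zero_mul, abs_zero]
      positivity
    have hx : |z i / h| ≤ κ := by
      rw [abs_div, abs_of_pos hh, div_le_iff₀ hh]
      exact (abs_le_of_weight_ne_zero hKsupp hh hi).2
    have hu : |unitVec p ν ⬝ᵥ ((Gam A K p h z)⁻¹ *ᵥ fun j : Fin (p + 1) => (z i / h) ^ (j : ℕ))|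
        ≤ Real.sqrt R2 / (c / κ) := by
      rw [unitVec_dotProduct p ν hν]
      refine abs_inv_mulVec_le hcκ (Real.sqrt_nonneg _) _ hgram _ ?_ _
      rw [Real.sq_sqrt hR2pos.le, hR2]
      refine Finset.sum_le_sum fun k _ => ?_
      rw [← pow_mul, mul_comm, pow_mul, ← sq_abs (z i / h)]
      gcongr
    rw [lpWeight, abs_mul, abs_mul, abs_mul, abs_mul, abs_of_nonneg hn,
      abs_of_nonneg (weight_nonneg hK0 hh _), abs_of_nonneg (by positivity : (0 : ℝ) ≤ (ν ! : ℝ)),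
      abs_of_nonneg (by positivity : (0 : ℝ) ≤ (h ^ ν)⁻¹)]
    calc (ν ! : ℝ) * (h ^ ν)⁻¹ * |unitVec p ν ⬝ᵥ
            ((Gam A K p h z)⁻¹ *ᵥ fun j : Fin (p + 1) => (z i / h) ^ (j : ℕ))|
            * weight A K h (z i) * (n : ℝ)⁻¹
        ≤ (ν ! : ℝ) * (h ^ ν)⁻¹ * (Real.sqrt R2 / (c / κ)) * (B / h) * (n : ℝ)⁻¹ := by
          have := weight_nonneg (A := A) hK0 hh (z i)
          have := weight_le (A := A) hB hKB hh (z i)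
          gcongr
      _ = (ν ! : ℝ) * (Real.sqrt R2 / (c / κ)) * B * (h ^ (ν + 1))⁻¹ * (n : ℝ)⁻¹ := by
          rw [pow_succ]
          field_simp
      _ ≤ _ := by
          gcongr
          linarith [abs_nonneg N]
  · intro k hk
    exact sum_lpWeight_mul_pow A K ν p k hν hk h hh z hunit
  · refine hcount.trans ?_
    gcongr
    have : 0 ≤ (ν ! : ℝ) * (Real.sqrt R2 / (c / κ)) * B := by positivity
    linarith [le_abs_self N]
  · rw [← biasB_eq_sum A K ν p (p + 1) (by omega) h hh z, abs_mul,
      abs_of_pos (pow_pos hh _), mul_comm]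
    refine mul_le_mul_of_nonneg_left ?_ (by positivity)
    -- `β` holds the coefficients of the weighted least squares projection of `x ^ (p + 1)` on
    -- degree at most `p`; the normal equations are the orthogonality asked for by
    -- `pow_le_abs_coeff`.
    set β := (Gam A K p h z)⁻¹ *ᵥ Theta A K p (p + 1) h z with hβ
    have hGβ : Gam A K p h z *ᵥ β = Theta A K p (p + 1) h z := by
      rw [hβ, Matrix.mulVec_mulVec, Matrix.mul_nonsing_inv _ hunit, Matrix.one_mulVec]
    have horth : ∀ k : Fin (p + 1), ∑ i, weight A K h (z i) * (n : ℝ)⁻¹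
        * ((z i / h) ^ (p + 1) - ∑ j : Fin (p + 1), β j * (z i / h) ^ (j : ℕ))
        * (z i / h) ^ (k : ℕ) = 0 := by
      intro k
      have h1 := congrFun hGβ k
      rw [Theta_apply] at h1
      simp only [Matrix.mulVec, dotProduct, Gam_apply, Finset.sum_mul] at h1
      rw [Finset.sum_comm] at h1
      rw [← sub_eq_zero, ← Finset.sum_sub_distrib] at h1
      rw [← neg_eq_zero, ← h1, ← Finset.sum_neg_distrib]
      refine Finset.sum_congr rfl fun i _ => ?_
      have h2 : ∑ j : Fin (p + 1), weight A K h (z i) * (n : ℝ)⁻¹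
          * ((z i / h) ^ (k : ℕ) * (z i / h) ^ (j : ℕ)) * β j
          = weight A K h (z i) * (n : ℝ)⁻¹ * (z i / h) ^ (k : ℕ)
            * ∑ j : Fin (p + 1), β j * (z i / h) ^ (j : ℕ) := by
        rw [Finset.mul_sum]
        exact Finset.sum_congr rfl fun j _ => by ring
      rw [h2]
      ring
    have h1 := H.pow_le_abs_coeff hc (mul_pos hM hR2pos) hformn (fun g => H.gram_le g) β horth
      ⟨ν, Nat.lt_succ_of_le hν⟩
    rw [biasB, unitVec_dotProduct p ν hν, ← hβ, abs_mul,
      abs_of_nonneg (by positivity : (0 : ℝ) ≤ (ν ! : ℝ))]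
    refine h1.trans (le_mul_of_one_le_left (abs_nonneg _) ?_)
    exact_mod_cast Nat.one_le_iff_ne_zero.mpr (Nat.factorial_ne_zero ν)

theorem abs_sum_mul_le {n : ℕ} (S : Finset (Fin n)) (w f : Fin n → ℝ) {D F N : ℝ} (hD : 0 ≤ D)
    (hF : 0 ≤ F) (hS : ∀ i, i ∉ S → w i * f i = 0) (hw : ∀ i, |w i| ≤ D)
    (hf : ∀ i ∈ S, w i ≠ 0 → |f i| ≤ F) (hN : (S.card : ℝ) ≤ N) : |∑ i, w i * f i| ≤ N * (D * F) := by
  rw [← Finset.sum_subset (Finset.subset_univ S) fun i _ hi => hS i hi]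
  calc |∑ i ∈ S, w i * f i| ≤ ∑ i ∈ S, |w i * f i| := Finset.abs_sum_le_sum_abs _ _
    _ ≤ ∑ i ∈ S, D * F := by
        refine Finset.sum_le_sum fun i hi => ?_
        by_cases h0 : w i = 0
        · rw [h0, zero_mul, abs_zero]
          positivity
        · rw [abs_mul]
          exact mul_le_mul (hw i) (hf i hi h0) (abs_nonneg _) hD
    _ = S.card * (D * F) := by rw [Finset.sum_const, nsmul_eq_mul]
    _ ≤ N * (D * F) := by gcongr

namespace IsLPWeight

variable {n : ℕ} {A : Set ℝ} {κ : ℝ} {ν p : ℕ} {h C : ℝ} {z w : Fin n → ℝ}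

theorem mono (H : IsLPWeight A κ ν p h C z w) (hh : 0 < h) {C' : ℝ} (hC : C ≤ C') :
    IsLPWeight A κ ν p h C' z w where
  supp := H.supp
  bound i := (H.bound i).trans (by gcongr)
  moment := H.moment
  count := H.count.trans (by gcongr)

/-- A local polynomial estimator applied to a function bounded by `F` on the window. -/
theorem abs_sum_le (H : IsLPWeight A κ ν p h C z w) (hn : 0 < n) (hh : 0 < h) (hC : 0 < C)
    (f : Fin n → ℝ) {F : ℝ} (hF : 0 ≤ F) (hf : ∀ i, w i ≠ 0 → |f i| ≤ F) :
    |∑ i, w i * f i| ≤ C ^ 2 * ((h ^ ν)⁻¹ * F) := by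
  have hn' : (0 : ℝ) < n := by exact_mod_cast hn
  refine (abs_sum_mul_le (Finset.univ.filter fun i => |z i| ≤ κ * h) w f (by positivity) hF ?_
    H.bound (fun i _ hi => hf i hi) H.count).trans_eq ?_
  · intro i hi
    by_contra h0
    exact hi (Finset.mem_filter.mpr ⟨Finset.mem_univ _, (H.supp i (left_ne_zero_of_mul h0)).2⟩)
  · rw [pow_succ]
    field_simp

/-- A local polynomial estimator applied to a function bounded by `F` on a window of another
bandwidth `b` and zero outside. -/
theorem abs_sum_le_of_window (H : IsLPWeight A κ ν p h C z w) (hn : 0 < n) (hh : 0 < h)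
    (hC : 0 < C) {b : ℝ} (hb : 0 < b)
    (hcount : ((Finset.univ.filter fun i => |z i| ≤ κ * b).card : ℝ) ≤ C * (n * b))
    (f : Fin n → ℝ) {F : ℝ} (hF : 0 ≤ F) (hf : ∀ i, |z i| ≤ κ * b → |f i| ≤ F)
    (hf0 : ∀ i, ¬ |z i| ≤ κ * b → f i = 0) :
    |∑ i, w i * f i| ≤ C ^ 2 * ((h ^ (ν + 1))⁻¹ * b * F) := by
  have hn' : (0 : ℝ) < n := by exact_mod_cast hn
  refine (abs_sum_mul_le (Finset.univ.filter fun i => |z i| ≤ κ * b) w f (by positivity) hF ?_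
    H.bound (fun i hi _ => hf i (Finset.mem_filter.mp hi).2) hcount).trans_eq ?_
  · intro i hi
    rw [hf0 i fun h1 => hi (Finset.mem_filter.mpr ⟨Finset.mem_univ _, h1⟩), mul_zero]
  · field_simp

end IsLPWeight

/-- Together with the lower bound of `exists_isLPWeight` this fixes the order of the correction
coefficient as `h ^ (p + 1 - ν)`. -/
theorem abs_sum_mul_pow_le {n : ℕ} {A : Set ℝ} {κ : ℝ} (hκ : 0 < κ) {ν p : ℕ} (hν : ν ≤ p)
    {h C : ℝ} {z w : Fin n → ℝ} (H : IsLPWeight A κ ν p h C z w) (hn : 0 < n) (hh : 0 < h)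
    (hC : 0 < C) :
    |∑ i, w i * z i ^ (p + 1)| ≤ C ^ 2 * κ ^ (p + 1) * h ^ (p + 1 - ν) := by
  refine (H.abs_sum_le hn hh hC (fun i => z i ^ (p + 1)) (F := (κ * h) ^ (p + 1)) (by positivity)
    fun i hi => ?_).trans_eq ?_
  · rw [abs_pow]
    exact pow_le_pow_left₀ (abs_nonneg _) (H.supp i hi).2 _
  · obtain ⟨r, hr⟩ := Nat.exists_eq_add_of_le (Nat.le_succ_of_le hν)
    rw [Nat.succ_eq_add_one] at hr
    rw [mul_pow, hr, Nat.add_sub_cancel_left, pow_add h ν r]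
    field_simp

/-! ### The corrected weights: maximum, Euclidean norm and bias -/

/-- The weights of the estimator of a `ν`-th derivative minus the estimated leading bias. -/
def corrected {n : ℕ} (p : ℕ) (z w w' : Fin n → ℝ) (i : Fin n) : ℝ :=
  w i - (∑ j, w j * z j ^ (p + 1)) / ((p + 1)! : ℝ) * w' i

theorem abs_div_factorial_le (x : ℝ) (p : ℕ) : |x / (p ! : ℝ)| ≤ |x| := by
  rw [abs_div, abs_of_nonneg (by positivity : (0 : ℝ) ≤ (p ! : ℝ))]
  refine div_le_self (abs_nonneg _) ?_
  exact_mod_cast Nat.one_le_iff_ne_zero.mpr (Nat.factorial_ne_zero p)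

/-- Both terms are put on one scale: `h ^ (-(ν + 1))` equals `h ^ (p + 1 - ν) * h ^ (-(p + 2))`,
while the correction is of order `h ^ (p + 1 - ν) * b ^ (-(p + 2))`. -/
theorem abs_corrected_le {n : ℕ} {A : Set ℝ} {κ : ℝ} (hκ : 0 < κ) {ν p q : ℕ} (hν : ν ≤ p)
    {h b C : ℝ} (hn : 0 < n) (hh : 0 < h) (hb : 0 < b) (hC : 0 < C) {z w w' : Fin n → ℝ}
    (H : IsLPWeight A κ ν p h C z w) (H' : IsLPWeight A κ (p + 1) q b C z w') (i : Fin n) :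
    |corrected p z w w' i| ≤ (C + C ^ 3 * κ ^ (p + 1)) *
      (h ^ (p + 1 - ν) * (n : ℝ)⁻¹ * (min h b ^ (p + 2))⁻¹) := by
  have hn' : (0 : ℝ) < n := by exact_mod_cast hn
  have hm : 0 < min h b := lt_min hh hb
  have h1 : |w i| ≤ C * (h ^ (p + 1 - ν) * (n : ℝ)⁻¹ * (min h b ^ (p + 2))⁻¹) := by
    refine (H.bound i).trans ?_
    have h2 : (h ^ (ν + 1))⁻¹ = h ^ (p + 1 - ν) * (h ^ (p + 2))⁻¹ := by
      have : p + 2 = (p + 1 - ν) + (ν + 1) := by omega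
      rw [this, pow_add h (p + 1 - ν) (ν + 1)]
      field_simp
    rw [h2]
    calc C * (h ^ (p + 1 - ν) * (h ^ (p + 2))⁻¹) * (n : ℝ)⁻¹
        ≤ C * (h ^ (p + 1 - ν) * (min h b ^ (p + 2))⁻¹) * (n : ℝ)⁻¹ := by
          gcongr
          exact min_le_left _ _
      _ = _ := by ring
  have h2 : |(∑ j, w j * z j ^ (p + 1)) / ((p + 1)! : ℝ) * w' i|
      ≤ C ^ 2 * κ ^ (p + 1) * h ^ (p + 1 - ν) * (C * (min h b ^ (p + 2))⁻¹ * (n : ℝ)⁻¹) := by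
    rw [abs_mul]
    refine mul_le_mul ((abs_div_factorial_le _ _).trans
      (abs_sum_mul_pow_le hκ hν H hn hh hC)) ?_ (abs_nonneg _) (by positivity)
    refine (H'.bound i).trans ?_
    gcongr
    exact min_le_right _ _
  rw [corrected]
  refine (abs_sub _ _).trans ((add_le_add h1 h2).trans_eq ?_)
  ring

theorem sum_sq_window_le {n : ℕ} {κ : ℝ} (hκ : 0 < κ) {b C : ℝ} (hb : 0 < b) {z : Fin n → ℝ}
    (hcount : ((Finset.univ.filter fun i => |z i| ≤ κ * b).card : ℝ) ≤ C * (n * b)) (k : ℕ) :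
    ∑ i, (if |z i| ≤ κ * b then z i ^ k else 0) ^ 2 ≤ C * κ ^ (2 * k) * (n * b ^ (2 * k + 1)) := by
  calc ∑ i, (if |z i| ≤ κ * b then z i ^ k else 0) ^ 2
      = ∑ i with |z i| ≤ κ * b, (z i ^ k) ^ 2 := by
        rw [Finset.sum_filter]
        refine Finset.sum_congr rfl fun i _ => ?_
        split_ifs <;> simp
    _ ≤ ∑ i with |z i| ≤ κ * b, (κ * b) ^ (2 * k) := by
        refine Finset.sum_le_sum fun i hi => ?_
        rw [← pow_mul, mul_comm k 2, pow_mul (z i), ← sq_abs, ← pow_mul]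
        exact pow_le_pow_left₀ (abs_nonneg _) (Finset.mem_filter.mp hi).2 _
    _ = (Finset.univ.filter fun i => |z i| ≤ κ * b).card * (κ * b) ^ (2 * k) := by
        rw [Finset.sum_const, nsmul_eq_mul]
    _ ≤ C * (n * b) * (κ * b) ^ (2 * k) := by gcongr
    _ = _ := by rw [mul_pow]; ring

/-- Cauchy–Schwarz used as duality: a test vector `g` of controlled norm bounds the norm of `a` from
below. -/
theorem sq_le_mul_of_le_abs_sum {n : ℕ} {a g : Fin n → ℝ} {L G : ℝ} (hL : 0 ≤ L)
    (h1 : L ≤ |∑ i, a i * g i|) (h2 : ∑ i, g i ^ 2 ≤ G) : L ^ 2 ≤ (∑ i, a i ^ 2) * G :=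
  calc L ^ 2 ≤ |∑ i, a i * g i| ^ 2 := by gcongr
    _ = (∑ i, a i * g i) ^ 2 := sq_abs _
    _ ≤ (∑ i, a i ^ 2) * ∑ i, g i ^ 2 := Finset.sum_mul_sq_le_sq_mul_sq _ _ _
    _ ≤ (∑ i, a i ^ 2) * G :=
      mul_le_mul_of_nonneg_left h2 (Finset.sum_nonneg fun i _ => sq_nonneg _)

theorem sum_corrected_mul {n : ℕ} (p : ℕ) (z w w' f : Fin n → ℝ) :
    ∑ i, corrected p z w w' i * f i = ∑ i, w i * f i
      - (∑ j, w j * z j ^ (p + 1)) / ((p + 1)! : ℝ) * ∑ i, w' i * f i := by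
  simp only [corrected, sub_mul, Finset.sum_sub_distrib, Finset.mul_sum, mul_assoc]

/-- The weights of the bias-corrected estimator have the largest possible order. -/
theorem exists_le_sum_sq_corrected {κ : ℝ} (hκ : 0 < κ) {ν p : ℕ} (hν : ν ≤ p)
    {C c₁ : ℝ} (hC : 0 < C) (hc₁ : 0 < c₁) :
    ∃ c : ℝ, 0 < c ∧ ∀ (n q : ℕ) (A : Set ℝ) (h b : ℝ) (z w w' : Fin n → ℝ), 0 < n → 0 < h →
      0 < b → p < q → IsLPWeight A κ ν p h C z w → IsLPWeight A κ (p + 1) q b C z w' →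
      c₁ * h ^ (p + 1 - ν) ≤ |∑ i, w i * z i ^ (p + 1)| →
      c * (h ^ (p + 1 - ν)) ^ 2
        ≤ (∑ i, corrected p z w w' i ^ 2) * (n * min h b ^ (2 * p + 3)) := by
  -- The threshold separates `h ≤ θ b`, `b ≤ θ h` and comparable bandwidths. Its last two arguments
  -- make the competing term at most half of the leading one in the first two regimes.
  set θ : ℝ := min 1 (min (2 * (C ^ 4 * κ ^ (p + 1 + ν)))⁻¹ (c₁ / (2 * (C ^ 2 * κ ^ (p + 1)))))
    with hθ
  have hθpos : 0 < θ := lt_min one_pos (lt_min (by positivity) (by positivity))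
  have hθ1 : θ ≤ 1 := min_le_left _ _
  have hθ2 : C ^ 4 * κ ^ (p + 1 + ν) * θ ≤ 1 / 2 := by
    have h1 : θ ≤ (2 * (C ^ 4 * κ ^ (p + 1 + ν)))⁻¹ := (min_le_right _ _).trans (min_le_left _ _)
    calc C ^ 4 * κ ^ (p + 1 + ν) * θ
        ≤ C ^ 4 * κ ^ (p + 1 + ν) * (2 * (C ^ 4 * κ ^ (p + 1 + ν)))⁻¹ := by gcongr
      _ = 1 / 2 := by field_simp
  have hθ3 : C ^ 2 * κ ^ (p + 1) * θ ≤ c₁ / 2 := by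
    have h1 : θ ≤ c₁ / (2 * (C ^ 2 * κ ^ (p + 1))) := (min_le_right _ _).trans (min_le_right _ _)
    calc C ^ 2 * κ ^ (p + 1) * θ ≤ C ^ 2 * κ ^ (p + 1) * (c₁ / (2 * (C ^ 2 * κ ^ (p + 1)))) := by
          gcongr
      _ = c₁ / 2 := by field_simp
  have hθpow : ∀ {x y : ℝ}, 0 < x → 0 < y → x ≤ θ * y → x ^ (p + 2) * (y ^ (p + 2))⁻¹ ≤ θ := by
    intro x y hx hy hxy
    rw [← div_eq_mul_inv, ← div_pow]
    have h1 : x / y ≤ θ := by rwa [div_le_iff₀ hy]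
    calc (x / y) ^ (p + 2) ≤ θ ^ (p + 2) := by gcongr
      _ ≤ θ := pow_le_of_le_one hθpos.le hθ1 (by omega)
  set c : ℝ := min (1 / 4 / (C * κ ^ (2 * ν)))
    (min (c₁ ^ 2 / 4 / (C * κ ^ (2 * (p + 1)))) (θ ^ (2 * p + 3) / (C * κ ^ (2 * ν)))) with hc
  refine ⟨c, lt_min (by positivity) (lt_min (by positivity) (by positivity)), ?_⟩
  intro n q A h b z w w' hn hh hb hpq H H' hlow
  have hn' : (0 : ℝ) < n := by exact_mod_cast hn
  set E := h ^ (p + 1 - ν) with hE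
  have hE0 : 0 < E := by positivity
  set B := ∑ i, w i * z i ^ (p + 1) with hB
  have hBup : |B| ≤ C ^ 2 * κ ^ (p + 1) * E := abs_sum_mul_pow_le hκ hν H hn hh hC
  have hνfac : (1 : ℝ) ≤ (ν ! : ℝ) := by
    exact_mod_cast Nat.one_le_iff_ne_zero.mpr (Nat.factorial_ne_zero ν)
  have hEh : E * h ^ (ν + 1) = h ^ (p + 2) := by
    rw [hE, ← pow_add]
    congr 1
    omega
  set Q := ∑ i, corrected p z w w' i ^ 2 with hQ
  have hQ0 : 0 ≤ Q := Finset.sum_nonneg fun i _ => sq_nonneg _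
  have hmom : ∑ i, w i * z i ^ ν = (ν ! : ℝ) := by rw [H.moment ν hν, if_pos rfl]
  rcases le_or_gt h (θ * b) with hcase | hcase
  · have hhb : h ≤ b := hcase.trans (mul_le_of_le_one_left hb.le hθ1)
    rw [min_eq_left hhb]
    -- Regime `h ≪ b`: against `z ^ ν` on the window of `h`, the main weights give `ν !`, and the
    -- pilot weights are too spread out to matter.
    set g : Fin n → ℝ := fun i => if |z i| ≤ κ * h then z i ^ ν else 0 with hg
    have h1 : ∑ i, w i * g i = (ν ! : ℝ) := by
      rw [← hmom]
      refine Finset.sum_congr rfl fun i _ => ?_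
      by_cases hi : w i = 0
      · rw [hi, zero_mul, zero_mul]
      · simp only [hg, if_pos (H.supp i hi).2]
    have h2 : |∑ i, w' i * g i| ≤ C ^ 2 * ((b ^ (p + 1 + 1))⁻¹ * h * (κ * h) ^ ν) := by
      refine H'.abs_sum_le_of_window hn hb hC hh H.count g (by positivity) (fun i hi => ?_)
        (fun i hi => if_neg hi)
      simp only [hg, if_pos hi, abs_pow]
      exact pow_le_pow_left₀ (abs_nonneg _) hi _
    have h3 : |B / ((p + 1)! : ℝ) * ∑ i, w' i * g i| ≤ 1 / 2 := by
      rw [abs_mul]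
      calc |B / ((p + 1)! : ℝ)| * |∑ i, w' i * g i|
          ≤ (C ^ 2 * κ ^ (p + 1) * E) * (C ^ 2 * ((b ^ (p + 1 + 1))⁻¹ * h * (κ * h) ^ ν)) :=
            mul_le_mul ((abs_div_factorial_le _ _).trans hBup) h2 (abs_nonneg _) (by positivity)
        _ = C ^ 4 * κ ^ (p + 1 + ν) * ((E * h ^ (ν + 1)) * (b ^ (p + 2))⁻¹) := by
            rw [mul_pow]; ring
        _ ≤ C ^ 4 * κ ^ (p + 1 + ν) * θ := by
            rw [hEh]
            exact mul_le_mul_of_nonneg_left (hθpow hh hb hcase) (by positivity)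
        _ ≤ 1 / 2 := hθ2
    have h4 : (1 / 2 : ℝ) ≤ |∑ i, corrected p z w w' i * g i| := by
      rw [sum_corrected_mul, h1]
      refine le_trans ?_ (le_abs_self _)
      linarith [(abs_le.mp h3).2]
    have h5 := sq_le_mul_of_le_abs_sum (by norm_num) h4 (sum_sq_window_le hκ hh H.count ν)
    have h6 : c * E ^ 2 ≤ 1 / 4 / (C * κ ^ (2 * ν)) * E ^ 2 := by
      gcongr
      exact min_le_left _ _
    refine h6.trans ?_
    rw [div_mul_eq_mul_div, div_le_iff₀ (by positivity)]
    have h7 : h ^ (2 * p + 3) = h ^ (2 * ν + 1) * E ^ 2 := by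
      rw [hE, ← pow_mul, ← pow_add]
      congr 1
      omega
    calc 1 / 4 * E ^ 2 = (1 / 2) ^ 2 * E ^ 2 := by norm_num
      _ ≤ Q * (C * κ ^ (2 * ν) * (n * h ^ (2 * ν + 1))) * E ^ 2 := by gcongr
      _ = _ := by rw [h7]; ring
  rcases le_or_gt b (θ * h) with hcase' | hcase'
  · have hbh : b ≤ h := hcase'.trans (mul_le_of_le_one_left hh.le hθ1)
    rw [min_eq_right hbh]
    -- Regime `b ≪ h`: against `z ^ (p + 1)` on the window of `b`, the pilot weights give `(p +
    -- 1)!`, so the correction contributes exactly `B`. Its lower bound `hlow` beats the main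
    -- weights.
    set g : Fin n → ℝ := fun i => if |z i| ≤ κ * b then z i ^ (p + 1) else 0 with hg
    have h1 : ∑ i, w' i * g i = ((p + 1)! : ℝ) := by
      have := H'.moment (p + 1) hpq
      rw [if_pos rfl] at this
      rw [← this]
      refine Finset.sum_congr rfl fun i _ => ?_
      by_cases hi : w' i = 0
      · rw [hi, zero_mul, zero_mul]
      · simp only [hg, if_pos (H'.supp i hi).2]
    have h2 : |∑ i, w i * g i| ≤ C ^ 2 * ((h ^ (ν + 1))⁻¹ * b * (κ * b) ^ (p + 1)) := by
      refine H.abs_sum_le_of_window hn hh hC hb H'.count g (by positivity) (fun i hi => ?_)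
        (fun i hi => if_neg hi)
      simp only [hg, if_pos hi, abs_pow]
      exact pow_le_pow_left₀ (abs_nonneg _) hi _
    have h3 : |∑ i, w i * g i| ≤ c₁ / 2 * E := by
      refine h2.trans ?_
      calc C ^ 2 * ((h ^ (ν + 1))⁻¹ * b * (κ * b) ^ (p + 1))
          = C ^ 2 * κ ^ (p + 1) * (b ^ (p + 2) * (h ^ (p + 2))⁻¹) * E := by
            rw [← hEh, mul_pow]
            field_simp
            ring
        _ ≤ C ^ 2 * κ ^ (p + 1) * θ * E := by
            gcongr
            exact hθpow hb hh hcase'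
        _ ≤ c₁ / 2 * E := by gcongr
    have h4 : c₁ / 2 * E ≤ |∑ i, corrected p z w w' i * g i| := by
      rw [sum_corrected_mul, h1, div_mul_cancel₀ _ (by positivity), abs_sub_comm]
      have := abs_sub_abs_le_abs_sub B (∑ i, w i * g i)
      linarith
    have h5 := sq_le_mul_of_le_abs_sum (by positivity) h4 (sum_sq_window_le hκ hb H'.count (p + 1))
    have h6 : c * E ^ 2 ≤ c₁ ^ 2 / 4 / (C * κ ^ (2 * (p + 1))) * E ^ 2 := by
      gcongr
      exact (min_le_right _ _).trans (min_le_left _ _)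
    refine h6.trans ?_
    rw [div_mul_eq_mul_div, div_le_iff₀ (by positivity)]
    calc c₁ ^ 2 / 4 * E ^ 2 = (c₁ / 2 * E) ^ 2 := by ring
      _ ≤ Q * (C * κ ^ (2 * (p + 1)) * (n * b ^ (2 * (p + 1) + 1))) := h5
      _ = _ := by ring
  -- Comparable bandwidths: on the larger window, which contains both supports, the moment
  -- conditions for `z ^ ν` are exact, `ν !` for the main weights and `0` for the pilot weights.
  -- Then `θ * N ≤ m` exchanges the two scales.
  · set m := min h b with hm
    set N := max h b with hN
    have hm0 : 0 < m := lt_min hh hb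
    have hN0 : 0 < N := hh.trans_le (le_max_left _ _)
    have hNm : θ * N ≤ m := by
      rcases le_total h b with h0 | h0
      · rw [hm, hN, min_eq_left h0, max_eq_right h0]
        exact hcase.le
      · rw [hm, hN, min_eq_right h0, max_eq_left h0]
        exact hcase'.le
    have hcount : ((Finset.univ.filter fun i => |z i| ≤ κ * N).card : ℝ) ≤ C * (n * N) := by
      rcases le_total h b with h0 | h0
      · rw [hN, max_eq_right h0]
        exact H'.count
      · rw [hN, max_eq_left h0]
        exact H.count
    set g : Fin n → ℝ := fun i => if |z i| ≤ κ * N then z i ^ ν else 0 with hg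
    have h1 : ∑ i, w i * g i = (ν ! : ℝ) := by
      rw [← hmom]
      refine Finset.sum_congr rfl fun i _ => ?_
      by_cases hi : w i = 0
      · rw [hi, zero_mul, zero_mul]
      · have : |z i| ≤ κ * N := (H.supp i hi).2.trans (by gcongr; exact le_max_left _ _)
        simp only [hg, if_pos this]
    have h2 : ∑ i, w' i * g i = 0 := by
      have := H'.moment ν (by omega)
      rw [if_neg (by omega)] at this
      rw [← this]
      refine Finset.sum_congr rfl fun i _ => ?_
      by_cases hi : w' i = 0
      · rw [hi, zero_mul, zero_mul]
      · have : |z i| ≤ κ * N := (H'.supp i hi).2.trans (by gcongr; exact le_max_right _ _)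
        simp only [hg, if_pos this]
    have h4 : (1 : ℝ) ≤ |∑ i, corrected p z w w' i * g i| := by
      rw [sum_corrected_mul, h1, h2, mul_zero, sub_zero]
      exact hνfac.trans (le_abs_self _)
    have h5 := sq_le_mul_of_le_abs_sum (by norm_num) h4 (sum_sq_window_le hκ hN0 hcount ν)
    have h6 : c * E ^ 2 ≤ θ ^ (2 * p + 3) / (C * κ ^ (2 * ν)) * E ^ 2 := by
      gcongr
      exact (min_le_right _ _).trans (min_le_right _ _)
    refine h6.trans ?_
    rw [div_mul_eq_mul_div, div_le_iff₀ (by positivity)]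
    have h7 : N ^ (2 * p + 3) = N ^ (2 * ν + 1) * (N ^ (p + 1 - ν)) ^ 2 := by
      rw [← pow_mul, ← pow_add]
      congr 1
      omega
    have h8 : E ≤ N ^ (p + 1 - ν) := pow_le_pow_left₀ hh.le (le_max_left _ _) _
    calc θ ^ (2 * p + 3) * E ^ 2 = θ ^ (2 * p + 3) * E ^ 2 * 1 ^ 2 := by ring
      _ ≤ θ ^ (2 * p + 3) * (N ^ (p + 1 - ν)) ^ 2
          * (Q * (C * κ ^ (2 * ν) * (n * N ^ (2 * ν + 1)))) := by gcongr
      _ = Q * n * (C * κ ^ (2 * ν)) * (θ * N) ^ (2 * p + 3) := by rw [mul_pow, h7]; ring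
      _ ≤ Q * n * (C * κ ^ (2 * ν)) * m ^ (2 * p + 3) := by gcongr
      _ = _ := by ring

/-- The bias of the bias-corrected estimator. -/
theorem abs_sum_corrected_sub_le {n : ℕ} {A : Set ℝ} {κ : ℝ} (hκ : 0 < κ) {ν p q : ℕ}
    (hν : ν ≤ p) (hpq : p < q) {h b C M : ℝ} (hn : 0 < n) (hh : 0 < h) (hb : 0 < b) (hC : 0 < C)
    (hM : 0 ≤ M) {z w w' : Fin n → ℝ} (H : IsLPWeight A κ ν p h C z w)
    (H' : IsLPWeight A κ (p + 1) q b C z w') (f : Fin n → ℝ) (t : ℕ → ℝ)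
    (hf : ∀ i, w i ≠ 0 → |f i - ∑ k ∈ Finset.range (p + 2), t k * z i ^ k| ≤ M * |z i| ^ (p + 2))
    (hf' : ∀ i, w' i ≠ 0 →
      |f i - ∑ k ∈ Finset.range (q + 1), t k * z i ^ k| ≤ M * |z i| ^ (q + 1)) :
    |∑ i, corrected p z w w' i * f i - (ν ! : ℝ) * t ν|
      ≤ (C ^ 2 * M * κ ^ (p + 2) + C ^ 4 * M * κ ^ (p + q + 2))
        * (h ^ (p + 1 - ν) * (h + b ^ (q - p))) := by
  set E := h ^ (p + 1 - ν) with hE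
  set B := ∑ i, w i * z i ^ (p + 1) with hB
  have hBup : |B| ≤ C ^ 2 * κ ^ (p + 1) * E := abs_sum_mul_pow_le hκ hν H hn hh hC
  set r : Fin n → ℝ := fun i => f i - ∑ k ∈ Finset.range (p + 2), t k * z i ^ k with hr
  set r' : Fin n → ℝ := fun i => f i - ∑ k ∈ Finset.range (q + 1), t k * z i ^ k with hr'
  have hsum : ∀ (v : Fin n → ℝ) (d : ℕ), ∑ i, v i * ∑ k ∈ Finset.range d, t k * z i ^ k
      = ∑ k ∈ Finset.range d, t k * ∑ i, v i * z i ^ k := by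
    intro v d
    simp only [Finset.mul_sum]
    rw [Finset.sum_comm]
    exact Finset.sum_congr rfl fun k _ => Finset.sum_congr rfl fun i _ => by ring
  -- The expansion goes one degree beyond exactness; the leading bias is `t (p + 1) * B`.
  have h1 : ∑ i, w i * f i = (ν ! : ℝ) * t ν + t (p + 1) * B + ∑ i, w i * r i := by
    have h2 : ∑ i, w i * f i
        = ∑ i, w i * (∑ k ∈ Finset.range (p + 2), t k * z i ^ k) + ∑ i, w i * r i := by
      rw [← Finset.sum_add_distrib]
      exact Finset.sum_congr rfl fun i _ => by rw [hr]; ring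
    rw [h2, hsum, Finset.sum_range_succ, ← hB]
    congr 2
    rw [Finset.sum_eq_single ν]
    · rw [H.moment ν hν, if_pos rfl, mul_comm]
    · intro k hk hkν
      rw [H.moment k (Nat.lt_succ_iff.mp (Finset.mem_range.mp hk)), if_neg hkν, mul_zero]
    · intro h0
      exact absurd (Finset.mem_range.mpr (Nat.lt_succ_of_le hν)) h0
  have h1' : ∑ i, w' i * f i = ((p + 1)! : ℝ) * t (p + 1) + ∑ i, w' i * r' i := by
    have h2 : ∑ i, w' i * f i
        = ∑ i, w' i * (∑ k ∈ Finset.range (q + 1), t k * z i ^ k) + ∑ i, w' i * r' i := by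
      rw [← Finset.sum_add_distrib]
      exact Finset.sum_congr rfl fun i _ => by rw [hr']; ring
    rw [h2, hsum]
    congr 1
    rw [Finset.sum_eq_single (p + 1)]
    · rw [H'.moment (p + 1) hpq, if_pos rfl, mul_comm]
    · intro k hk hkν
      rw [H'.moment k (Nat.lt_succ_iff.mp (Finset.mem_range.mp hk)), if_neg hkν, mul_zero]
    · intro h0
      exact absurd (Finset.mem_range.mpr (Nat.succ_lt_succ hpq)) h0
  have h3 : |∑ i, w i * r i| ≤ C ^ 2 * M * κ ^ (p + 2) * (E * h) := by
    refine (H.abs_sum_le hn hh hC r (F := M * (κ * h) ^ (p + 2)) (by positivity)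
      fun i hi => (hf i hi).trans ?_).trans_eq ?_
    · have := (H.supp i hi).2
      gcongr
    · have : p + 2 = (p + 1 - ν) + 1 + ν := by omega
      rw [mul_pow, hE]
      rw [this, pow_add h _ ν, pow_succ h]
      field_simp
  have h3' : |∑ i, w' i * r' i| ≤ C ^ 2 * M * κ ^ (q + 1) * b ^ (q - p) := by
    refine (H'.abs_sum_le hn hb hC r' (F := M * (κ * b) ^ (q + 1)) (by positivity)
      fun i hi => (hf' i hi).trans ?_).trans_eq ?_
    · have := (H'.supp i hi).2
      gcongr
    · have : b ^ (q + 1) = b ^ (p + 1) * b ^ (q - p) := by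
        rw [← pow_add]
        congr 1
        omega
      rw [mul_pow, this]
      field_simp
  have hfac : ((p + 1)! : ℝ) ≠ 0 := by positivity
  -- The pilot fit reproduces `(p + 1)! * t (p + 1)`, so the leading bias cancels and only Taylor
  -- remainders are left.
  have h4 : ∑ i, corrected p z w w' i * f i - (ν ! : ℝ) * t ν
      = ∑ i, w i * r i - B / ((p + 1)! : ℝ) * ∑ i, w' i * r' i := by
    rw [sum_corrected_mul, h1, h1', ← hB]
    field_simp
    ring
  rw [h4]
  have h5 : |B / ((p + 1)! : ℝ) * ∑ i, w' i * r' i|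
      ≤ C ^ 2 * κ ^ (p + 1) * E * (C ^ 2 * M * κ ^ (q + 1) * b ^ (q - p)) := by
    rw [abs_mul]
    exact mul_le_mul ((abs_div_factorial_le _ _).trans hBup) h3' (abs_nonneg _) (by positivity)
  refine (abs_sub _ _).trans ((add_le_add h3 h5).trans ?_)
  have h6 : 0 ≤ C ^ 2 * M * κ ^ (p + 2) * (E * b ^ (q - p)) := by positivity
  have h7 : 0 ≤ C ^ 4 * M * κ ^ (p + q + 2) * (E * h) := by positivity
  have h8 : C ^ 2 * κ ^ (p + 1) * E * (C ^ 2 * M * κ ^ (q + 1) * b ^ (q - p))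
      = C ^ 4 * M * κ ^ (p + q + 2) * (E * b ^ (q - p)) := by
    rw [show p + q + 2 = (p + 1) + (q + 1) by omega, pow_add]
    ring
  rw [h8]
  linarith [h6, h7, mul_add (C ^ 2 * M * κ ^ (p + 2)) (E * h) (E * b ^ (q - p))]

/-! ### Conditioning an i.i.d. sample on the running variables -/

/-- The product of the kernel `k` over the coordinates. -/
def piKernel (ι : Type*) [Fintype ι] {α β : Type*} [MeasurableSpace α] [MeasurableSpace β]
    (k : Kernel α β) [IsMarkovKernel k] : Kernel (ι → α) (ι → β) where
  toFun z := Measure.pi fun i => k (z i)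
  measurable' := by
    refine Measurable.measure_of_isPiSystem_of_isProbabilityMeasure generateFrom_pi.symm
      isPiSystem_pi ?_
    rintro _ ⟨s, hs, rfl⟩
    simp only [Measure.pi_pi]
    refine Finset.measurable_fun_prod _ fun i _ => ?_
    exact (k.measurable_coe (hs i (Set.mem_univ i))).comp (measurable_pi_apply i)

theorem piKernel_apply (ι : Type*) [Fintype ι] {α β : Type*} [MeasurableSpace α]
    [MeasurableSpace β] (k : Kernel α β) [IsMarkovKernel k] (z : ι → α) :
    piKernel ι k z = Measure.pi fun i => k (z i) := rfl

instance (ι : Type*) [Fintype ι] {α β : Type*} [MeasurableSpace α] [MeasurableSpace β]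
    (k : Kernel α β) [IsMarkovKernel k] : IsMarkovKernel (piKernel ι k) where
  isProbabilityMeasure z := by
    rw [piKernel_apply]
    infer_instance

/-- Independent pairs can be drawn by sampling all first components and then each second component
from its own conditional law. Both sides factor over the coordinates on products of measurable
rectangles, which determine the measure. -/
theorem pi_compProd (ι : Type*) [Fintype ι] {α β : Type*} [MeasurableSpace α]
    [MeasurableSpace β] (μ : Measure α) [IsProbabilityMeasure μ] (k : Kernel α β)
    [IsMarkovKernel k] :
    Measure.pi (fun _ : ι => μ ⊗ₘ k)
      = ((Measure.pi fun _ : ι => μ) ⊗ₘ piKernel ι k).map fun w i => (w.1 i, w.2 i) := by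
  have hmeas : Measurable fun (w : (ι → α) × (ι → β)) i => (w.1 i, w.2 i) := by fun_prop
  refine Measure.pi_eq_generateFrom (C := fun _ =>
      Set.image2 (· ×ˢ ·) {s : Set α | MeasurableSet s} {t : Set β | MeasurableSet t})
    (fun _ => generateFrom_prod) (fun _ => isPiSystem_prod)
    (fun _ => ⟨fun _ => Set.univ, fun _ => ⟨Set.univ, .univ, Set.univ, .univ, by simp⟩,
      fun _ => measure_lt_top _ _, by simp [Set.iUnion_const]⟩) fun s hs => ?_
  choose A hA B hB hAB using hs
  have hpre : (fun (w : (ι → α) × (ι → β)) i => (w.1 i, w.2 i)) ⁻¹' Set.univ.pi s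
      = Set.univ.pi A ×ˢ Set.univ.pi B := by
    ext w
    simp only [Set.mem_preimage, Set.mem_pi, Set.mem_univ, forall_const, Set.mem_prod, ← hAB,
      forall_and]
  have hms : MeasurableSet (Set.univ.pi s) := MeasurableSet.univ_pi fun i => by
    rw [← hAB]
    exact (hA i).prod (hB i)
  rw [Measure.map_apply hmeas hms, hpre, Measure.compProd_apply_prod
    (MeasurableSet.univ_pi hA) (MeasurableSet.univ_pi hB),
    ← lintegral_indicator (MeasurableSet.univ_pi hA)]
  have h1 : ∀ z : ι → α, (Set.univ.pi A).indicator (fun z => piKernel ι k z (Set.univ.pi B)) z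
      = ∏ i, (A i).indicator (fun a => k a (B i)) (z i) := by
    intro z
    by_cases hz : z ∈ Set.univ.pi A
    · rw [Set.indicator_of_mem hz, piKernel_apply, Measure.pi_pi]
      exact Finset.prod_congr rfl fun i _ =>
        (Set.indicator_of_mem (hz i (Set.mem_univ i)) fun a => k a (B i)).symm
    · rw [Set.indicator_of_notMem hz]
      simp only [Set.mem_pi, Set.mem_univ, forall_const, not_forall] at hz
      obtain ⟨i, hi⟩ := hz
      exact (Finset.prod_eq_zero (Finset.mem_univ i) (Set.indicator_of_notMem hi _)).symm
  simp only [h1]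
  have hmi : ∀ i, Measurable ((A i).indicator fun a => k a (B i)) := fun i =>
    (k.measurable_coe (hB i)).indicator (hA i)
  rw [lintegral_prod_eq_prod_lintegral_of_indepFun Finset.univ
    (fun i (z : ι → α) => (A i).indicator (fun a => k a (B i)) (z i))
    (iIndepFun_pi fun i => (hmi i).aemeasurable)
    (fun i => (hmi i).comp (measurable_pi_apply i))]
  refine Finset.prod_congr rfl fun i _ => ?_
  rw [(measurePreserving_eval (fun _ : ι => μ) i).lintegral_comp (hmi i),
    lintegral_indicator (hA i), ← Measure.compProd_apply_prod (hA i) (hB i)]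
  exact congrArg _ (hAB i)

/-- The characteristic function of a sum whose weights depend on the conditioning variables. -/
theorem integral_exp_weighted_sum {ι : Type*} [Fintype ι] {α : Type*} [MeasurableSpace α]
    (μ : Measure α) [IsProbabilityMeasure μ] (k : Kernel α ℝ) [IsMarkovKernel k]
    (L : (ι → α) → ι → ℝ) (hL : ∀ i, Measurable fun z => L z i) (c : (ι → α) → ℝ)
    (hc : Measurable c) :
    ∫ w, Complex.exp (((∑ i, L (fun j => (w j).1) i * (w i).2 - c (fun j => (w j).1) : ℝ) : ℂ)
        * Complex.I) ∂(Measure.pi fun _ : ι => μ ⊗ₘ k)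
      = ∫ z, Complex.exp (-(c z : ℂ) * Complex.I) * ∏ i, charFun (k (z i)) (L z i)
          ∂(Measure.pi fun _ : ι => μ) := by
  have hmeas : Measurable fun (w : (ι → α) × (ι → ℝ)) i => (w.1 i, w.2 i) := by fun_prop
  have hint : Measurable fun w : (ι → α) × (ι → ℝ) =>
      Complex.exp (((∑ i, L w.1 i * w.2 i - c w.1 : ℝ) : ℂ) * Complex.I) := by
    have : ∀ i, Measurable fun w : (ι → α) × (ι → ℝ) => L w.1 i :=
      fun i => (hL i).comp measurable_fst
    have : Measurable fun w : (ι → α) × (ι → ℝ) => c w.1 := hc.comp measurable_fst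
    fun_prop
  rw [pi_compProd, integral_map hmeas.aemeasurable]
  · rw [Measure.integral_compProd]
    · refine integral_congr_ae (ae_of_all _ fun z => ?_)
      simp only [piKernel_apply]
      have h1 : ∀ x : ι → ℝ, Complex.exp (((∑ i, L z i * x i - c z : ℝ) : ℂ) * Complex.I)
          = Complex.exp (-(c z : ℂ) * Complex.I)
            * ∏ i, Complex.exp ((L z i : ℂ) * (x i : ℂ) * Complex.I) := by
        intro x
        rw [← Complex.exp_sum, ← Complex.exp_add, ← Finset.sum_mul]
        push_cast
        ring_nf
      simp only [h1]
      rw [integral_const_mul, integral_fintype_prod_eq_prod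
        (f := fun i (x : ℝ) => Complex.exp ((L z i : ℂ) * (x : ℂ) * Complex.I))]
      simp only [charFun_apply_real]
    · refine Integrable.of_bound hint.aestronglyMeasurable 1 (ae_of_all _ fun w => ?_)
      rw [Complex.norm_exp_ofReal_mul_I]
  · have h2 : ∀ i, Measurable fun w : ι → α × ℝ => L (fun j => (w j).1) i := fun i =>
      (hL i).comp (by fun_prop)
    have h3 : Measurable fun w : ι → α × ℝ => c (fun j => (w j).1) := hc.comp (by fun_prop)
    exact Measurable.aestronglyMeasurable (by fun_prop)

/-! ### Expansion of characteristic functions and the conditional central limit theorem -/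

/-- For `|x| > 1` every term on the left is dominated by `|x| ^ 3` itself, so one constant covers
all `x`. -/
theorem norm_exp_mul_I_sub_quadratic_le (x : ℝ) :
    ‖Complex.exp (x * Complex.I) - (1 + x * Complex.I - (x : ℂ) ^ 2 / 2)‖ ≤ 4 * |x| ^ 3 := by
  rcases le_or_gt |x| 1 with hx | hx
  · have hn : ‖(x : ℂ) * Complex.I‖ = |x| := by simp
    have h1 := Complex.exp_bound (x := x * Complex.I) (by rw [hn]; exact hx) (n := 3) (by norm_num)
    rw [hn] at h1
    have h2 : ∑ m ∈ Finset.range 3, ((x : ℂ) * Complex.I) ^ m / (m ! : ℂ)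
        = 1 + x * Complex.I - (x : ℂ) ^ 2 / 2 := by
      simp only [Finset.sum_range_succ, Finset.sum_range_zero, mul_pow, Complex.I_sq]
      norm_num [Nat.factorial]
      ring
    rw [h2] at h1
    refine h1.trans ?_
    have h3 : 0 ≤ |x| ^ 3 := by positivity
    norm_num [Nat.factorial]
    linarith
  · have h1 : ‖Complex.exp (x * Complex.I)‖ = 1 := Complex.norm_exp_ofReal_mul_I x
    have h2 : ‖(1 + x * Complex.I - (x : ℂ) ^ 2 / 2 : ℂ)‖ ≤ 1 + |x| + |x| ^ 2 / 2 := by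
      refine (norm_sub_le _ _).trans (add_le_add ((norm_add_le _ _).trans ?_) ?_)
      · simp
      · simp
    refine (norm_sub_le _ _).trans ?_
    rw [h1]
    nlinarith [mul_pos (sub_pos.mpr hx) (sub_pos.mpr hx), mul_pos (mul_pos (sub_pos.mpr hx)
      (sub_pos.mpr hx)) (sub_pos.mpr hx), sq_nonneg |x|]

theorem abs_exp_neg_sub_le {y : ℝ} (hy : 0 ≤ y) : |Real.exp (-y) - (1 - y)| ≤ y ^ 2 := by
  rcases le_or_gt y 1 with h | h
  · have := Real.abs_exp_sub_one_sub_id_le (x := -y) (by rwa [abs_neg, abs_of_nonneg hy])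
    rw [neg_sq] at this
    convert this using 2
    ring
  · have h1 : Real.exp (-y) ≤ 1 := Real.exp_le_one_iff.mpr (by linarith)
    have h2 := Real.exp_pos (-y)
    rw [abs_le]
    constructor <;> nlinarith

/-- Second order expansion of the characteristic function of a centred law. -/
theorem norm_charFun_sub_exp_le {C : ℝ} (ρ : Measure ℝ) [IsProbabilityMeasure ρ] {m v : ℝ}
    (h4 : Integrable (fun x : ℝ => x ^ 4) ρ) (h4C : ∫ x, x ^ 4 ∂ρ ≤ C)
    (hm : ∫ x, x ∂ρ = m) (hv : variance (fun x => x) ρ = v) (t : ℝ) :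
    ‖Complex.exp (-((t * m : ℝ) : ℂ) * Complex.I) * charFun ρ t - Real.exp (-(t ^ 2 * v / 2))‖
      ≤ (16 * (1 + C + (1 + C) ^ 3) + (1 + C) ^ 2) * (|t| ^ 3 + t ^ 4) := by
  -- All lower absolute moments come from `|x| ^ k ≤ 1 + x ^ 4`; this is why the constants are
  -- powers of `1 + C`.
  have hpow : ∀ k ≤ 4, Integrable (fun x : ℝ => |x| ^ k) ρ := by
    intro k hk
    refine Integrable.mono' (h4.add (integrable_const (1 : ℝ)))
      (by fun_prop) (ae_of_all _ fun x => ?_)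
    rw [Real.norm_eq_abs, abs_pow, abs_abs]
    have h0 : x ^ 4 = |x| ^ 4 := by rw [← abs_pow, abs_of_nonneg (by positivity)]
    change _ ≤ x ^ 4 + 1
    rw [h0]
    rcases le_or_gt |x| 1 with h | h
    · have : |x| ^ k ≤ 1 := pow_le_one₀ (abs_nonneg _) h
      have : 0 ≤ |x| ^ 4 := by positivity
      linarith
    · have : |x| ^ k ≤ |x| ^ 4 := pow_le_pow_right₀ h.le hk
      linarith
  have habs : ∀ k ≤ 4, ∫ x, |x| ^ k ∂ρ ≤ 1 + C := by
    intro k hk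
    calc ∫ x, |x| ^ k ∂ρ ≤ ∫ x, (1 + x ^ 4) ∂ρ := by
          refine integral_mono (hpow k hk) ((integrable_const _).add h4) fun x => ?_
          have h0 : x ^ 4 = |x| ^ 4 := by rw [← abs_pow, abs_of_nonneg (by positivity)]
          change |x| ^ k ≤ 1 + x ^ 4
          rw [h0]
          rcases le_or_gt |x| 1 with h | h
          · have : |x| ^ k ≤ 1 := pow_le_one₀ (abs_nonneg _) h
            have : 0 ≤ |x| ^ 4 := by positivity
            linarith
          · have : |x| ^ k ≤ |x| ^ 4 := pow_le_pow_right₀ h.le hk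
            linarith
      _ = 1 + ∫ x, x ^ 4 ∂ρ := by
          rw [integral_add (integrable_const _) h4]
          simp
      _ ≤ 1 + C := by linarith
  have hC0 : 0 ≤ 1 + C := (integral_nonneg fun x => by positivity).trans (habs 0 (by norm_num))
  have hC1 : 1 ≤ 1 + C := by simpa using habs 0 (by norm_num)
  have hid : Integrable (fun x : ℝ => x) ρ := by
    refine (integrable_norm_iff (by fun_prop)).mp ?_
    simpa using hpow 1 (by norm_num)
  have hsq : Integrable (fun x : ℝ => x ^ 2) ρ := by
    simpa using hpow 2 (by norm_num)
  have hm_le : |m| ≤ 1 + C := by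
    rw [← hm]
    exact (abs_integral_le_integral_abs).trans (by simpa using habs 1 (by norm_num))
  have hcen : Integrable (fun x : ℝ => x - m) ρ := hid.sub (integrable_const m)
  have hcen2 : Integrable (fun x : ℝ => (x - m) ^ 2) ρ := by
    have : (fun x : ℝ => (x - m) ^ 2) = fun x => x ^ 2 - 2 * m * x + m ^ 2 := by
      ext x; ring
    rw [this]
    exact (hsq.sub (hid.const_mul _)).add (integrable_const _)
  have hv' : ∫ x, (x - m) ^ 2 ∂ρ = v := by
    rw [← hv, variance_eq_integral (by fun_prop), hm]
  have hcen0 : ∫ x, (x - m) ∂ρ = 0 := by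
    rw [integral_sub hid (integrable_const m), hm]
    simp
  have hv_le : v ≤ 1 + C := by
    have h1 : v = ∫ x, x ^ 2 ∂ρ - m ^ 2 := by
      have h2 : ∀ x : ℝ, (x - m) ^ 2 = x ^ 2 - 2 * m * x + m ^ 2 := fun x => by ring
      have h3 : Integrable (fun x : ℝ => x ^ 2 - 2 * m * x) ρ := hsq.sub (hid.const_mul _)
      rw [← hv']
      simp only [h2]
      rw [integral_add h3 (integrable_const _),
        integral_sub hsq (hid.const_mul _), integral_const_mul, hm]
      simp
      ring
    have h2 : ∫ x, x ^ 2 ∂ρ ≤ 1 + C := by simpa using habs 2 (by norm_num)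
    nlinarith [sq_nonneg m]
  have hv0 : 0 ≤ v := by rw [← hv]; exact variance_nonneg _ _
  have hcube_int : Integrable (fun x : ℝ => 4 * (|x| ^ 3 + |m| ^ 3)) ρ :=
    ((hpow 3 (by norm_num)).add (integrable_const _)).const_mul _
  have hcube : ∀ x : ℝ, |x - m| ^ 3 ≤ 4 * (|x| ^ 3 + |m| ^ 3) := by
    intro x
    have h1 : |x - m| ≤ |x| + |m| := abs_sub _ _
    have h2 : |x - m| ^ 3 ≤ (|x| + |m|) ^ 3 := pow_le_pow_left₀ (abs_nonneg _) h1 3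
    nlinarith [mul_nonneg (add_nonneg (abs_nonneg x) (abs_nonneg m)) (sq_nonneg (|x| - |m|))]
  have hexp_int : Integrable (fun x : ℝ => Complex.exp (((t * (x - m) : ℝ) : ℂ) * Complex.I)) ρ := by
    refine Integrable.of_bound (Continuous.aestronglyMeasurable (by fun_prop)) 1
      (ae_of_all _ fun x => ?_)
    rw [Complex.norm_exp_ofReal_mul_I]
  have hφ : Complex.exp (-((t * m : ℝ) : ℂ) * Complex.I) * charFun ρ t
      = ∫ x, Complex.exp (((t * (x - m) : ℝ) : ℂ) * Complex.I) ∂ρ := by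
    rw [charFun_apply_real, ← integral_const_mul]
    refine integral_congr_ae (ae_of_all _ fun x => ?_)
    simp only
    rw [← Complex.exp_add]
    push_cast
    ring_nf
  have hquad : ∫ x, (1 + ((t * (x - m) : ℝ) : ℂ) * Complex.I - ((t * (x - m) : ℝ) : ℂ) ^ 2 / 2) ∂ρ
      = ((1 - t ^ 2 * v / 2 : ℝ) : ℂ) := by
    have h1 : ∀ x : ℝ, (1 + ((t * (x - m) : ℝ) : ℂ) * Complex.I
        - ((t * (x - m) : ℝ) : ℂ) ^ 2 / 2)
        = ((1 - t ^ 2 / 2 * (x - m) ^ 2 : ℝ) : ℂ) + ((t * (x - m) : ℝ) : ℂ) * Complex.I := by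
      intro x
      push_cast
      ring
    simp only [h1]
    rw [integral_add, integral_mul_const, integral_complex_ofReal, integral_complex_ofReal, integral_sub (integrable_const _)
      (hcen2.const_mul _), integral_const_mul, integral_const_mul, hv', hcen0]
    · simp
      ring
    · exact ((integrable_const _).sub (hcen2.const_mul _)).ofReal
    · exact ((hcen.const_mul t).ofReal).mul_const _
  have hquad_int : Integrable (fun x : ℝ => (1 + ((t * (x - m) : ℝ) : ℂ) * Complex.I
      - ((t * (x - m) : ℝ) : ℂ) ^ 2 / 2)) ρ := by
    have h1 : ∀ x : ℝ, (1 + ((t * (x - m) : ℝ) : ℂ) * Complex.I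
        - ((t * (x - m) : ℝ) : ℂ) ^ 2 / 2)
        = ((1 - t ^ 2 / 2 * (x - m) ^ 2 : ℝ) : ℂ) + ((t * (x - m) : ℝ) : ℂ) * Complex.I := by
      intro x
      push_cast
      ring
    simp only [h1]
    exact (((integrable_const (1 : ℝ)).sub (hcen2.const_mul _)).ofReal).add
      (((hcen.const_mul t).ofReal).mul_const _)
  -- The factor `exp (-i t m)` centres the law and removes the linear term. The third absolute
  -- moment bounds the remainder, with `16 = 4 * 4` from the expansion and from `hcube`.
  have hA : ‖Complex.exp (-((t * m : ℝ) : ℂ) * Complex.I) * charFun ρ t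
      - ((1 - t ^ 2 * v / 2 : ℝ) : ℂ)‖ ≤ 16 * (1 + C + (1 + C) ^ 3) * |t| ^ 3 := by
    rw [hφ, ← hquad, ← integral_sub hexp_int hquad_int]
    calc ‖∫ x, (Complex.exp (((t * (x - m) : ℝ) : ℂ) * Complex.I)
          - (1 + ((t * (x - m) : ℝ) : ℂ) * Complex.I - ((t * (x - m) : ℝ) : ℂ) ^ 2 / 2)) ∂ρ‖
        ≤ ∫ x, 4 * |t| ^ 3 * (4 * (|x| ^ 3 + |m| ^ 3)) ∂ρ := by
          refine norm_integral_le_of_norm_le (hcube_int.const_mul _) (ae_of_all _ fun x => ?_)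
          refine (norm_exp_mul_I_sub_quadratic_le _).trans ?_
          rw [abs_mul, mul_pow, ← mul_assoc]
          exact mul_le_mul_of_nonneg_left (hcube x) (by positivity)
      _ = 16 * |t| ^ 3 * (∫ x, |x| ^ 3 ∂ρ + |m| ^ 3) := by
          rw [integral_const_mul, integral_const_mul,
            integral_add (hpow 3 (by norm_num)) (integrable_const _)]
          simp
          ring
      _ ≤ 16 * |t| ^ 3 * ((1 + C) + (1 + C) ^ 3) := by
          have := habs 3 (by norm_num)
          gcongr
      _ = _ := by ring
  -- Passing from `1 - t² v / 2` to the Gaussian factor costs the order `t ^ 4`.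
  have hB : ‖((1 - t ^ 2 * v / 2 : ℝ) : ℂ) - Real.exp (-(t ^ 2 * v / 2))‖
      ≤ (1 + C) ^ 2 * t ^ 4 := by
    rw [← Complex.ofReal_sub, Complex.norm_real, Real.norm_eq_abs, abs_sub_comm]
    refine (abs_exp_neg_sub_le (by positivity)).trans ?_
    calc (t ^ 2 * v / 2) ^ 2 = v ^ 2 * t ^ 4 / 4 := by ring
      _ ≤ (1 + C) ^ 2 * t ^ 4 / 4 := by gcongr
      _ ≤ _ := by
        have : 0 ≤ (1 + C) ^ 2 * t ^ 4 := by positivity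
        linarith
  have htri := norm_sub_le_norm_sub_add_norm_sub
    (Complex.exp (-((t * m : ℝ) : ℂ) * Complex.I) * charFun ρ t)
    ((1 - t ^ 2 * v / 2 : ℝ) : ℂ) (Real.exp (-(t ^ 2 * v / 2)) : ℂ)
  refine htri.trans ((add_le_add hA hB).trans ?_)
  have h1 : 0 ≤ 16 * (1 + C + (1 + C) ^ 3) * t ^ 4 := by positivity
  have h2 : 0 ≤ (1 + C) ^ 2 * |t| ^ 3 := by positivity
  nlinarith [h1, h2]

/-- Telescoping over the factors, all of which lie in the unit disc. -/
theorem norm_prod_sub_prod_le {ι : Type*} (s : Finset ι) (f g : ι → ℂ) (hf : ∀ i ∈ s, ‖f i‖ ≤ 1)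
    (hg : ∀ i ∈ s, ‖g i‖ ≤ 1) : ‖∏ i ∈ s, f i - ∏ i ∈ s, g i‖ ≤ ∑ i ∈ s, ‖f i - g i‖ := by
  classical
  induction s using Finset.induction_on with
  | empty => simp
  | insert a s ha ih =>
    rw [Finset.prod_insert ha, Finset.prod_insert ha, Finset.sum_insert ha]
    have h1 : f a * ∏ i ∈ s, f i - g a * ∏ i ∈ s, g i
        = (f a - g a) * ∏ i ∈ s, f i + g a * (∏ i ∈ s, f i - ∏ i ∈ s, g i) := by ring
    have h2 := ih (fun i hi => hf i (Finset.mem_insert_of_mem hi))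
      (fun i hi => hg i (Finset.mem_insert_of_mem hi))
    have h3 : ‖∏ i ∈ s, f i‖ ≤ 1 := by
      rw [norm_prod]
      exact Finset.prod_le_one (fun i _ => norm_nonneg _)
        fun i hi => hf i (Finset.mem_insert_of_mem hi)
    rw [h1]
    refine (norm_add_le _ _).trans (add_le_add ?_ ?_)
    · rw [norm_mul]
      exact mul_le_of_le_one_right (norm_nonneg _) h3
    · rw [norm_mul]
      exact (mul_le_of_le_one_left (norm_nonneg _) (hg a (Finset.mem_insert_self _ _))).trans h2

/-- Conditionally on the running variables, the studentized statistic is nearly standard normal. -/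
theorem norm_exp_mul_prod_charFun_sub_le {n : ℕ} {C vmin η δ τ : ℝ} (hvmin : 0 < vmin)
    (hη : 0 ≤ η) (hδ : 0 ≤ δ) (a m v : Fin n → ℝ) (ρ : Fin n → Measure ℝ)
    [∀ i, IsProbabilityMeasure (ρ i)] (hQ : 0 < ∑ i, a i ^ 2)
    (hv : ∀ i, a i ≠ 0 → vmin ≤ v i)
    (hρ : ∀ i, a i ≠ 0 → Integrable (fun x : ℝ => x ^ 4) (ρ i) ∧ ∫ x, x ^ 4 ∂(ρ i) ≤ C ∧
      ∫ x, x ∂(ρ i) = m i ∧ variance (fun x => x) (ρ i) = v i)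
    (ha : ∀ i, |a i| ≤ η * Real.sqrt (∑ i, a i ^ 2))
    (hbias : |∑ i, a i * m i - τ| ≤ δ * Real.sqrt (∑ i, a i ^ 2)) (t : ℝ) :
    ‖Complex.exp (-((t * τ / Real.sqrt (∑ i, a i ^ 2 * v i) : ℝ) : ℂ) * Complex.I)
        * ∏ i, charFun (ρ i) (t * a i / Real.sqrt (∑ i, a i ^ 2 * v i))
        - Real.exp (-(t ^ 2 / 2))‖
      ≤ |t| * (δ / Real.sqrt vmin) + (16 * (1 + C + (1 + C) ^ 3) + (1 + C) ^ 2)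
        * ((|t| * (η / Real.sqrt vmin) + (|t| * (η / Real.sqrt vmin)) ^ 2) * (t ^ 2 / vmin)) := by
  set Q := ∑ i, a i ^ 2 with hQdef
  set V := ∑ i, a i ^ 2 * v i with hVdef
  set D := 16 * (1 + C + (1 + C) ^ 3) + (1 + C) ^ 2 with hD
  have hC1 : 0 ≤ 1 + C := by
    obtain ⟨i, -, hi⟩ := Finset.exists_ne_zero_of_sum_ne_zero hQ.ne'
    have hi' : a i ≠ 0 := fun h0 => hi (by simp [h0])
    have h1 : 0 ≤ ∫ x, x ^ 4 ∂(ρ i) := integral_nonneg fun x => by positivity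
    linarith [(hρ i hi').2.1]
  have hD0 : 0 ≤ D := by
    rw [hD]
    positivity
  -- Bounds relative to `√Q` thereby become bounds relative to the studentizing factor `√V`.
  have hVQ : vmin * Q ≤ V := by
    rw [hQdef, hVdef, Finset.mul_sum]
    refine Finset.sum_le_sum fun i _ => ?_
    by_cases hi : a i = 0
    · simp [hi]
    · rw [mul_comm]
      exact mul_le_mul_of_nonneg_left (hv i hi) (sq_nonneg _)
  have hV : 0 < V := (mul_pos hvmin hQ).trans_le hVQ
  have hsV : 0 < Real.sqrt V := Real.sqrt_pos.mpr hV
  have hsv : 0 < Real.sqrt vmin := Real.sqrt_pos.mpr hvmin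
  have hsqrt : Real.sqrt vmin * Real.sqrt Q ≤ Real.sqrt V := by
    rw [← Real.sqrt_mul hvmin.le]
    exact Real.sqrt_le_sqrt hVQ
  have hratio : ∀ {x e : ℝ}, 0 ≤ e → |x| ≤ e * Real.sqrt Q →
      |x| / Real.sqrt V ≤ e / Real.sqrt vmin := by
    intro x e he hx
    rw [div_le_div_iff₀ hsV hsv]
    calc |x| * Real.sqrt vmin ≤ e * Real.sqrt Q * Real.sqrt vmin := by gcongr
      _ = e * (Real.sqrt vmin * Real.sqrt Q) := by ring
      _ ≤ e * Real.sqrt V := by gcongr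
  set L : Fin n → ℝ := fun i => t * a i / Real.sqrt V with hL
  set σ := |t| * (η / Real.sqrt vmin) with hσ
  have hσ0 : 0 ≤ σ := by positivity
  have hLσ : ∀ i, |L i| ≤ σ := by
    intro i
    rw [hL, abs_div, abs_mul, abs_of_pos hsV, mul_div_assoc]
    exact mul_le_mul_of_nonneg_left (hratio hη (ha i)) (abs_nonneg _)
  have hL2 : ∀ i, L i ^ 2 = t ^ 2 / V * a i ^ 2 := by
    intro i
    rw [hL, div_pow, Real.sq_sqrt hV.le]
    ring
  have hLsum : ∑ i, L i ^ 2 ≤ t ^ 2 / vmin := by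
    simp only [hL2, ← Finset.mul_sum]
    rw [div_mul_eq_mul_div, div_le_div_iff₀ hV hvmin, mul_assoc, mul_comm _ vmin]
    exact mul_le_mul_of_nonneg_left hVQ (sq_nonneg _)
  have hLv : ∑ i, L i ^ 2 * v i = t ^ 2 := by
    simp only [hL2, mul_assoc, ← Finset.mul_sum]
    rw [← hVdef]
    field_simp
  -- `ψ` collects the centred conditional factors and `γ` their Gaussian counterparts, whose product
  -- is `exp (-t² / 2)` because `∑ L i ^ 2 * v i = t ^ 2`. Where `a i = 0` both equal `1`, so
  -- moments matter only where the weight is nonzero.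
  set ψ : Fin n → ℂ := fun i =>
    Complex.exp (-((L i * m i : ℝ) : ℂ) * Complex.I) * charFun (ρ i) (L i) with hψ
  set γ : Fin n → ℂ := fun i => (Real.exp (-(L i ^ 2 * v i / 2)) : ℂ) with hγ
  have hψ1 : ∀ i, ‖ψ i‖ ≤ 1 := by
    intro i
    rw [hψ, norm_mul, ← Complex.ofReal_neg, Complex.norm_exp_ofReal_mul_I, one_mul]
    exact norm_charFun_le_one _
  have hγ1 : ∀ i, ‖γ i‖ ≤ 1 := by
    intro i
    have h0 : 0 ≤ L i ^ 2 * v i := by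
      by_cases hi : a i = 0
      · simp [hL, hi]
      · exact mul_nonneg (sq_nonneg _) (hvmin.le.trans (hv i hi))
    rw [hγ, Complex.norm_real, Real.norm_eq_abs, Real.abs_exp]
    exact Real.exp_le_one_iff.mpr (by linarith)
  have hdiff : ∀ i, ‖ψ i - γ i‖ ≤ D * ((σ + σ ^ 2) * L i ^ 2) := by
    intro i
    by_cases hi : a i = 0
    · simp [hψ, hγ, hL, hi]
    · obtain ⟨h1, h2, h3, h4⟩ := hρ i hi
      refine (norm_charFun_sub_exp_le (ρ i) h1 h2 h3 h4 (L i)).trans ?_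
      refine mul_le_mul_of_nonneg_left ?_ hD0
      have h5 : |L i| ^ 3 = |L i| * L i ^ 2 := by rw [← sq_abs (L i)]; ring
      have h6 : L i ^ 4 = |L i| ^ 2 * L i ^ 2 := by rw [sq_abs]; ring
      rw [h5, h6, ← add_mul]
      have := hLσ i
      gcongr
  have hprod : ‖∏ i, ψ i - (Real.exp (-(t ^ 2 / 2)) : ℂ)‖
      ≤ D * ((σ + σ ^ 2) * (t ^ 2 / vmin)) := by
    have h1 : (Real.exp (-(t ^ 2 / 2)) : ℂ) = ∏ i, γ i := by
      rw [hγ, ← Complex.ofReal_prod, ← Real.exp_sum, Finset.sum_neg_distrib, ← Finset.sum_div, hLv]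
    rw [h1]
    calc ‖∏ i, ψ i - ∏ i, γ i‖ ≤ ∑ i, ‖ψ i - γ i‖ :=
          norm_prod_sub_prod_le _ _ _ (fun i _ => hψ1 i) fun i _ => hγ1 i
      _ ≤ ∑ i, D * ((σ + σ ^ 2) * L i ^ 2) := Finset.sum_le_sum fun i _ => hdiff i
      _ = D * ((σ + σ ^ 2) * ∑ i, L i ^ 2) := by rw [Finset.mul_sum, Finset.mul_sum]
      _ ≤ _ := by gcongr
  -- The conditional bias enters only through the phase `exp (i y)`.
  set y : ℝ := t * (∑ i, a i * m i - τ) / Real.sqrt V with hy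
  have hsplit : Complex.exp (-((t * τ / Real.sqrt V : ℝ) : ℂ) * Complex.I)
        * ∏ i, charFun (ρ i) (t * a i / Real.sqrt V)
      = Complex.exp (Complex.I * (y : ℂ)) * ∏ i, ψ i := by
    rw [hψ, Finset.prod_mul_distrib, ← Complex.exp_sum, ← mul_assoc, ← Complex.exp_add]
    congr 2
    rw [← Finset.sum_mul, Finset.sum_neg_distrib, ← Complex.ofReal_sum]
    have h1 : ∑ i, L i * m i = t * (∑ i, a i * m i) / Real.sqrt V := by
      rw [hL, Finset.mul_sum, Finset.sum_div]
      exact Finset.sum_congr rfl fun i _ => by ring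
    have h2 : y = ∑ i, L i * m i - t * τ / Real.sqrt V := by
      rw [h1, hy]
      ring
    rw [h2]
    push_cast
    ring
  have hy_le : |y| ≤ |t| * (δ / Real.sqrt vmin) := by
    rw [hy, abs_div, abs_mul, abs_of_pos hsV, mul_div_assoc]
    exact mul_le_mul_of_nonneg_left (hratio hδ hbias) (abs_nonneg _)
  rw [hsplit]
  have h1 : Complex.exp (Complex.I * (y : ℂ)) * ∏ i, ψ i - (Real.exp (-(t ^ 2 / 2)) : ℂ)
      = (Complex.exp (Complex.I * (y : ℂ)) - 1) * ∏ i, ψ i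
        + (∏ i, ψ i - (Real.exp (-(t ^ 2 / 2)) : ℂ)) := by ring
  rw [h1]
  refine (norm_add_le _ _).trans (add_le_add ?_ hprod)
  rw [norm_mul]
  have h2 : ‖∏ i, ψ i‖ ≤ 1 := by
    rw [norm_prod]
    exact Finset.prod_le_one (fun i _ => norm_nonneg _) fun i _ => hψ1 i
  refine (mul_le_of_le_one_right (norm_nonneg _) h2).trans ?_
  exact (Real.norm_exp_I_mul_ofReal_sub_one_le).trans hy_le

/-- A bounded function that is close to a constant outside a set of small measure. -/
theorem norm_integral_sub_le_add {α : Type*} [MeasurableSpace α] (μ : Measure α)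
    [IsProbabilityMeasure μ] (F : α → ℂ) (hF : Integrable F μ) (g : ℂ) (G : Set α) {ε B : ℝ}
    (hε : 0 ≤ ε) (h1 : ∀ᵐ x ∂μ, x ∈ G → ‖F x - g‖ ≤ ε)
    (h2 : ∀ x, ‖F x - g‖ ≤ B) : ‖∫ x, F x ∂μ - g‖ ≤ ε + B * (μ Gᶜ).toReal := by
  -- `G` need not be measurable; the measurable hull of its complement has the same measure.
  set S := toMeasurable μ Gᶜ with hS
  have hSm : MeasurableSet S := measurableSet_toMeasurable _ _
  have h3 : ∫ x, F x ∂μ - g = ∫ x, (F x - g) ∂μ := by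
    rw [integral_sub hF (integrable_const g)]
    simp
  have h4 : Integrable (fun x => ε + S.indicator (fun _ => B) x) μ :=
    (integrable_const ε).add ((integrable_const B).indicator hSm)
  rw [h3]
  calc ‖∫ x, (F x - g) ∂μ‖ ≤ ∫ x, (ε + S.indicator (fun _ => B) x) ∂μ := by
        refine norm_integral_le_of_norm_le h4 ?_
        filter_upwards [h1] with x hx
        by_cases hxS : x ∈ S
        · rw [Set.indicator_of_mem hxS]
          linarith [h2 x]
        · rw [Set.indicator_of_notMem hxS, add_zero]
          refine hx (by_contra fun hxG => hxS (subset_toMeasurable μ _ hxG))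
    _ = ε + B * (μ Gᶜ).toReal := by
        rw [integral_add (integrable_const ε) ((integrable_const B).indicator hSm),
          integral_indicator_const _ hSm, Measure.real, hS, measure_toMeasurable]
        simp [mul_comm]

/-- Central limit theorem for statistics that are linear in the outcomes, with weights that depend on
the running variables. -/
theorem tendsto_charFun_studentized {Ω : Type*} [MeasurableSpace Ω] (P : Measure Ω)
    [IsProbabilityMeasure P] (Z X : ℕ → Ω → ℝ) (hZ : ∀ i, Measurable (Z i))
    (hX : ∀ i, Measurable (X i)) (hind : iIndepFun (fun i ω => (Z i ω, X i ω)) P)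
    (hid : ∀ i, P.map (fun ω => (Z i ω, X i ω)) = P.map (fun ω => (Z 0 ω, X 0 ω)))
    (U : Set ℝ) (m v : ℝ → ℝ) {C vmin : ℝ} (hvmin : 0 < vmin) (hv : ∀ z ∈ U, vmin ≤ v z)
    (hρ : ∀ᵐ z ∂(P.map (Z 0)), z ∈ U →
      Integrable (fun x : ℝ => x ^ 4) (condDistrib (X 0) (Z 0) P z) ∧
      ∫ x, x ^ 4 ∂(condDistrib (X 0) (Z 0) P z) ≤ C ∧
      ∫ x, x ∂(condDistrib (X 0) (Z 0) P z) = m z ∧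
      variance (fun x => x) (condDistrib (X 0) (Z 0) P z) = v z)
    (a : ∀ n : ℕ, (Fin n → ℝ) → Fin n → ℝ) (ha : ∀ n i, Measurable fun z => a n z i)
    (haU : ∀ n z i, a n z i ≠ 0 → z i ∈ U) (V : ∀ n : ℕ, (Fin n → ℝ) → ℝ)
    (hV : ∀ n, Measurable (V n)) (hVeq : ∀ n z, V n z = ∑ i, a n z i ^ 2 * v (z i)) (τ : ℝ)
    (G : ∀ n : ℕ, Set (Fin n → ℝ)) (hGm : ∀ n, MeasurableSet (G n))
    (hG : Tendsto (fun n => (P {ω | (fun i : Fin n => Z i ω) ∉ G n}).toReal) atTop (𝓝 0))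
    (η δ : ℕ → ℝ) (hη0 : ∀ n, 0 ≤ η n) (hδ0 : ∀ n, 0 ≤ δ n) (hη : Tendsto η atTop (𝓝 0))
    (hδ : Tendsto δ atTop (𝓝 0))
    (hQ : ∀ n, ∀ z ∈ G n, 0 < ∑ i, a n z i ^ 2)
    (hmax : ∀ n, ∀ z ∈ G n, ∀ i, |a n z i| ≤ η n * Real.sqrt (∑ i, a n z i ^ 2))
    (hbias : ∀ n, ∀ z ∈ G n,
      |∑ i, a n z i * m (z i) - τ| ≤ δ n * Real.sqrt (∑ i, a n z i ^ 2)) (t : ℝ) :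
    Tendsto (fun n => charFun (P.map fun ω =>
        (∑ i : Fin n, a n (fun j => Z j ω) i * X i ω - τ) / Real.sqrt (V n fun j => Z j ω)) t)
      atTop (𝓝 (Real.exp (-(t ^ 2 / 2)) : ℂ)) := by
  set μ := P.map (Z 0) with hμ
  have : IsProbabilityMeasure μ := Measure.isProbabilityMeasure_map (hZ 0).aemeasurable
  set k := condDistrib (X 0) (Z 0) P with hk
  have hlaw : ∀ n : ℕ, P.map (fun ω (i : Fin n) => (Z i ω, X i ω))
      = Measure.pi fun _ : Fin n => μ ⊗ₘ k := by
    intro n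
    have h1 : iIndepFun (fun (i : Fin n) ω => (Z i ω, X i ω)) P :=
      hind.precomp (g := fun i : Fin n => (i : ℕ)) Fin.val_injective
    rw [(iIndepFun_iff_map_fun_eq_pi_map (f := fun (i : Fin n) ω => (Z i ω, X i ω)) fun i =>
      ((hZ i).prodMk (hX i)).aemeasurable).mp h1]
    congr 1
    ext i : 1
    rw [hid, hμ, hk, compProd_map_condDistrib (hX 0).aemeasurable]
  have hlawZ : ∀ n : ℕ, P.map (fun ω (i : Fin n) => Z i ω) = Measure.pi fun _ : Fin n => μ := by
    intro n
    have h1 : iIndepFun (fun (i : Fin n) ω => Z i ω) P :=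
      (hind.precomp (g := fun i : Fin n => (i : ℕ)) Fin.val_injective).comp
        (fun _ => Prod.fst) fun _ => measurable_fst
    rw [(iIndepFun_iff_map_fun_eq_pi_map (f := fun (i : Fin n) ω => Z i ω) fun i =>
      (hZ i).aemeasurable).mp h1]
    congr 1
    ext i : 1
    have h2 : ∀ j, P.map (Z j) = (P.map fun ω => (Z j ω, X j ω)).map Prod.fst := fun j => by
      rw [Measure.map_map measurable_fst ((hZ j).prodMk (hX j))]
      rfl
    rw [h2, hid, ← h2]
  -- `F n z` is the conditional characteristic function of the statistic at `t`, given the running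
  -- variables `z`.
  set F : ∀ n : ℕ, (Fin n → ℝ) → ℂ := fun n z =>
    Complex.exp (-((t * τ / Real.sqrt (V n z) : ℝ) : ℂ) * Complex.I)
      * ∏ i, charFun (k (z i)) (t * a n z i / Real.sqrt (V n z)) with hF
  have hL : ∀ n i, Measurable fun z => t * a n z i / Real.sqrt (V n z) := fun n i =>
    ((ha n i).const_mul t).div (hV n).sqrt
  have hc : ∀ n, Measurable fun z => t * τ / Real.sqrt (V n z) := fun n =>
    measurable_const.div (hV n).sqrt
  have hTmeas : ∀ n : ℕ, Measurable fun w : Fin n → ℝ × ℝ =>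
      (∑ i : Fin n, a n (fun j => (w j).1) i * (w i).2 - τ)
        / Real.sqrt (V n fun j => (w j).1) := by
    intro n
    have h1 : ∀ i, Measurable fun w : Fin n → ℝ × ℝ => a n (fun j => (w j).1) i := fun i =>
      (ha n i).comp (by fun_prop)
    have h2 : Measurable fun w : Fin n → ℝ × ℝ => V n (fun j => (w j).1) :=
      (hV n).comp (by fun_prop)
    fun_prop
  have hdata : ∀ n : ℕ, Measurable fun ω (i : Fin n) => (Z i ω, X i ω) := fun n =>
    measurable_pi_lambda _ fun i => (hZ i).prodMk (hX i)
  have hchar : ∀ n, charFun (P.map fun ω =>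
        (∑ i : Fin n, a n (fun j => Z j ω) i * X i ω - τ) / Real.sqrt (V n fun j => Z j ω)) t
      = ∫ z, F n z ∂(Measure.pi fun _ : Fin n => μ) := by
    intro n
    have h1 : P.map (fun ω => (∑ i : Fin n, a n (fun j => Z j ω) i * X i ω - τ)
          / Real.sqrt (V n fun j => Z j ω))
        = (Measure.pi fun _ : Fin n => μ ⊗ₘ k).map fun w =>
          (∑ i : Fin n, a n (fun j => (w j).1) i * (w i).2 - τ)
            / Real.sqrt (V n fun j => (w j).1) := by
      rw [← hlaw, Measure.map_map (hTmeas n) (hdata n)]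
      rfl
    rw [h1, charFun_apply_real, integral_map (hTmeas n).aemeasurable
      (Continuous.aestronglyMeasurable (by fun_prop)), hF]
    rw [← integral_exp_weighted_sum μ k (fun z i => t * a n z i / Real.sqrt (V n z)) (hL n)
      (fun z => t * τ / Real.sqrt (V n z)) (hc n)]
    refine integral_congr_ae (ae_of_all _ fun w => ?_)
    simp only
    congr 2
    rw [← Complex.ofReal_mul]
    congr 1
    rw [mul_div_assoc', mul_sub, sub_div, Finset.mul_sum, Finset.sum_div]
    congr 1
    exact Finset.sum_congr rfl fun i _ => by ring
  have hF1 : ∀ n z, ‖F n z‖ ≤ 1 := by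
    intro n z
    rw [hF, norm_mul, ← Complex.ofReal_neg, Complex.norm_exp_ofReal_mul_I, one_mul, norm_prod]
    exact Finset.prod_le_one (fun i _ => norm_nonneg _) fun i _ => norm_charFun_le_one _
  have hFint : ∀ n, Integrable (F n) (Measure.pi fun _ : Fin n => μ) := by
    intro n
    refine Integrable.of_bound (Measurable.aestronglyMeasurable ?_) 1 (ae_of_all _ (hF1 n))
    have h1 : ∀ i, Measurable fun z : Fin n → ℝ =>
        charFun (k (z i)) (t * a n z i / Real.sqrt (V n z)) := by
      intro i
      -- Joint measurability in the conditioning point and the argument, as the integral of a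
      -- jointly measurable function against a kernel.
      have h2 : StronglyMeasurable fun w : ℝ × ℝ => charFun (k w.1) w.2 := by
        simp only [charFun_apply_real]
        have h3 : StronglyMeasurable fun w : (ℝ × ℝ) × ℝ =>
            Complex.exp ((w.1.2 : ℂ) * (w.2 : ℂ) * Complex.I) :=
          Measurable.stronglyMeasurable (by fun_prop)
        exact StronglyMeasurable.integral_kernel_prod_right' (κ := k.comap Prod.fst measurable_fst)
          (f := fun w : (ℝ × ℝ) × ℝ => Complex.exp ((w.1.2 : ℂ) * (w.2 : ℂ) * Complex.I)) h3
      exact h2.measurable.comp ((measurable_pi_apply i).prodMk (hL n i))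
    have h2 := hc n
    rw [hF]
    refine Measurable.mul (by fun_prop) (Finset.measurable_fun_prod _ fun i _ => h1 i)
  set D := 16 * (1 + C + (1 + C) ^ 3) + (1 + C) ^ 2 with hD
  set ε : ℕ → ℝ := fun n => |t| * (δ n / Real.sqrt vmin) + D
        * ((|t| * (η n / Real.sqrt vmin) + (|t| * (η n / Real.sqrt vmin)) ^ 2) * (t ^ 2 / vmin))
    with hε
  have hεlim : Tendsto ε atTop (𝓝 0) := by
    have h1 : Tendsto (fun n => |t| * (η n / Real.sqrt vmin)) atTop (𝓝 0) := by
      simpa using (hη.div_const (Real.sqrt vmin)).const_mul |t|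
    have h2 : Tendsto (fun n => |t| * (δ n / Real.sqrt vmin)) atTop (𝓝 0) := by
      simpa using (hδ.div_const (Real.sqrt vmin)).const_mul |t|
    simpa using h2.add (((h1.add (h1.pow 2)).mul_const (t ^ 2 / vmin)).const_mul D)
  have hgood : ∀ n, ∀ᵐ z ∂(Measure.pi fun _ : Fin n => μ), z ∈ G n →
      ‖F n z - (Real.exp (-(t ^ 2 / 2)) : ℂ)‖ ≤ |ε n| := by
    intro n
    have h1 : ∀ᵐ z ∂(Measure.pi fun _ : Fin n => μ), ∀ i : Fin n, z i ∈ U →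
        Integrable (fun x : ℝ => x ^ 4) (k (z i)) ∧ ∫ x, x ^ 4 ∂(k (z i)) ≤ C ∧
        ∫ x, x ∂(k (z i)) = m (z i) ∧ variance (fun x => x) (k (z i)) = v (z i) := by
      rw [ae_all_iff]
      intro i
      exact (Measure.quasiMeasurePreserving_eval (fun _ : Fin n => μ) i).ae hρ
    filter_upwards [h1] with z hz hzG
    -- The sign of `ε n` is not known, because nothing is assumed about `C`; hence the absolute
    -- value.
    refine le_trans ?_ (le_abs_self _)
    have h2 := norm_exp_mul_prod_charFun_sub_le (C := C) hvmin (hη0 n) (hδ0 n) (a n z)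
      (fun i => m (z i)) (fun i => v (z i)) (fun i => k (z i)) (hQ n z hzG)
      (fun i hi => hv _ (haU n z i hi)) (fun i hi => hz i (haU n z i hi)) (hmax n z hzG)
      (hbias n z hzG) t
    rw [← hVeq n z] at h2
    exact h2
  have hg1 : ‖(Real.exp (-(t ^ 2 / 2)) : ℂ)‖ ≤ 1 := by
    rw [Complex.norm_real, Real.norm_eq_abs, Real.abs_exp]
    exact Real.exp_le_one_iff.mpr (by nlinarith [sq_nonneg t])
  have hbad : ∀ n, (Measure.pi fun _ : Fin n => μ) (G n)ᶜ
      = P {ω | (fun i : Fin n => Z i ω) ∉ G n} := by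
    intro n
    rw [← hlawZ, Measure.map_apply (measurable_pi_lambda (fun ω (i : Fin n) => Z i ω)
      fun i => hZ i) (hGm n).compl]
    rfl
  rw [tendsto_iff_norm_sub_tendsto_zero]
  have hlim : Tendsto (fun n => |ε n| + 2 * (P {ω | (fun i : Fin n => Z i ω) ∉ G n}).toReal)
      atTop (𝓝 0) := by
    simpa using hεlim.abs.add (hG.const_mul 2)
  refine squeeze_zero (fun n => norm_nonneg _) (fun n => ?_) hlim
  rw [hchar, ← hbad]
  refine norm_integral_sub_le_add _ (F n) (hFint n) _ (G n) (abs_nonneg _) (hgood n) fun z => ?_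
  exact (norm_sub_le _ _).trans (by linarith [hF1 n z])

/-! ### Consequences of the regularity conditions -/

/-- The conditional laws of two variables that agree whenever `Z ∈ A` agree at almost every point
of `A`. -/
theorem condDistrib_ae_eq_of_eqOn {Ω : Type*} [MeasurableSpace Ω] (P : Measure Ω)
    [IsProbabilityMeasure P] {Z X X' : Ω → ℝ} (hZ : Measurable Z) (hX : Measurable X)
    (hX' : Measurable X') {A : Set ℝ} (hA : MeasurableSet A)
    (h : ∀ ω, Z ω ∈ A → X ω = X' ω) :
    ∀ᵐ z ∂(P.map Z), z ∈ A → condDistrib X Z P z = condDistrib X' Z P z := by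
  have : IsProbabilityMeasure (P.map Z) := Measure.isProbabilityMeasure_map hZ.aemeasurable
  have hval : ∀ W : Ω → ℝ, Measurable W → ∀ S T : Set ℝ, MeasurableSet S → MeasurableSet T →
      (((P.map Z).restrict A) ⊗ₘ condDistrib W Z P) (S ×ˢ T)
        = P (Z ⁻¹' (S ∩ A) ∩ W ⁻¹' T) := by
    intro W hW S T hS hT
    rw [Measure.compProd_apply_prod hS hT, Measure.restrict_restrict hS,
      ← Measure.compProd_apply_prod (hS.inter hA) hT, compProd_map_condDistrib hW.aemeasurable,
      Measure.map_apply (hZ.prodMk hW) ((hS.inter hA).prod hT)]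
    rfl
  -- The joint laws restricted to `A` agree on rectangles, and disintegrations are almost everywhere
  -- unique.
  have heq : ((P.map Z).restrict A) ⊗ₘ condDistrib X Z P
      = ((P.map Z).restrict A) ⊗ₘ condDistrib X' Z P := by
    refine Measure.ext_prod fun {S T} hS hT => ?_
    rw [hval X hX S T hS hT, hval X' hX' S T hS hT]
    congr 1
    ext ω
    simp only [Set.mem_inter_iff, Set.mem_preimage]
    constructor
    · rintro ⟨⟨h1, h2⟩, h3⟩
      exact ⟨⟨h1, h2⟩, h ω h2 ▸ h3⟩
    · rintro ⟨⟨h1, h2⟩, h3⟩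
      exact ⟨⟨h1, h2⟩, (h ω h2).symm ▸ h3⟩
  exact (ae_restrict_iff' hA).mp (Kernel.ae_eq_of_compProd_eq heq)

theorem measurable_datum_fst {Ω : Type*} [MeasurableSpace Ω] {Z : ℕ → Ω → ℝ}
    {Y : ℕ → Fin 2 → Fin 2 → Fin 2 → Ω → ℝ} {i : ℕ} (h : Measurable (datum Z Y i)) :
    Measurable (Z i) := h.fst

theorem measurable_datum_snd {Ω : Type*} [MeasurableSpace Ω] {Z : ℕ → Ω → ℝ}
    {Y : ℕ → Fin 2 → Fin 2 → Fin 2 → Ω → ℝ} {i : ℕ} (h : Measurable (datum Z Y i))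
    (t d₀ d₁ : Fin 2) : Measurable (Y i t d₀ d₁) :=
  (measurable_pi_apply d₁).comp ((measurable_pi_apply d₀).comp ((measurable_pi_apply t).comp h.snd))

/-- The observed running variable and change, as a function of the datum. -/
def observedPair (w : ℝ × (Fin 2 → Fin 2 → Fin 2 → ℝ)) : ℝ × ℝ :=
  (w.1, if 0 ≤ w.1 then w.2 1 1 1 - w.2 0 1 0 else w.2 1 0 0 - w.2 0 0 0)

theorem measurable_observedPair : Measurable observedPair := by
  refine measurable_fst.prodMk (Measurable.ite (measurableSet_le measurable_const measurable_fst)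
    ?_ ?_) <;> fun_prop

theorem observedPair_datum {Ω : Type*} (Z : ℕ → Ω → ℝ) (Y : ℕ → Fin 2 → Fin 2 → Fin 2 → Ω → ℝ)
    (i : ℕ) (ω : Ω) : observedPair (datum Z Y i ω) = (Z i ω, deltaY Z Y i ω) := by
  rw [deltaY_eq]
  rfl

/-- On the neighbourhood of the cutoff, the conditional law of the observed change has the conditional
moments of the regularity conditions. -/
theorem exists_ae_condDistrib_moments {Ω : Type*} [MeasurableSpace Ω] (P : Measure Ω)
    [IsProbabilityMeasure P] {Z X X₀ X₁ : Ω → ℝ} (hZ : Measurable Z) (hX : Measurable X)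
    (hX₀ : Measurable X₀) (hX₁ : Measurable X₁) (h₀ : ∀ ω, Z ω < 0 → X ω = X₀ ω)
    (h₁ : ∀ ω, 0 ≤ Z ω → X ω = X₁ ω) {κ₀ : ℝ} {S : ℕ} {μm μp sm sp : ℝ → ℝ}
    (hd : IsSmoothDesign P Z X X₀ X₁ κ₀ S μm μp sm sp) :
    ∃ C : ℝ, ∀ᵐ z ∂(P.map Z), z ∈ Set.Ioo (-κ₀) κ₀ →
      Integrable (fun x : ℝ => x ^ 4) (condDistrib X Z P z) ∧
      ∫ x, x ^ 4 ∂(condDistrib X Z P z) ≤ C ∧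
      ∫ x, x ∂(condDistrib X Z P z) = glue μm μp z ∧
      variance (fun x => x) (condDistrib X Z P z) = glue sm sp z := by
  obtain ⟨C, hC⟩ := hd.fourthMoment
  refine ⟨C, ?_⟩
  filter_upwards [(ae_restrict_iff' measurableSet_Ioo).mp hC,
    (ae_restrict_iff' measurableSet_Ioo).mp hd.mean_control,
    (ae_restrict_iff' measurableSet_Ioo).mp hd.mean_treated,
    (ae_restrict_iff' measurableSet_Ioo).mp hd.var_control,
    (ae_restrict_iff' measurableSet_Ioo).mp hd.var_treated,
    condDistrib_ae_eq_of_eqOn P hZ hX hX₀ measurableSet_Iio h₀,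
    condDistrib_ae_eq_of_eqOn P hZ hX hX₁ measurableSet_Ici h₁] with z h4 hm0 hm1 hv0 hv1 he0 he1 hz
  refine ⟨(h4 hz).1, (h4 hz).2, ?_⟩
  rcases le_or_gt 0 z with h | h
  · rw [glue, glue, if_pos h, if_pos h, he1 h]
    exact ⟨(hm1 hz).2, (hv1 hz).2⟩
  · rw [glue, glue, if_neg (not_le.mpr h), if_neg (not_le.mpr h), he0 h]
    exact ⟨(hm0 hz).2, (hv0 hz).2⟩

theorem exists_pos_le_glue {U : Set ℝ} {sm sp : ℝ → ℝ}
    (hm : ∃ c : ℝ, 0 < c ∧ ∀ z ∈ U, c ≤ sm z) (hp : ∃ c : ℝ, 0 < c ∧ ∀ z ∈ U, c ≤ sp z) :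
    ∃ c : ℝ, 0 < c ∧ ∀ z ∈ U, c ≤ glue sm sp z := by
  obtain ⟨c, hc, h1⟩ := hm
  obtain ⟨d, hd, h2⟩ := hp
  refine ⟨min c d, lt_min hc hd, fun z hz => ?_⟩
  rw [glue]
  split_ifs
  · exact (min_le_right _ _).trans (h2 z hz)
  · exact (min_le_left _ _).trans (h1 z hz)

/-- Supplies a bound for the regression function on the whole neighbourhood, which smoothness on an
open interval does not give near its ends. -/
theorem abs_integral_le_of_fourth_moment {C : ℝ} (ρ : Measure ℝ) [IsProbabilityMeasure ρ]
    (h4 : Integrable (fun x : ℝ => x ^ 4) ρ) (h4C : ∫ x, x ^ 4 ∂ρ ≤ C) :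
    |∫ x, x ∂ρ| ≤ 1 + C := by
  calc |∫ x, x ∂ρ| ≤ ∫ x, (1 + x ^ 4) ∂ρ := by
        rw [← Real.norm_eq_abs]
        refine norm_integral_le_of_norm_le ((integrable_const _).add h4) (ae_of_all _ fun x => ?_)
        rw [Real.norm_eq_abs]
        nlinarith [sq_nonneg (x ^ 2 - 1), sq_nonneg (|x| - 1), sq_abs x, sq_nonneg x]
    _ = 1 + ∫ x, x ^ 4 ∂ρ := by
        rw [integral_add (integrable_const _) h4]
        simp
    _ ≤ 1 + C := by linarith

/-- A continuous function that is bounded almost everywhere on an open set on which the density is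
bounded away from zero is bounded there. -/
theorem abs_le_of_ae_of_density {Ω : Type*} [MeasurableSpace Ω] {P : Measure Ω} {Z : Ω → ℝ}
    {U V : Set ℝ} (hVU : V ⊆ U) (hV : IsOpen V)
    (hd : HasRegularDensityOn P Z U) {f : ℝ → ℝ} (hf : ContinuousOn f V) {B : ℝ}
    (hB : ∀ᵐ z ∂((P.map Z).restrict U), z ∈ V → |f z| ≤ B) (z : ℝ) (hz : z ∈ V) : |f z| ≤ B := by
  obtain ⟨g, hgc, ⟨c, hc, hcg⟩, hgd⟩ := hd
  -- The set where the bound fails is open. It is null for the law of `Z`, hence Lebesgue null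
  -- because the density is at least `c`, hence empty.
  set W := V ∩ (fun z => |f z|) ⁻¹' Set.Ioi B with hW
  have hWopen : IsOpen W := (continuous_abs.comp_continuousOn hf).isOpen_inter_preimage hV isOpen_Ioi
  have hWU : W ⊆ U := Set.inter_subset_left.trans hVU
  have h1 : (P.map Z).restrict U W = 0 := by
    refine measure_mono_null ?_ hB
    intro x hx hx'
    exact absurd (hx' hx.1) (not_le.mpr hx.2)
  have h2 : ENNReal.ofReal c * volume W ≤ (P.map Z).restrict U W := by
    rw [hgd, withDensity_apply _ hWopen.measurableSet, Measure.restrict_restrict hWopen.measurableSet,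
      Set.inter_eq_left.mpr hWU, ← setLIntegral_const]
    refine setLIntegral_mono' hWopen.measurableSet fun x hx => ?_
    exact ENNReal.ofReal_le_ofReal (hcg x (hWU hx))
  have h3 : volume W = 0 := by
    rw [h1] at h2
    rcases mul_eq_zero.mp (le_antisymm h2 bot_le) with h | h
    · exact absurd (ENNReal.ofReal_eq_zero.mp h) (not_le.mpr hc)
    · exact h
  have h4 : W = ∅ := hWopen.measure_eq_zero_iff volume |>.mp h3
  by_contra h5
  have : z ∈ W := ⟨hz, not_le.mp h5⟩
  rw [h4] at this
  exact this

/-- Taylor expansion at the origin, with a bound on the whole interval on which the function is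
bounded. -/
theorem exists_taylor_bound {κ₀ : ℝ} (hκ₀ : 0 < κ₀) {f : ℝ → ℝ} {S : ℕ}
    (hf : ContDiffOn ℝ (S : WithTop ℕ∞) f (Set.Ioo (-κ₀) κ₀)) {B : ℝ}
    (hB : ∀ x ∈ Set.Ioo 0 κ₀, |f x| ≤ B) (d : ℕ) (hd : d + 1 ≤ S) :
    ∃ M : ℝ, 0 ≤ M ∧ ∀ x, 0 ≤ x → x < κ₀ →
      |f x - ∑ k ∈ Finset.range (d + 1), iteratedDeriv k f 0 / (k ! : ℝ) * x ^ k|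
        ≤ M * |x| ^ (d + 1) := by
  have hsub : Set.Icc 0 (κ₀ / 2) ⊆ Set.Ioo (-κ₀) κ₀ := fun x hx =>
    ⟨by linarith [hx.1], by linarith [hx.2]⟩
  have hfat : ContDiffAt ℝ (S : WithTop ℕ∞) f 0 :=
    hf.contDiffAt (Ioo_mem_nhds (by linarith) hκ₀)
  obtain ⟨M₁, hM₁⟩ := exists_taylor_mean_remainder_bound (f := f) (a := 0) (b := κ₀ / 2) (n := d)
    (by linarith) ((hf.mono hsub).of_le (by exact_mod_cast hd))
  have hT : ∀ x, taylorWithinEval f d (Set.Icc 0 (κ₀ / 2)) 0 x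
      = ∑ k ∈ Finset.range (d + 1), iteratedDeriv k f 0 / (k ! : ℝ) * x ^ k := by
    intro x
    rw [taylor_within_apply]
    refine Finset.sum_congr rfl fun k hk => ?_
    have hk' : k ≤ S := by
      have := Finset.mem_range.mp hk
      omega
    rw [iteratedDerivWithin_eq_iteratedDeriv (uniqueDiffOn_Icc (by linarith))
      (hfat.of_le (by exact_mod_cast hk')) (Set.left_mem_Icc.mpr (by linarith)), smul_eq_mul,
      sub_zero]
    ring
  set A : ℝ := ∑ k ∈ Finset.range (d + 1), |iteratedDeriv k f 0 / (k ! : ℝ)| * κ₀ ^ k with hA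
  have hA0 : 0 ≤ A := Finset.sum_nonneg fun k _ => by positivity
  refine ⟨|M₁| + (|B| + A) * ((κ₀ / 2) ^ (d + 1))⁻¹, by positivity, fun x hx0 hxκ => ?_⟩
  rw [abs_of_nonneg hx0]
  -- Taylor's theorem applies on the compact half. Beyond it `x ^ (d + 1)` is bounded below, so
  -- boundedness of `f` suffices. The full interval is needed because the larger bandwidth is not
  -- assumed to tend to zero.
  rcases le_or_gt x (κ₀ / 2) with hx | hx
  · have h1 := hM₁ x ⟨hx0, hx⟩
    rw [hT, sub_zero, Real.norm_eq_abs] at h1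
    refine h1.trans (mul_le_mul_of_nonneg_right ?_ (by positivity))
    have : 0 ≤ (|B| + A) * ((κ₀ / 2) ^ (d + 1))⁻¹ := by positivity
    linarith [le_abs_self M₁]
  · have h1 : |f x - ∑ k ∈ Finset.range (d + 1), iteratedDeriv k f 0 / (k ! : ℝ) * x ^ k|
        ≤ |B| + A := by
      refine (abs_sub _ _).trans (add_le_add ?_ ?_)
      · exact (hB x ⟨by linarith, hxκ⟩).trans (le_abs_self B)
      · refine (Finset.abs_sum_le_sum_abs _ _).trans (Finset.sum_le_sum fun k _ => ?_)
        rw [abs_mul, abs_pow, abs_of_nonneg hx0]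
        gcongr
    have h2 : 1 ≤ ((κ₀ / 2) ^ (d + 1))⁻¹ * x ^ (d + 1) := by
      rw [inv_mul_eq_div, one_le_div (by positivity)]
      gcongr
    calc |f x - ∑ k ∈ Finset.range (d + 1), iteratedDeriv k f 0 / (k ! : ℝ) * x ^ k|
        ≤ (|B| + A) * 1 := by rwa [mul_one]
      _ ≤ (|B| + A) * (((κ₀ / 2) ^ (d + 1))⁻¹ * x ^ (d + 1)) := by gcongr
      _ ≤ (|M₁| + (|B| + A) * ((κ₀ / 2) ^ (d + 1))⁻¹) * x ^ (d + 1) := by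
        have : 0 ≤ |M₁| * x ^ (d + 1) := by positivity
        linarith

theorem exists_taylor_bound_left {κ₀ : ℝ} (hκ₀ : 0 < κ₀) {f : ℝ → ℝ} {S : ℕ}
    (hf : ContDiffOn ℝ (S : WithTop ℕ∞) f (Set.Ioo (-κ₀) κ₀)) {B : ℝ}
    (hB : ∀ x ∈ Set.Ioo (-κ₀) 0, |f x| ≤ B) (d : ℕ) (hd : d + 1 ≤ S) :
    ∃ M : ℝ, 0 ≤ M ∧ ∀ x, x ≤ 0 → -κ₀ < x →
      |f x - ∑ k ∈ Finset.range (d + 1), iteratedDeriv k f 0 / (k ! : ℝ) * x ^ k|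
        ≤ M * |x| ^ (d + 1) := by
  have hg : ContDiffOn ℝ (S : WithTop ℕ∞) (fun x => f (-x)) (Set.Ioo (-κ₀) κ₀) :=
    hf.comp contDiff_neg.contDiffOn fun x hx => ⟨by linarith [hx.2], by linarith [hx.1]⟩
  obtain ⟨M, hM0, hM⟩ := exists_taylor_bound hκ₀ hg
    (fun x hx => hB (-x) ⟨by linarith [hx.2], by linarith [hx.1]⟩) d hd
  refine ⟨M, hM0, fun x hx0 hxκ => ?_⟩
  have h1 := hM (-x) (by linarith) (by linarith)
  rw [neg_neg, abs_neg] at h1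
  refine le_trans (le_of_eq ?_) h1
  congr 2
  refine Finset.sum_congr rfl fun k _ => ?_
  rw [iteratedDeriv_comp_neg, neg_zero, smul_eq_mul, neg_pow x k]
  have : ((-1 : ℝ) ^ k) * (-1) ^ k = 1 := by rw [← mul_pow]; simp
  linear_combination (-(iteratedDeriv k f 0 / (k ! : ℝ) * x ^ k)) * this

/-- The estimand is the difference of the derivatives of the two regression functions at the
cutoff. -/
theorem estimand_glue {κ₀ : ℝ} (hκ₀ : 0 < κ₀) {f g : ℝ → ℝ} {S : ℕ}
    (hf : ContDiffOn ℝ (S : WithTop ℕ∞) f (Set.Ioo (-κ₀) κ₀))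
    (hg : ContDiffOn ℝ (S : WithTop ℕ∞) g (Set.Ioo (-κ₀) κ₀)) {ν : ℕ} (hν : ν ≤ S) :
    estimand ν (glue f g) = iteratedDeriv ν g 0 - iteratedDeriv ν f 0 := by
  have hcont : ∀ {u : ℝ → ℝ}, ContDiffOn ℝ (S : WithTop ℕ∞) u (Set.Ioo (-κ₀) κ₀) →
      Tendsto (iteratedDeriv ν u) (𝓝 0) (𝓝 (iteratedDeriv ν u 0)) := by
    intro u hu
    have h1 : ContinuousOn (iteratedDeriv ν u) (Set.Ioo (-κ₀) κ₀) :=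
      (hu.continuousOn_iteratedDerivWithin (by exact_mod_cast hν)
        isOpen_Ioo.uniqueDiffOn).congr fun x hx =>
          (iteratedDerivWithin_of_isOpen isOpen_Ioo hx).symm
    exact h1.continuousAt (Ioo_mem_nhds (by linarith) hκ₀)
  have hright : Tendsto (iteratedDeriv ν (glue f g)) (𝓝[>] 0) (𝓝 (iteratedDeriv ν g 0)) := by
    refine ((hcont hg).mono_left nhdsWithin_le_nhds).congr' ?_
    filter_upwards [self_mem_nhdsWithin] with x hx
    refine (Filter.EventuallyEq.iteratedDeriv_eq ν ?_).symm
    filter_upwards [Ioi_mem_nhds hx] with y hy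
    rw [glue, if_pos (le_of_lt hy)]
  have hleft : Tendsto (iteratedDeriv ν (glue f g)) (𝓝[<] 0) (𝓝 (iteratedDeriv ν f 0)) := by
    refine ((hcont hf).mono_left nhdsWithin_le_nhds).congr' ?_
    filter_upwards [self_mem_nhdsWithin] with x hx
    refine (Filter.EventuallyEq.iteratedDeriv_eq ν ?_).symm
    filter_upwards [Iio_mem_nhds hx] with y hy
    rw [glue, if_neg (not_le.mpr hy)]
  rw [estimand, hright.limUnder_eq, hleft.limUnder_eq]

/-- Upper bound for the probability of shrinking windows around the cutoff. -/
theorem exists_measure_window_le {Ω : Type*} [MeasurableSpace Ω] (P : Measure Ω)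
    [IsProbabilityMeasure P] {Z : Ω → ℝ} (hZ : Measurable Z) {κ₀ κ : ℝ} (hκ₀ : 0 < κ₀)
    (hκ : 0 < κ) (hd : HasRegularDensityOn P Z (Set.Ioo (-κ₀) κ₀)) :
    ∃ C : ℝ, 0 < C ∧ ∀ h, 0 < h → P.real (Z ⁻¹' {x | |x| ≤ κ * h}) ≤ C * h := by
  have : IsProbabilityMeasure (P.map Z) := Measure.isProbabilityMeasure_map hZ.aemeasurable
  obtain ⟨g, hgc, -, hgd⟩ := hd
  have hsub : Set.Icc (-(κ₀ / 2)) (κ₀ / 2) ⊆ Set.Ioo (-κ₀) κ₀ := fun x hx =>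
    ⟨by linarith [hx.1], by linarith [hx.2]⟩
  obtain ⟨B, hB⟩ := isCompact_Icc.exists_bound_of_continuousOn (hgc.mono hsub)
  refine ⟨|B| * (2 * κ) + 2 * κ / κ₀, by positivity, fun h hh => ?_⟩
  have hset : {x : ℝ | |x| ≤ κ * h} = Set.Icc (-(κ * h)) (κ * h) := by
    ext x
    simp only [Set.mem_ofPred_eq, Set.mem_Icc, abs_le]
  rw [hset]
  -- The density is bounded on the compact half only; for wider windows `2 * κ / κ₀ * h ≥ 1` already
  -- exceeds any probability.
  rcases le_or_gt (κ * h) (κ₀ / 2) with hle | hgt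
  · have hsub2 : Set.Icc (-(κ * h)) (κ * h) ⊆ Set.Icc (-(κ₀ / 2)) (κ₀ / 2) :=
      Set.Icc_subset_Icc (by linarith) hle
    have h1 : P (Z ⁻¹' Set.Icc (-(κ * h)) (κ * h))
        = (P.map Z).restrict (Set.Ioo (-κ₀) κ₀) (Set.Icc (-(κ * h)) (κ * h)) := by
      rw [Measure.restrict_apply measurableSet_Icc, Set.inter_eq_left.mpr (hsub2.trans hsub),
        Measure.map_apply hZ measurableSet_Icc]
    have h2 : P (Z ⁻¹' Set.Icc (-(κ * h)) (κ * h))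
        ≤ ENNReal.ofReal |B| * ENNReal.ofReal (2 * (κ * h)) := by
      rw [h1, hgd, withDensity_apply _ measurableSet_Icc,
        Measure.restrict_restrict measurableSet_Icc, Set.inter_eq_left.mpr (hsub2.trans hsub)]
      calc ∫⁻ x in Set.Icc (-(κ * h)) (κ * h), ENNReal.ofReal (g x)
          ≤ ∫⁻ x in Set.Icc (-(κ * h)) (κ * h), ENNReal.ofReal |B| := by
            refine setLIntegral_mono' measurableSet_Icc fun x hx => ENNReal.ofReal_le_ofReal ?_
            exact (le_abs_self _).trans ((hB x (hsub2 hx)).trans (le_abs_self B))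
        _ = ENNReal.ofReal |B| * ENNReal.ofReal (2 * (κ * h)) := by
            rw [setLIntegral_const, Real.volume_Icc]
            congr 2
            ring
    rw [Measure.real]
    refine (ENNReal.toReal_mono (by finiteness) h2).trans ?_
    rw [ENNReal.toReal_mul, ENNReal.toReal_ofReal (abs_nonneg _),
      ENNReal.toReal_ofReal (by positivity)]
    have : 0 ≤ 2 * κ / κ₀ * h := by positivity
    linarith
  · refine measureReal_le_one.trans ?_
    have h1 : 1 ≤ 2 * κ / κ₀ * h := by
      rw [div_mul_eq_mul_div, one_le_div hκ₀]
      linarith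
    have h2 : 0 ≤ |B| * (2 * κ) * h := by positivity
    linarith

/-- Lower bound for the probability of shrinking intervals next to the cutoff. -/
theorem exists_le_measure_interval {Ω : Type*} [MeasurableSpace Ω] (P : Measure Ω)
    [IsProbabilityMeasure P] {Z : Ω → ℝ} (hZ : Measurable Z) {κ₀ : ℝ}
    (hd : HasRegularDensityOn P Z (Set.Ioo (-κ₀) κ₀)) :
    ∃ c : ℝ, 0 < c ∧ ∀ (s α β h : ℝ), (s = 1 ∨ s = -1) → 0 < h → 0 < α → α ≤ β → β * h < κ₀ →
      c * (β - α) * h ≤ P.real (Z ⁻¹' {x | s * (x / h) ∈ Set.Icc α β}) := by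
  have : IsProbabilityMeasure (P.map Z) := Measure.isProbabilityMeasure_map hZ.aemeasurable
  obtain ⟨g, -, ⟨c, hc, hcg⟩, hgd⟩ := hd
  refine ⟨c, hc, fun s α β h hs hh hα hαβ hβ => ?_⟩
  have key : ∀ l u : ℝ, l ≤ u → -κ₀ < l → u < κ₀ →
      c * (u - l) ≤ P.real (Z ⁻¹' Set.Icc l u) := by
    intro l u hlu hl hu
    have hsub : Set.Icc l u ⊆ Set.Ioo (-κ₀) κ₀ := fun x hx =>
      ⟨by linarith [hx.1], by linarith [hx.2]⟩
    have h1 : P (Z ⁻¹' Set.Icc l u)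
        = (P.map Z).restrict (Set.Ioo (-κ₀) κ₀) (Set.Icc l u) := by
      rw [Measure.restrict_apply measurableSet_Icc, Set.inter_eq_left.mpr hsub,
        Measure.map_apply hZ measurableSet_Icc]
    have h2 : ENNReal.ofReal c * ENNReal.ofReal (u - l) ≤ P (Z ⁻¹' Set.Icc l u) := by
      rw [h1, hgd, withDensity_apply _ measurableSet_Icc,
        Measure.restrict_restrict measurableSet_Icc, Set.inter_eq_left.mpr hsub,
        ← Real.volume_Icc, ← setLIntegral_const]
      exact setLIntegral_mono' measurableSet_Icc fun x hx => ENNReal.ofReal_le_ofReal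
        (hcg x (hsub hx))
    have h3 := ENNReal.toReal_mono (measure_ne_top _ _) h2
    rwa [ENNReal.toReal_mul, ENNReal.toReal_ofReal hc.le,
      ENNReal.toReal_ofReal (by linarith)] at h3
  have hαh : 0 < α * h := mul_pos hα hh
  have hαβh : α * h ≤ β * h := mul_le_mul_of_nonneg_right hαβ hh.le
  rcases hs with rfl | rfl
  · have hset : {x : ℝ | 1 * (x / h) ∈ Set.Icc α β} = Set.Icc (α * h) (β * h) := by
      ext x
      simp only [Set.mem_ofPred_eq, Set.mem_Icc, one_mul, le_div_iff₀ hh, div_le_iff₀ hh]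
    rw [hset]
    refine le_trans (le_of_eq ?_) (key (α * h) (β * h) hαβh (by linarith) hβ)
    ring
  · have hset : {x : ℝ | -1 * (x / h) ∈ Set.Icc α β} = Set.Icc (-(β * h)) (-(α * h)) := by
      ext x
      have : -1 * (x / h) = -x / h := by ring
      simp only [Set.mem_ofPred_eq, Set.mem_Icc, this, le_div_iff₀ hh, div_le_iff₀ hh]
      constructor <;> rintro ⟨h1, h2⟩ <;> constructor <;> linarith
    rw [hset]
    refine le_trans (le_of_eq ?_) (key (-(β * h)) (-(α * h)) (by linarith) (by linarith)
      (by linarith))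
    ring

/-! ### The good event -/

/-- The number of observations in `B`. -/
def obsCount {n : ℕ} (B : Set ℝ) (z : Fin n → ℝ) : ℝ := ∑ i, B.indicator (fun _ => (1 : ℝ)) (z i)

open scoped Classical in
theorem obsCount_eq_card {n : ℕ} (B : Set ℝ) (z : Fin n → ℝ) :
    obsCount B z = ((Finset.univ.filter fun i => z i ∈ B).card : ℝ) := by
  simp [obsCount, Set.indicator_apply]

theorem measurable_obsCount {n : ℕ} {B : Set ℝ} (hB : MeasurableSet B) :
    Measurable (obsCount (n := n) B) := by
  refine Finset.measurable_fun_sum _ fun i _ => ?_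
  exact (measurable_const.indicator hB).comp (measurable_pi_apply i)

/-- Chebyshev: the variance of the count is at most its mean, which is of order `n h`, so deviations
of order `n h` have probability of order `1 / (n h)`. -/
theorem tendsto_measure_obsCount {Ω : Type*} [MeasurableSpace Ω] (P : Measure Ω)
    [IsProbabilityMeasure P] (Z : ℕ → Ω → ℝ) (hZ : ∀ i, Measurable (Z i)) (hind : iIndepFun Z P)
    (hid : ∀ i, P.map (Z i) = P.map (Z 0)) (B : ℕ → Set ℝ) (hB : ∀ n, MeasurableSet (B n))
    (h : ℕ → ℝ) (hlim : Tendsto (fun n : ℕ => (n : ℝ) * h n) atTop atTop)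
    {C : ℝ} (hC : ∀ n, P.real (Z 0 ⁻¹' B n) ≤ C * h n) {η : ℝ} (hη : 0 < η) :
    Tendsto (fun n : ℕ => P.real {ω | η * (n * h n)
      ≤ |obsCount (B n) (fun i : Fin n => Z i ω) - n * P.real (Z 0 ⁻¹' B n)|}) atTop (𝓝 0) := by
  have hbound : ∀ᶠ n : ℕ in atTop, P.real {ω | η * (n * h n)
      ≤ |obsCount (B n) (fun i : Fin n => Z i ω) - n * P.real (Z 0 ⁻¹' B n)|}
      ≤ C / η ^ 2 * (n * h n)⁻¹ := by
    filter_upwards [hlim.eventually_gt_atTop 0] with n hn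
    set X : Fin n → Ω → ℝ := fun i ω => (B n).indicator (fun _ => (1 : ℝ)) (Z i ω) with hX
    have hXm : ∀ i, Measurable (X i) := fun i => (measurable_const.indicator (hB n)).comp (hZ i)
    have hXL : ∀ i, MemLp (X i) 2 P := by
      intro i
      refine MemLp.of_bound (hXm i).aestronglyMeasurable 1 (ae_of_all _ fun ω => ?_)
      rw [hX, Real.norm_eq_abs]
      by_cases hω : Z i ω ∈ B n <;> simp [hω]
    have hXint : ∀ i, ∫ ω, X i ω ∂P = P.real (Z 0 ⁻¹' B n) := by
      intro i
      have h1 : X i = (Z i ⁻¹' B n).indicator fun _ => (1 : ℝ) := rfl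
      rw [h1, integral_indicator_const _ (hZ i (hB n)), smul_eq_mul, mul_one, Measure.real,
        Measure.real, ← Measure.map_apply (hZ i) (hB n), hid, Measure.map_apply (hZ 0) (hB n)]
    have hsq : ∀ i, variance (X i) P ≤ P.real (Z 0 ⁻¹' B n) := by
      intro i
      refine (variance_le_expectation_sq (hXm i).aestronglyMeasurable).trans_eq ?_
      rw [← hXint i]
      refine integral_congr_ae (ae_of_all _ fun ω => ?_)
      by_cases hω : Z i ω ∈ B n <;> simp [hX, hω]
    have hsum : (fun ω => obsCount (B n) fun i : Fin n => Z i ω) = ∑ i, X i := by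
      ext ω
      rw [Finset.sum_apply]
      rfl
    have hmean : ∫ ω, (∑ i, X i) ω ∂P = n * P.real (Z 0 ⁻¹' B n) := by
      simp only [Finset.sum_apply]
      rw [integral_finsetSum _ fun i _ => (hXL i).integrable (by norm_num)]
      simp [hXint]
    have hvar : variance (∑ i, X i) P ≤ n * P.real (Z 0 ⁻¹' B n) := by
      rw [IndepFun.variance_sum (fun i _ => hXL i)]
      · refine (Finset.sum_le_sum fun i _ => hsq i).trans_eq ?_
        simp
      · intro i _ j _ hij
        have h1 : iIndepFun (fun i : Fin n => Z i) P :=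
          hind.precomp (g := fun i : Fin n => (i : ℕ)) Fin.val_injective
        exact (h1.indepFun hij).comp (measurable_const.indicator (hB n))
          (measurable_const.indicator (hB n))
    have hc : 0 < η * (n * h n) := mul_pos hη hn
    have hcheb := meas_ge_le_variance_div_sq (memLp_finsetSum' Finset.univ fun i _ => hXL i) hc
    rw [hmean] at hcheb
    have hset : {ω | η * (n * h n)
        ≤ |obsCount (B n) (fun i : Fin n => Z i ω) - n * P.real (Z 0 ⁻¹' B n)|}
        = {ω | η * (n * h n) ≤ |(∑ i, X i) ω - n * P.real (Z 0 ⁻¹' B n)|} := by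
      rw [← hsum]
    rw [hset, Measure.real]
    refine (ENNReal.toReal_mono ENNReal.ofReal_ne_top hcheb).trans ?_
    rw [ENNReal.toReal_ofReal (by have := variance_nonneg (∑ i, X i) P; positivity),
      div_le_iff₀ (by positivity)]
    have hnh : (n : ℝ) * h n ≠ 0 := hn.ne'
    calc variance (∑ i, X i) P ≤ n * P.real (Z 0 ⁻¹' B n) := hvar
      _ ≤ n * (C * h n) := by
        gcongr
        exact hC n
      _ = C / η ^ 2 * (n * h n)⁻¹ * (η * (n * h n)) ^ 2 := by
        field_simp
  have hzero : Tendsto (fun n : ℕ => C / η ^ 2 * ((n : ℝ) * h n)⁻¹) atTop (𝓝 0) := by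
    simpa using (tendsto_inv_atTop_zero.comp hlim).const_mul (C / η ^ 2)
  exact squeeze_zero' (Eventually.of_forall fun n => measureReal_nonneg) hbound hzero

/-- The samples in which the numbers of observations in the window and in the boxes have the right
order. -/
def goodSet {n : ℕ} (κ : ℝ) (d : ℕ) (C c h : ℝ) : Set (Fin n → ℝ) :=
  {z | obsCount {x | |x| ≤ κ * h} z ≤ C * (n * h)} ∩
    ⋂ j : Fin (d + 1), ({z | c * (n * h) ≤ obsCount {x | 1 * (x / h) ∈ box κ d j} z} ∩
      {z | c * (n * h) ≤ obsCount {x | -1 * (x / h) ∈ box κ d j} z})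

theorem measurableSet_window (κ h : ℝ) : MeasurableSet {x : ℝ | |x| ≤ κ * h} :=
  measurableSet_le (by fun_prop) measurable_const

theorem measurableSet_box_preimage (κ : ℝ) (d : ℕ) (j : Fin (d + 1)) (s h : ℝ) :
    MeasurableSet {x : ℝ | s * (x / h) ∈ box κ d j} :=
  (show Measurable fun x : ℝ => s * (x / h) by fun_prop) measurableSet_Icc

theorem measurableSet_goodSet {n : ℕ} (κ : ℝ) (d : ℕ) (C c h : ℝ) :
    MeasurableSet (goodSet (n := n) κ d C c h) :=
  (measurableSet_le (measurable_obsCount (measurableSet_window κ h)) measurable_const).inter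
    (MeasurableSet.iInter fun j =>
      (measurableSet_le measurable_const
        (measurable_obsCount (measurableSet_box_preimage κ d j 1 h))).inter
      (measurableSet_le measurable_const
        (measurable_obsCount (measurableSet_box_preimage κ d j (-1) h))))

/-- The mean window count is at most `C n h` and the mean box counts are at least `2 c₁ n h`.
Allowing deviations `n h` and `c₁ n h` leaves the constants `C + 1` and `c₁`; a union bound over
finitely many counts finishes. -/
theorem exists_tendsto_goodSet {Ω : Type*} [MeasurableSpace Ω] (P : Measure Ω)
    [IsProbabilityMeasure P] (Z : ℕ → Ω → ℝ) (hZ : ∀ i, Measurable (Z i)) (hind : iIndepFun Z P)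
    (hid : ∀ i, P.map (Z i) = P.map (Z 0)) {κ₀ κ : ℝ} (hκ₀ : 0 < κ₀) (hκ : 0 < κ)
    (hd : HasRegularDensityOn P (Z 0) (Set.Ioo (-κ₀) κ₀)) (d : ℕ) (h : ℕ → ℝ)
    (hh : ∀ n, 0 < h n) (hsmall : ∀ n, κ * h n < κ₀)
    (hlim : Tendsto (fun n : ℕ => (n : ℝ) * h n) atTop atTop) :
    ∃ C c : ℝ, 0 < C ∧ 0 < c ∧
      Tendsto (fun n : ℕ => P.real {ω | (fun i : Fin n => Z i ω) ∉ goodSet κ d C c (h n)}) atTop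
        (𝓝 0) := by
  obtain ⟨C, hC, hCup⟩ := exists_measure_window_le P (hZ 0) hκ₀ hκ hd
  obtain ⟨c, hc, hclow⟩ := exists_le_measure_interval P (hZ 0) hd
  set c₁ : ℝ := c * (κ / (2 * d + 4)) / 2 with hc₁
  have hc₁pos : 0 < c₁ := by positivity
  refine ⟨C + 1, c₁, by positivity, hc₁pos, ?_⟩
  have hwin := tendsto_measure_obsCount P Z hZ hind hid (fun n => {x | |x| ≤ κ * h n})
    (fun n => measurableSet_window κ (h n)) h hlim (fun n => hCup (h n) (hh n)) one_pos
  have hboxlow : ∀ s : ℝ, (s = 1 ∨ s = -1) → ∀ (j : Fin (d + 1)) (n : ℕ),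
      2 * c₁ * h n ≤ P.real (Z 0 ⁻¹' {x | s * (x / h n) ∈ box κ d j}) := by
    intro s hs j n
    have hle : κ * (2 * (j : ℕ) + 1) / (2 * d + 4) ≤ κ * (2 * (j : ℕ) + 2) / (2 * d + 4) :=
      (left_mem_box hκ j).2
    have hup : κ * (2 * (j : ℕ) + 2) / (2 * d + 4) ≤ κ := by
      rw [div_le_iff₀ (by positivity)]
      have : ((j : ℕ) : ℝ) ≤ d := by exact_mod_cast Nat.lt_succ_iff.mp j.2
      exact mul_le_mul_of_nonneg_left (by linarith) hκ.le
    refine le_trans (le_of_eq ?_) (hclow s (κ * (2 * (j : ℕ) + 1) / (2 * d + 4))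
      (κ * (2 * (j : ℕ) + 2) / (2 * d + 4)) (h n) hs (hh n) (by positivity) hle
      ((mul_le_mul_of_nonneg_right hup (hh n).le).trans_lt (hsmall n)))
    rw [hc₁]
    ring
  have hboxup : ∀ s : ℝ, (s = 1 ∨ s = -1) → ∀ (j : Fin (d + 1)) (n : ℕ),
      P.real (Z 0 ⁻¹' {x | s * (x / h n) ∈ box κ d j}) ≤ C * h n := by
    intro s hs j n
    refine le_trans (measureReal_mono (Set.preimage_mono fun x hx => ?_)) (hCup (h n) (hh n))
    have h1 := le_of_mem_box hκ hx
    have h2 : s * (x / h n) ≤ κ := by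
      refine (le_of_mem_box' hκ hx).trans ?_
      rw [div_le_iff₀ (by positivity)]
      exact mul_le_mul_of_nonneg_left (by linarith) hκ.le
    have h3 : 0 ≤ s * (x / h n) := le_trans (by positivity) h1
    have h4 : |x / h n| ≤ κ := by
      rcases hs with rfl | rfl
      · rw [one_mul] at h2 h3
        rwa [abs_of_nonneg h3]
      · rw [abs_le]
        constructor <;> linarith
    rwa [abs_div, abs_of_pos (hh n), div_le_iff₀ (hh n)] at h4
  have hbox : ∀ s : ℝ, (s = 1 ∨ s = -1) → ∀ j : Fin (d + 1), Tendsto (fun n : ℕ =>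
      P.real {ω | c₁ * (n * h n) ≤ |obsCount {x | s * (x / h n) ∈ box κ d j}
        (fun i : Fin n => Z i ω) - n * P.real (Z 0 ⁻¹' {x | s * (x / h n) ∈ box κ d j})|})
      atTop (𝓝 0) := fun s hs j =>
    tendsto_measure_obsCount P Z hZ hind hid (fun n => {x | s * (x / h n) ∈ box κ d j})
      (fun n => measurableSet_box_preimage κ d j s (h n)) h hlim (hboxup s hs j) hc₁pos
  have hsum : Tendsto (fun n : ℕ =>
      P.real {ω | 1 * (n * h n) ≤ |obsCount {x | |x| ≤ κ * h n} (fun i : Fin n => Z i ω)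
          - n * P.real (Z 0 ⁻¹' {x | |x| ≤ κ * h n})|}
      + ∑ j : Fin (d + 1),
        (P.real {ω | c₁ * (n * h n) ≤ |obsCount {x | 1 * (x / h n) ∈ box κ d j}
          (fun i : Fin n => Z i ω) - n * P.real (Z 0 ⁻¹' {x | 1 * (x / h n) ∈ box κ d j})|}
        + P.real {ω | c₁ * (n * h n) ≤ |obsCount {x | -1 * (x / h n) ∈ box κ d j}
          (fun i : Fin n => Z i ω) - n * P.real (Z 0 ⁻¹' {x | -1 * (x / h n) ∈ box κ d j})|}))
      atTop (𝓝 0) := by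
    have h1 := hwin.add (tendsto_finsetSum Finset.univ fun j _ =>
      (hbox 1 (Or.inl rfl) j).add (hbox (-1) (Or.inr rfl) j))
    simpa using h1
  refine squeeze_zero (fun n => measureReal_nonneg) (fun n => ?_) hsum
  have hn0 : (0 : ℝ) ≤ n := Nat.cast_nonneg n
  refine le_trans (measureReal_mono (s₂ := {ω | 1 * (n * h n)
      ≤ |obsCount {x | |x| ≤ κ * h n} (fun i : Fin n => Z i ω)
          - n * P.real (Z 0 ⁻¹' {x | |x| ≤ κ * h n})|} ∪ ⋃ j : Fin (d + 1),
        ({ω | c₁ * (n * h n) ≤ |obsCount {x | 1 * (x / h n) ∈ box κ d j}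
          (fun i : Fin n => Z i ω) - n * P.real (Z 0 ⁻¹' {x | 1 * (x / h n) ∈ box κ d j})|}
        ∪ {ω | c₁ * (n * h n) ≤ |obsCount {x | -1 * (x / h n) ∈ box κ d j}
          (fun i : Fin n => Z i ω) - n * P.real (Z 0 ⁻¹' {x | -1 * (x / h n) ∈ box κ d j})|}))
      fun ω hω => ?_) ((measureReal_union_le _ _).trans (add_le_add le_rfl
        ((measureReal_iUnion_fintype_le _).trans (Finset.sum_le_sum fun j _ =>
          measureReal_union_le _ _))))
  by_contra hnot
  simp only [Set.mem_union, Set.mem_iUnion, Set.mem_ofPred_eq, not_or, not_exists, not_le,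
    abs_lt] at hnot
  apply hω
  refine ⟨?_, Set.mem_iInter.mpr fun j => ⟨?_, ?_⟩⟩
  · have h1 := hnot.1.2
    have h2 := mul_le_mul_of_nonneg_left (hCup (h n) (hh n)) hn0
    change obsCount _ _ ≤ _
    linarith
  · have h1 := (hnot.2 j).1.1
    have h2 := mul_le_mul_of_nonneg_left (hboxlow 1 (Or.inl rfl) j n) hn0
    change _ ≤ obsCount _ _
    linarith
  · have h1 := (hnot.2 j).2.1
    have h2 := mul_le_mul_of_nonneg_left (hboxlow (-1) (Or.inr rfl) j n) hn0
    change _ ≤ obsCount _ _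
    linarith

/-- All boxes lie in one compact subset of `(0, κ)`; the kernel may degenerate at `0` and at `κ`. -/
theorem IsKernel.exists_le_on_boxes {K : ℝ → ℝ} {κ : ℝ} (hK : IsKernel K κ) (d : ℕ) :
    ∃ c : ℝ, 0 < c ∧ ∀ (j : Fin (d + 1)) (u : ℝ), u ∈ box κ d j → c ≤ K u := by
  have hκ := hK.radius_pos
  have hsub : Set.Icc (κ / (2 * d + 4)) (κ * (2 * d + 2) / (2 * d + 4)) ⊆ Set.Ioo 0 κ := by
    intro x hx
    refine ⟨lt_of_lt_of_le (by positivity) hx.1, hx.2.trans_lt ?_⟩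
    rw [div_lt_iff₀ (by positivity)]
    exact mul_lt_mul_of_pos_left (by linarith) hκ
  have hne : (Set.Icc (κ / (2 * d + 4)) (κ * (2 * d + 2) / (2 * d + 4))).Nonempty :=
    ⟨_, le_of_mem_box hκ (left_mem_box hκ (0 : Fin (d + 1))),
      le_of_mem_box' hκ (left_mem_box hκ (0 : Fin (d + 1)))⟩
  obtain ⟨x, hx, hmin⟩ := isCompact_Icc.exists_isMinOn hne (hK.cont.mono hsub)
  exact ⟨K x, hK.pos x (hsub hx), fun j u hu =>
    hmin (show u ∈ Set.Icc _ _ from ⟨le_of_mem_box hκ hu, le_of_mem_box' hκ hu⟩)⟩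

/-- Links the counts to the deterministic theory. The conditions on `A` cover both half-lines, with
or without the cutoff point; on the left side the symmetry of `K` transfers its lower bound. -/
theorem isSideMeasure_of_mem_goodSet {n : ℕ} (hn : 0 < n) {K : ℝ → ℝ} {κ : ℝ}
    (hK : IsKernel K κ) {B k₀ : ℝ} (hB : 0 ≤ B) (hKB : ∀ u, K u ≤ B) {d : ℕ} (hk₀ : 0 < k₀)
    (hk : ∀ (j : Fin (d + 1)) (u : ℝ), u ∈ box κ d j → k₀ ≤ K u) {C c h : ℝ} (hh : 0 < h)
    {z : Fin n → ℝ} (hz : z ∈ goodSet κ d C c h) {A : Set ℝ} {s : ℝ} (hs : s = 1 ∨ s = -1)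
    (hA : ∀ x, 0 < s * x → x ∈ A) (hA' : ∀ x ∈ A, 0 ≤ s * x) :
    IsSideMeasure s κ d (k₀ * c) (B * C) (fun i => weight A K h (z i) * (n : ℝ)⁻¹)
      (fun i => z i / h) := by
  have hn' : (0 : ℝ) < n := by exact_mod_cast hn
  have hκ := hK.radius_pos
  obtain ⟨hwin, hbox⟩ := hz
  rw [Set.mem_iInter] at hbox
  have hboxs : ∀ j : Fin (d + 1), c * (n * h) ≤ obsCount {x | s * (x / h) ∈ box κ d j} z := by
    intro j
    rcases hs with rfl | rfl
    · exact (hbox j).1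
    · exact (hbox j).2
  refine ⟨hs, fun i => mul_nonneg (weight_nonneg hK.nonneg hh _) (by positivity), ?_, ?_, ?_, ?_⟩
  · intro i hi
    have := hA' _ (abs_le_of_weight_ne_zero hK.support hh (left_ne_zero_of_mul hi)).1
    rw [← mul_div_assoc]
    positivity
  · intro i hi
    have h1 := (abs_le_of_weight_ne_zero hK.support hh (left_ne_zero_of_mul hi)).2
    rw [← mul_div_assoc, div_le_iff₀ hh]
    refine le_trans ?_ h1
    rcases hs with rfl | rfl
    · rw [one_mul]
      exact le_abs_self _
    · rw [neg_one_mul]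
      exact neg_le_abs _
  · calc ∑ i, weight A K h (z i) * (n : ℝ)⁻¹
        ≤ ∑ i, B / h * (n : ℝ)⁻¹ * {x | |x| ≤ κ * h}.indicator (fun _ => (1 : ℝ)) (z i) := by
          refine Finset.sum_le_sum fun i _ => ?_
          by_cases hi : |z i| ≤ κ * h
          · rw [Set.indicator_of_mem (show z i ∈ {x | |x| ≤ κ * h} from hi), mul_one]
            have := weight_le (A := A) hB hKB hh (z i)
            gcongr
          · rw [Set.indicator_of_notMem (show z i ∉ {x | |x| ≤ κ * h} from hi), mul_zero]
            have : weight A K h (z i) = 0 := by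
              by_contra h0
              exact hi (abs_le_of_weight_ne_zero hK.support hh h0).2
            rw [this, zero_mul]
      _ = B / h * (n : ℝ)⁻¹ * obsCount {x | |x| ≤ κ * h} z := by rw [obsCount, Finset.mul_sum]
      _ ≤ B / h * (n : ℝ)⁻¹ * (C * (n * h)) := by
          have : obsCount {x | |x| ≤ κ * h} z ≤ C * (n * h) := hwin
          gcongr
      _ = B * C := by field_simp
  · intro j
    classical
    calc k₀ * c = k₀ / h * (n : ℝ)⁻¹ * (c * (n * h)) := by field_simp
      _ ≤ k₀ / h * (n : ℝ)⁻¹ * obsCount {x | s * (x / h) ∈ box κ d j} z := by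
          have := hboxs j
          gcongr
      _ = ∑ i with s * (z i / h) ∈ box κ d j, k₀ / h * (n : ℝ)⁻¹ := by
          rw [obsCount_eq_card, Finset.sum_const, nsmul_eq_mul, mul_comm]
          congr
      _ ≤ ∑ i with s * (z i / h) ∈ box κ d j, weight A K h (z i) * (n : ℝ)⁻¹ := by
          refine Finset.sum_le_sum fun i hi => ?_
          have hi' := (Finset.mem_filter.mp hi).2
          have hpos : 0 < s * z i := by
            have h1 : 0 < s * (z i / h) := lt_of_lt_of_le (by positivity) (le_of_mem_box hκ hi')
            rw [← mul_div_assoc] at h1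
            exact (div_pos_iff_of_pos_right hh).mp h1
          have hKi : k₀ ≤ K (z i / h) := by
            refine (hk j _ hi').trans_eq ?_
            rcases hs with rfl | rfl
            · rw [one_mul]
            · rw [neg_one_mul, hK.symm]
          rw [weight, Set.indicator_of_mem (hA _ hpos)]
          gcongr
      _ ≤ _ := le_of_eq (by congr)

/-! ### The bias-corrected weights on the good event -/

theorem exists_isLPWeight_of_goodSet {K : ℝ → ℝ} {κ : ℝ} (hK : IsKernel K κ) {ν p : ℕ}
    (hν : ν ≤ p) {D d : ℝ} (hD : 0 < D) (hd : 0 < d) :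
    ∃ C c : ℝ, 0 < C ∧ 0 < c ∧ ∀ (n : ℕ) (A : Set ℝ) (s h : ℝ) (z : Fin n → ℝ), 0 < n → 0 < h →
      (s = 1 ∨ s = -1) → (∀ x, 0 < s * x → x ∈ A) → (∀ x ∈ A, 0 ≤ s * x) →
      z ∈ goodSet κ p D d h →
      IsLPWeight A κ ν p h C z (lpWeight A K ν p h z) ∧
        c * h ^ (p + 1 - ν) ≤ |∑ i, lpWeight A K ν p h z i * z i ^ (p + 1)| := by
  obtain ⟨B, hB⟩ := hK.bounded
  -- The maximum with `1` makes the mass bound strictly positive.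
  have hB' : ∀ u, K u ≤ max B 1 := fun u => (hB u).trans (le_max_left _ _)
  have hB0 : (0 : ℝ) < max B 1 := lt_max_of_lt_right one_pos
  obtain ⟨k₀, hk₀, hk⟩ := hK.exists_le_on_boxes p
  obtain ⟨C, c, hC, hc, H⟩ := exists_isLPWeight hK.radius_pos ν p hν (m := k₀ * d)
    (M := max B 1 * D) (B := max B 1) (N := D) (by positivity) (by positivity) hB0.le
  refine ⟨C, c, hC, hc, fun n A s h z hn hh hs hA hA' hz => ?_⟩
  refine H n A K s h z hh hK.nonneg hB' hK.support
    (isSideMeasure_of_mem_goodSet hn hK hB0.le hB' hk₀ hk hh hz hs hA hA') ?_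
  have h1 : obsCount {x | |x| ≤ κ * h} z ≤ D * (n * h) := hz.1
  rw [obsCount_eq_card] at h1
  convert h1
  exact Iff.rfl

theorem exists_bcWeight_bounds {K : ℝ → ℝ} {κ : ℝ} (hK : IsKernel K κ) {ν p q : ℕ}
    (hν : ν ≤ p) (hpq : p < q) {D d D' d' M : ℝ} (hD : 0 < D) (hd : 0 < d) (hD' : 0 < D')
    (hd' : 0 < d') (hM : 0 ≤ M) :
    ∃ C c : ℝ, 0 < C ∧ 0 < c ∧ ∀ (n : ℕ) (A : Set ℝ) (s h b : ℝ) (z : Fin n → ℝ), 0 < n →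
      0 < h → 0 < b → (s = 1 ∨ s = -1) → (∀ x, 0 < s * x → x ∈ A) → (∀ x ∈ A, 0 ≤ s * x) →
      z ∈ goodSet κ p D d h → z ∈ goodSet κ q D' d' b →
      c * (h ^ (p + 1 - ν)) ^ 2
          ≤ (∑ i, bcWeight A K ν p q h b z i ^ 2) * (n * min h b ^ (2 * p + 3)) ∧
      (∀ i, |bcWeight A K ν p q h b z i|
        ≤ C * (h ^ (p + 1 - ν) * (n : ℝ)⁻¹ * (min h b ^ (p + 2))⁻¹)) ∧
      ∀ (f : ℝ → ℝ) (t : ℕ → ℝ),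
        (∀ x ∈ A, |x| ≤ κ * h →
          |f x - ∑ k ∈ Finset.range (p + 2), t k * x ^ k| ≤ M * |x| ^ (p + 2)) →
        (∀ x ∈ A, |x| ≤ κ * b →
          |f x - ∑ k ∈ Finset.range (q + 1), t k * x ^ k| ≤ M * |x| ^ (q + 1)) →
        |∑ i, bcWeight A K ν p q h b z i * f (z i) - (ν ! : ℝ) * t ν|
          ≤ C * (h ^ (p + 1 - ν) * (h + b ^ (q - p))) := by
  have hκ := hK.radius_pos
  obtain ⟨C₁, c₁, hC₁, hc₁, H₁⟩ := exists_isLPWeight_of_goodSet hK hν hD hd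
  obtain ⟨C₂, c₂, hC₂, hc₂, H₂⟩ :=
    exists_isLPWeight_of_goodSet hK (Nat.succ_le_of_lt hpq) hD' hd'
  set C := max C₁ C₂ with hCdef
  have hC : 0 < C := lt_max_of_lt_left hC₁
  obtain ⟨c, hc, Hc⟩ := exists_le_sum_sq_corrected hκ hν hC hc₁
  refine ⟨max (C + C ^ 3 * κ ^ (p + 1)) (C ^ 2 * M * κ ^ (p + 2) + C ^ 4 * M * κ ^ (p + q + 2)),
    c, lt_max_of_lt_left (by positivity), hc, fun n A s h b z hn hh hb hs hA hA' hz hz' => ?_⟩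
  have h1 := H₁ n A s h z hn hh hs hA hA' hz
  have L := h1.1.mono hh (le_max_left C₁ C₂)
  have L' := (H₂ n A s b z hn hb hs hA hA' hz').1.mono hb (le_max_right C₁ C₂)
  have hm : 0 < min h b := lt_min hh hb
  have heq : ∀ i, bcWeight A K ν p q h b z i
      = corrected p z (lpWeight A K ν p h z) (lpWeight A K (p + 1) q b z) i := fun _ => rfl
  simp only [heq]
  refine ⟨Hc n q A h b z _ _ hn hh hb hpq L L' h1.2, fun i => ?_, fun f t hf hf' => ?_⟩
  · exact (abs_corrected_le hκ hν hn hh hb hC L L' i).trans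
      (mul_le_mul_of_nonneg_right (le_max_left _ _) (by positivity))
  · refine (abs_sum_corrected_sub_le hκ hν hpq hn hh hb hC hM L L' (fun i => f (z i)) t
      (fun i hi => hf _ (L.supp i hi).1 (L.supp i hi).2)
      (fun i hi => hf' _ (L'.supp i hi).1 (L'.supp i hi).2)).trans
      (mul_le_mul_of_nonneg_right (le_max_right _ _) (by positivity))

/-- All bounds are expressed relative to `‖a‖₂`, the form used by `tendsto_charFun_studentized`. The
coefficients `t` and `u` differ because the regression function may jump, together with its
derivatives, at the cutoff. -/
theorem exists_tauWeight_bounds {K : ℝ → ℝ} {κ : ℝ} (hK : IsKernel K κ) {ν p q : ℕ}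
    (hν : ν ≤ p) (hpq : p < q) {D d D' d' M : ℝ} (hD : 0 < D) (hd : 0 < d) (hD' : 0 < D')
    (hd' : 0 < d') (hM : 0 ≤ M) {κ₀ : ℝ} (f : ℝ → ℝ) (t u : ℕ → ℝ)
    (hf : ∀ x, 0 ≤ x → x < κ₀ →
      |f x - ∑ k ∈ Finset.range (p + 2), t k * x ^ k| ≤ M * |x| ^ (p + 2))
    (hf' : ∀ x, 0 ≤ x → x < κ₀ →
      |f x - ∑ k ∈ Finset.range (q + 1), t k * x ^ k| ≤ M * |x| ^ (q + 1))
    (hg : ∀ x, x < 0 → -κ₀ < x →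
      |f x - ∑ k ∈ Finset.range (p + 2), u k * x ^ k| ≤ M * |x| ^ (p + 2))
    (hg' : ∀ x, x < 0 → -κ₀ < x →
      |f x - ∑ k ∈ Finset.range (q + 1), u k * x ^ k| ≤ M * |x| ^ (q + 1)) :
    ∃ C : ℝ, 0 < C ∧ ∀ (n : ℕ) (h b : ℝ) (z : Fin n → ℝ), 0 < n → 0 < h → 0 < b →
      κ * h < κ₀ → κ * b < κ₀ → z ∈ goodSet κ p D d h → z ∈ goodSet κ q D' d' b →
      0 < ∑ i, tauWeight K ν p q h b z i ^ 2 ∧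
      (∀ i, |tauWeight K ν p q h b z i|
        ≤ C * (Real.sqrt (n * min h b))⁻¹ * Real.sqrt (∑ i, tauWeight K ν p q h b z i ^ 2)) ∧
      |∑ i, tauWeight K ν p q h b z i * f (z i) - (ν ! : ℝ) * (t ν - u ν)|
        ≤ C * (Real.sqrt (n * min h b ^ (2 * p + 3)) * (h + b ^ (q - p)))
          * Real.sqrt (∑ i, tauWeight K ν p q h b z i ^ 2) := by
  obtain ⟨C, c, hC, hc, H⟩ := exists_bcWeight_bounds hK hν hpq hD hd hD' hd' hM
  refine ⟨2 * C / Real.sqrt c, by positivity, fun n h b z hn hh hb hhκ hbκ hz hz' => ?_⟩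
  have hn' : (0 : ℝ) < n := by exact_mod_cast hn
  have hm : 0 < min h b := lt_min hh hb
  obtain ⟨hQp, hap, hbp⟩ := H n (Set.Ici 0) 1 h b z hn hh hb (Or.inl rfl)
    (fun x hx => by simpa using (one_mul x ▸ hx : (0 : ℝ) < x).le)
    (fun x hx => by simpa using hx) hz hz'
  obtain ⟨_, ham, hbm⟩ := H n (Set.Iio 0) (-1) h b z hn hh hb (Or.inr rfl)
    (fun x hx => by simpa using hx) (fun x hx => by simpa using (Set.mem_Iio.mp hx).le) hz hz'
  set m := min h b with hmdef
  set Q := ∑ i, tauWeight K ν p q h b z i ^ 2 with hQdef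
  set H₀ := h ^ (p + 1 - ν) with hH₀
  have hH₀pos : 0 < H₀ := by positivity
  -- Squared weights of the two sides add up, so a lower bound on the right side is enough.
  have hQle : ∑ i, bcWeight (Set.Ici 0) K ν p q h b z i ^ 2 ≤ Q := by
    rw [hQdef]
    refine Finset.sum_le_sum fun i _ => ?_
    rw [tauWeight_sq]
    exact le_add_of_nonneg_right (sq_nonneg _)
  have hQH : c * H₀ ^ 2 ≤ Q * (n * m ^ (2 * p + 3)) :=
    hQp.trans (mul_le_mul_of_nonneg_right hQle (by positivity))
  have hQpos : 0 < Q := by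
    have h1 : 0 < Q * (n * m ^ (2 * p + 3)) := lt_of_lt_of_le (by positivity) hQH
    exact pos_of_mul_pos_left h1 (by positivity)
  have hH : H₀ ≤ (Real.sqrt c)⁻¹ * (Real.sqrt Q * Real.sqrt (n * m ^ (2 * p + 3))) := by
    have h1 := Real.sqrt_le_sqrt hQH
    rw [Real.sqrt_mul hc.le, Real.sqrt_sq hH₀pos.le, Real.sqrt_mul hQpos.le] at h1
    rw [inv_mul_eq_div, le_div_iff₀ (by positivity)]
    linarith
  refine ⟨hQpos, fun i => ?_, ?_⟩
  · have habs : |tauWeight K ν p q h b z i| ≤ C * (H₀ * (n : ℝ)⁻¹ * (m ^ (p + 2))⁻¹) := by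
      rw [tauWeight]
      rcases le_or_gt 0 (z i) with h0 | h0
      · rw [bcWeight_of_notMem (Set.Iio 0) K ν p q h b z i (by simpa using h0), sub_zero]
        exact hap i
      · rw [bcWeight_of_notMem (Set.Ici 0) K ν p q h b z i (by simpa using h0), zero_sub, abs_neg]
        exact ham i
    -- Powers of `m`: `(p + 3/2) - (p + 2) = -1/2`.
    have hsq : Real.sqrt (n * m ^ (2 * p + 3)) * ((n : ℝ)⁻¹ * (m ^ (p + 2))⁻¹)
        = (Real.sqrt (n * m))⁻¹ := by
      have h1 : (n : ℝ) * m ^ (2 * p + 3) = (n * m) * (m ^ (p + 1)) ^ 2 := by ring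
      rw [h1, Real.sqrt_mul (by positivity), Real.sqrt_sq (by positivity)]
      have h2 : Real.sqrt (n * m) ≠ 0 := by positivity
      have h3 := Real.mul_self_sqrt (show 0 ≤ (n : ℝ) * m by positivity)
      refine eq_inv_of_mul_eq_one_right ?_
      calc _ = (Real.sqrt (n * m) * Real.sqrt (n * m)) * (m ^ (p + 1) * ((n : ℝ)⁻¹
              * (m ^ (p + 2))⁻¹)) := by ring
        _ = 1 := by
          rw [h3]
          field_simp
          ring
    calc |tauWeight K ν p q h b z i| ≤ C * (H₀ * (n : ℝ)⁻¹ * (m ^ (p + 2))⁻¹) := habs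
      _ ≤ C * ((Real.sqrt c)⁻¹ * (Real.sqrt Q * Real.sqrt (n * m ^ (2 * p + 3))) * (n : ℝ)⁻¹
            * (m ^ (p + 2))⁻¹) := by gcongr
      _ = C * (Real.sqrt c)⁻¹ * (Real.sqrt (n * m ^ (2 * p + 3))
            * ((n : ℝ)⁻¹ * (m ^ (p + 2))⁻¹)) * Real.sqrt Q := by ring
      _ = C / Real.sqrt c * (Real.sqrt (n * m))⁻¹ * Real.sqrt Q := by rw [hsq, div_eq_mul_inv]
      _ ≤ 2 * C / Real.sqrt c * (Real.sqrt (n * m))⁻¹ * Real.sqrt Q := by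
        gcongr
        linarith
  · have hp := hbp f t (fun x hx hxh => hf x hx ((le_abs_self x).trans_lt (hxh.trans_lt hhκ)))
      (fun x hx hxb => hf' x hx ((le_abs_self x).trans_lt (hxb.trans_lt hbκ)))
    have hlow : ∀ {x y : ℝ}, |x| ≤ y → y < κ₀ → -κ₀ < x := fun h1 h2 => by
      linarith [(abs_le.mp h1).1]
    have hm' := hbm f u (fun x hx hxh => hg x hx (hlow hxh hhκ))
      (fun x hx hxb => hg' x hx (hlow hxb hbκ))
    have hsplit : ∑ i, tauWeight K ν p q h b z i * f (z i) - (ν ! : ℝ) * (t ν - u ν)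
        = (∑ i, bcWeight (Set.Ici 0) K ν p q h b z i * f (z i) - (ν ! : ℝ) * t ν)
          - (∑ i, bcWeight (Set.Iio 0) K ν p q h b z i * f (z i) - (ν ! : ℝ) * u ν) := by
      simp only [tauWeight, sub_mul, Finset.sum_sub_distrib]
      ring
    rw [hsplit]
    calc _ ≤ C * (H₀ * (h + b ^ (q - p))) + C * (H₀ * (h + b ^ (q - p))) :=
          (abs_sub _ _).trans (add_le_add hp hm')
      _ = 2 * C * (H₀ * (h + b ^ (q - p))) := by ring
      _ ≤ 2 * C * ((Real.sqrt c)⁻¹ * (Real.sqrt Q * Real.sqrt (n * m ^ (2 * p + 3)))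
            * (h + b ^ (q - p))) := by gcongr
      _ = _ := by rw [div_eq_mul_inv]; ring

/-! ### Measurability of the weights -/

theorem measurable_indicator_of_continuousOn {f : ℝ → ℝ} {s : Set ℝ} (hs : MeasurableSet s)
    (hf : ContinuousOn f s) : Measurable (s.indicator f) := by
  classical
  rw [← Set.piecewise_eq_indicator]
  exact hf.measurable_piecewise continuousOn_const hs

theorem measurable_indicator_glue {f g : ℝ → ℝ} {s : Set ℝ} (hs : MeasurableSet s)
    (hf : ContinuousOn f s) (hg : ContinuousOn g s) : Measurable (s.indicator (glue f g)) := by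
  have h1 : s.indicator (glue f g)
      = fun z => if 0 ≤ z then s.indicator g z else s.indicator f z := by
    funext z
    by_cases hz : z ∈ s <;> simp [glue, hz]
  rw [h1]
  exact Measurable.ite measurableSet_Ici (measurable_indicator_of_continuousOn hs hg)
    (measurable_indicator_of_continuousOn hs hf)

/-- Continuity is given on `(0, κ)` and passes to `(-κ, 0)` by symmetry; what remains are the three
points `0` and `±κ`, and zero elsewhere. -/
theorem IsKernel.measurable {K : ℝ → ℝ} {κ : ℝ} (hK : IsKernel K κ) : Measurable K := by
  have hκ := hK.radius_pos
  have hc : ContinuousOn K (Set.Ioo (-κ) 0) := by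
    have h1 : ContinuousOn (fun u => K (-u)) (Set.Ioo (-κ) 0) :=
      hK.cont.comp continuous_neg.continuousOn fun u hu => ⟨by linarith [hu.2], by linarith [hu.1]⟩
    exact h1.congr fun u _ => (hK.symm u).symm
  have heq : K = fun u => (Set.Ioo 0 κ).indicator K u + (Set.Ioo (-κ) 0).indicator K u
      + ((if u = 0 then K 0 else 0) + (if u = κ then K κ else 0)
        + (if u = -κ then K (-κ) else 0)) := by
    funext u
    by_cases h0 : u = 0
    · subst h0
      simp [hκ.ne, hκ.ne']
    by_cases h1 : u = κ
    · subst h1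
      have : ¬ u = -u := by intro h; linarith
      simp [hκ.ne', this, hκ.not_gt]
    by_cases h2 : u = -κ
    · subst h2
      have : ¬ -κ = κ := by intro h; linarith
      simp [hκ.ne', this, hκ.not_gt]
    by_cases h3 : κ < |u|
    · have h4 := hK.support u h3
      simp [h4, h0, h1, h2, Set.indicator_apply]
    · rw [not_lt, abs_le] at h3
      have h4 : -κ < u := lt_of_le_of_ne h3.1 (Ne.symm h2)
      have h5 : u < κ := lt_of_le_of_ne h3.2 h1
      rcases lt_or_gt_of_ne h0 with h6 | h6
      · simp [h0, h1, h2, h4, h6, h6.not_gt]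
      · simp [h0, h1, h2, h5, h6, h6.not_gt]
  rw [heq]
  have hite : ∀ a c : ℝ, Measurable fun u : ℝ => if u = a then c else 0 := fun a c =>
    Measurable.ite (measurableSet_singleton a) measurable_const measurable_const
  exact ((measurable_indicator_of_continuousOn measurableSet_Ioo hK.cont).add
    (measurable_indicator_of_continuousOn measurableSet_Ioo hc)).add
    (((hite _ _).add (hite _ _)).add (hite _ _))

theorem measurable_matrix_det {α : Type*} [MeasurableSpace α] {m : ℕ}
    {M : α → Matrix (Fin m) (Fin m) ℝ} (hM : ∀ i j, Measurable fun x => M x i j) :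
    Measurable fun x => (M x).det := by
  simp only [Matrix.det_apply']
  exact Finset.measurable_fun_sum _ fun σ _ => measurable_const.mul
    (Finset.measurable_fun_prod _ fun i _ => hM _ _)

/-- By Cramer's rule the entries are rational in those of `M`, with value zero where the determinant
vanishes. -/
theorem measurable_matrix_inv {α : Type*} [MeasurableSpace α] {m : ℕ}
    {M : α → Matrix (Fin m) (Fin m) ℝ} (hM : ∀ i j, Measurable fun x => M x i j) (i j : Fin m) :
    Measurable fun x => (M x)⁻¹ i j := by
  simp only [Matrix.inv_def, Matrix.smul_apply, smul_eq_mul, Ring.inverse_eq_inv',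
    Matrix.adjugate_apply]
  refine (measurable_matrix_det hM).inv.mul (measurable_matrix_det fun k l => ?_)
  simp only [Matrix.updateRow_apply]
  split_ifs
  · exact measurable_const
  · exact hM _ _

theorem measurable_lpWeight {n : ℕ} {A : Set ℝ} (hA : MeasurableSet A) {K : ℝ → ℝ}
    (hK : Measurable K) (ν p : ℕ) (h : ℝ) (i : Fin n) :
    Measurable fun z : Fin n → ℝ => lpWeight A K ν p h z i := by
  have hw : ∀ j : Fin n, Measurable fun z : Fin n → ℝ => weight A K h (z j) := fun j =>
    (((hK.comp (measurable_id.div_const h)).div_const h).indicator hA).comp (measurable_pi_apply j)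
  have hz : ∀ (j : Fin n) (k : ℕ), Measurable fun z : Fin n → ℝ => (z j / h) ^ k := fun j k =>
    ((show Measurable fun z : Fin n → ℝ => z j from measurable_pi_apply j).div_const h).pow_const k
  have hG : ∀ j k : Fin (p + 1), Measurable fun z : Fin n → ℝ => Gam A K p h z j k := by
    intro j k
    simp only [Gam_apply]
    exact Finset.measurable_fun_sum _ fun l _ => ((hw l).mul_const _).mul ((hz l _).mul (hz l _))
  unfold lpWeight
  simp only [dotProduct, Matrix.mulVec]
  refine ((Measurable.const_mul ?_ _).mul (hw i)).mul_const _
  exact Finset.measurable_fun_sum _ fun j _ => measurable_const.mul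
    (Finset.measurable_fun_sum _ fun k _ => (measurable_matrix_inv hG j k).mul (hz i _))

theorem measurable_tauWeight {n : ℕ} {K : ℝ → ℝ} (hK : Measurable K) (ν p q : ℕ) (h b : ℝ)
    (i : Fin n) : Measurable fun z : Fin n → ℝ => tauWeight K ν p q h b z i := by
  have hbc : ∀ A : Set ℝ, MeasurableSet A →
      Measurable fun z : Fin n → ℝ => bcWeight A K ν p q h b z i := by
    intro A hA
    exact (measurable_lpWeight hA hK ν p h i).sub (((Finset.measurable_fun_sum _ fun j _ =>
      (measurable_lpWeight hA hK ν p h j).mul ((measurable_pi_apply j).pow_const _)).div_const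
        _).mul (measurable_lpWeight hA hK (p + 1) q b i))
  exact (hbc _ measurableSet_Ici).sub (hbc _ measurableSet_Iio)

theorem abs_le_of_tauWeight_ne_zero {n : ℕ} {K : ℝ → ℝ} {κ : ℝ} (hK : IsKernel K κ) {ν p q : ℕ}
    {h b : ℝ} (hh : 0 < h) (hb : 0 < b) {z : Fin n → ℝ} {i : Fin n}
    (hi : tauWeight K ν p q h b z i ≠ 0) : |z i| ≤ κ * max h b := by
  have hκ := hK.radius_pos
  have hlp : ∀ (A : Set ℝ) (ν p : ℕ) (h : ℝ), 0 < h → κ * h < |z i| →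
      lpWeight A K ν p h z i = 0 := by
    intro A ν p h hh hlt
    have hw : weight A K h (z i) = 0 := by
      by_contra h0
      exact absurd (abs_le_of_weight_ne_zero hK.support hh h0).2 (not_le.mpr hlt)
    rw [lpWeight, hw, mul_zero, zero_mul]
  by_contra hlt
  rw [not_le] at hlt
  have h1 : κ * h < |z i| := (mul_le_mul_of_nonneg_left (le_max_left h b) hκ.le).trans_lt hlt
  have h2 : κ * b < |z i| := (mul_le_mul_of_nonneg_left (le_max_right h b) hκ.le).trans_lt hlt
  apply hi
  simp only [tauWeight, bcWeight, hlp _ _ _ _ hh h1, hlp _ _ _ _ hb h2]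
  ring
/-! ### Asymptotic normality -/

/-- The bound on the conditional mean holds almost everywhere; the density condition makes it hold
everywhere, and then the Taylor bounds apply on each side. -/
theorem exists_design_expansion {Ω : Type*} [MeasurableSpace Ω] (P : Measure Ω)
    [IsProbabilityMeasure P] {Z X X₀ X₁ : Ω → ℝ} {κ₀ : ℝ} {S : ℕ} {μm μp sm sp : ℝ → ℝ}
    (hd : IsSmoothDesign P Z X X₀ X₁ κ₀ S μm μp sm sp) {C : ℝ}
    (hC : ∀ᵐ z ∂(P.map Z), z ∈ Set.Ioo (-κ₀) κ₀ → |glue μm μp z| ≤ C) {d : ℕ} (hdS : d + 1 ≤ S) :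
    ∃ M : ℝ, 0 ≤ M ∧
      (∀ x, 0 ≤ x → x < κ₀ → |glue μm μp x
        - ∑ k ∈ Finset.range (d + 1), iteratedDeriv k μp 0 / (k ! : ℝ) * x ^ k|
          ≤ M * |x| ^ (d + 1)) ∧
      ∀ x, x < 0 → -κ₀ < x → |glue μm μp x
        - ∑ k ∈ Finset.range (d + 1), iteratedDeriv k μm 0 / (k ! : ℝ) * x ^ k|
          ≤ M * |x| ^ (d + 1) := by
  have hκ₀ := hd.radius_pos
  have hsubp : Set.Ioo 0 κ₀ ⊆ Set.Ioo (-κ₀) κ₀ := Set.Ioo_subset_Ioo_left (by linarith)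
  have hsubm : Set.Ioo (-κ₀) 0 ⊆ Set.Ioo (-κ₀) κ₀ := Set.Ioo_subset_Ioo_right hκ₀.le
  have hBp : ∀ x ∈ Set.Ioo 0 κ₀, |μp x| ≤ C := by
    refine abs_le_of_ae_of_density hsubp isOpen_Ioo hd.density
      (hd.smooth_treated.continuousOn.mono hsubp) (ae_restrict_of_ae ?_)
    filter_upwards [hC] with z hz hzV
    have := hz (hsubp hzV)
    rwa [glue, if_pos hzV.1.le] at this
  have hBm : ∀ x ∈ Set.Ioo (-κ₀) 0, |μm x| ≤ C := by
    refine abs_le_of_ae_of_density hsubm isOpen_Ioo hd.density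
      (hd.smooth_control.continuousOn.mono hsubm) (ae_restrict_of_ae ?_)
    filter_upwards [hC] with z hz hzV
    have := hz (hsubm hzV)
    rwa [glue, if_neg hzV.2.not_ge] at this
  obtain ⟨M₁, hM₁, h₁⟩ := exists_taylor_bound hκ₀ hd.smooth_treated hBp d hdS
  obtain ⟨M₂, _, h₂⟩ := exists_taylor_bound_left hκ₀ hd.smooth_control hBm d hdS
  refine ⟨max M₁ M₂, hM₁.trans (le_max_left _ _), fun x hx hxκ => ?_, fun x hx hxκ => ?_⟩
  · rw [glue, if_pos hx]
    exact (h₁ x hx hxκ).trans (mul_le_mul_of_nonneg_right (le_max_left _ _) (by positivity))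
  · rw [glue, if_neg hx.not_ge]
    exact (h₂ x hx.le hxκ).trans (mul_le_mul_of_nonneg_right (le_max_right _ _) (by positivity))

/-- Translates the bias ratio into the square root of the quantity in the rate condition; the `2`
comes from bounding a sum by a maximum. -/
theorem sqrt_mul_bandwidth_le {p q : ℕ} (n : ℕ) {h b : ℝ} (hh : 0 < h) (hb : 0 < b) :
    Real.sqrt (n * min h b ^ (2 * p + 3)) * (h + b ^ (q - p))
      ≤ 2 * Real.sqrt (n * min (h ^ (2 * p + 3)) (b ^ (2 * p + 3))
        * max (h ^ 2) (b ^ (2 * (q - p)))) := by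
  have hm : 0 < min h b := lt_min hh hb
  have h1 : min h b ^ (2 * p + 3) ≤ min (h ^ (2 * p + 3)) (b ^ (2 * p + 3)) :=
    le_min (pow_le_pow_left₀ hm.le (min_le_left _ _) _) (pow_le_pow_left₀ hm.le (min_le_right _ _) _)
  have h2 : h ≤ Real.sqrt (max (h ^ 2) (b ^ (2 * (q - p)))) :=
    Real.le_sqrt_of_sq_le (le_max_left _ _)
  have h3 : b ^ (q - p) ≤ Real.sqrt (max (h ^ 2) (b ^ (2 * (q - p)))) := by
    refine Real.le_sqrt_of_sq_le (le_trans (le_of_eq ?_) (le_max_right _ _))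
    rw [← pow_mul, mul_comm]
  have h4 : (0 : ℝ) ≤ n * min (h ^ (2 * p + 3)) (b ^ (2 * p + 3)) :=
    mul_nonneg (Nat.cast_nonneg n) (le_min (by positivity) (by positivity))
  rw [Real.sqrt_mul h4]
  calc _ ≤ Real.sqrt (n * min (h ^ (2 * p + 3)) (b ^ (2 * p + 3)))
        * (Real.sqrt (max (h ^ 2) (b ^ (2 * (q - p))))
          + Real.sqrt (max (h ^ 2) (b ^ (2 * (q - p))))) := by gcongr
    _ = _ := by ring

/-- The variance function is arbitrary off the neighbourhood. Cutting it off there changes nothing,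
because the weights vanish outside the larger window. -/
theorem measurable_varBC {n : ℕ} {K s : ℝ → ℝ} {κ κ₀ : ℝ} (hK : IsKernel K κ)
    (hs : Measurable ((Set.Ioo (-κ₀) κ₀).indicator s)) {ν p q : ℕ} (hν : ν ≤ p) {h b : ℝ}
    (hh : 0 < h) (hb : 0 < b) (hsmall : κ * max h b < κ₀) :
    Measurable fun z : Fin n → ℝ => varBC K s ν p q h b z := by
  have heq : (fun z : Fin n → ℝ => varBC K s ν p q h b z) = fun z =>
      ∑ i, tauWeight K ν p q h b z i ^ 2 * (Set.Ioo (-κ₀) κ₀).indicator s (z i) := by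
    funext z
    rw [varBC_eq_sum _ _ _ _ _ hν _ _ hh hb]
    refine Finset.sum_congr rfl fun i _ => ?_
    by_cases hi : tauWeight K ν p q h b z i = 0
    · rw [hi]
      ring
    · rw [Set.indicator_of_mem]
      exact abs_lt.mp ((abs_le_of_tauWeight_ne_zero hK hh hb hi).trans_lt hsmall)
  rw [heq]
  exact Finset.measurable_fun_sum _ fun i _ =>
    ((measurable_tauWeight hK.measurable ν p q h b i).pow_const 2).mul
      (hs.comp (measurable_pi_apply i))

theorem measurable_tStat {Ω : Type*} [MeasurableSpace Ω] {n : ℕ} {K s : ℝ → ℝ} {κ κ₀ : ℝ}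
    (hK : IsKernel K κ) (hs : Measurable ((Set.Ioo (-κ₀) κ₀).indicator s)) (τ : ℝ) {ν p q : ℕ}
    (hν : ν ≤ p) (hpq : p < q) {h b : ℝ} (hh : 0 < h) (hb : 0 < b) (hsmall : κ * max h b < κ₀)
    {Z X : ℕ → Ω → ℝ} (hZ : ∀ i, Measurable (Z i)) (hX : ∀ i, Measurable (X i)) :
    Measurable fun ω =>
      tStat K s τ ν p q h b (fun i : Fin n => Z i ω) (fun i : Fin n => X i ω) := by
  have hZn : Measurable fun ω => fun i : Fin n => Z i ω := measurable_pi_lambda _ fun i => hZ i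
  simp only [tStat, tauBC_eq_sum K ν p q hν hpq h b hh]
  refine Measurable.div ((Finset.measurable_fun_sum _ fun i _ => ?_).sub_const τ)
    ((measurable_varBC hK hs hν hh hb hsmall).comp hZn).sqrt
  exact ((measurable_tauWeight hK.measurable ν p q h b i).comp hZn).mul (hX i)

theorem tendsto_charFun_tStat {Ω : Type*} [MeasurableSpace Ω] (P : Measure Ω)
    [IsProbabilityMeasure P] (Z X : ℕ → Ω → ℝ) (hZ : ∀ i, Measurable (Z i))
    (hX : ∀ i, Measurable (X i)) (hind : iIndepFun (fun i ω => (Z i ω, X i ω)) P)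
    (hid : ∀ i, P.map (fun ω => (Z i ω, X i ω)) = P.map (fun ω => (Z 0 ω, X 0 ω)))
    {X₀ X₁ : Ω → ℝ} (hX₀ : Measurable X₀) (hX₁ : Measurable X₁)
    (hXX₀ : ∀ ω, Z 0 ω < 0 → X 0 ω = X₀ ω) (hXX₁ : ∀ ω, 0 ≤ Z 0 ω → X 0 ω = X₁ ω)
    {ν p q S : ℕ} (hν : ν ≤ p) (hpq : p < q) (hS : q + 1 ≤ S) {κ₀ : ℝ} {μm μp sm sp : ℝ → ℝ}
    (hd : IsSmoothDesign P (Z 0) (X 0) X₀ X₁ κ₀ S μm μp sm sp) {K : ℝ → ℝ} {κ : ℝ}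
    (hK : IsKernel K κ) {h b : ℕ → ℝ} (hh : ∀ n, 0 < h n) (hb : ∀ n, 0 < b n)
    (hsmall : ∀ n, κ * max (h n) (b n) < κ₀)
    (hrate : Tendsto (fun n : ℕ => (n : ℝ) * min (h n) (b n)) atTop atTop)
    (hrate_bias : Tendsto (fun n : ℕ =>
      (n : ℝ) * min (h n ^ (2 * p + 3)) (b n ^ (2 * p + 3))
        * max (h n ^ 2) (b n ^ (2 * (q - p)))) atTop (𝓝 0)) (t : ℝ) :
    Tendsto (fun n : ℕ => charFun (P.map fun ω =>
        tStat K (glue sm sp) (estimand ν (glue μm μp)) ν p q (h n) (b n)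
          (fun i : Fin n => Z i ω) (fun i : Fin n => X i ω)) t)
      atTop (𝓝 (Real.exp (-(t ^ 2 / 2)) : ℂ)) := by
  have hκ := hK.radius_pos
  have hκ₀ := hd.radius_pos
  have hhκ : ∀ n, κ * h n < κ₀ := fun n =>
    (mul_le_mul_of_nonneg_left (le_max_left _ _) hκ.le).trans_lt (hsmall n)
  have hbκ : ∀ n, κ * b n < κ₀ := fun n =>
    (mul_le_mul_of_nonneg_left (le_max_right _ _) hκ.le).trans_lt (hsmall n)
  have hnh : Tendsto (fun n : ℕ => (n : ℝ) * h n) atTop atTop :=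
    tendsto_atTop_mono (fun n => mul_le_mul_of_nonneg_left (min_le_left _ _) n.cast_nonneg) hrate
  have hnb : Tendsto (fun n : ℕ => (n : ℝ) * b n) atTop atTop :=
    tendsto_atTop_mono (fun n => mul_le_mul_of_nonneg_left (min_le_right _ _) n.cast_nonneg) hrate
  have hindZ : iIndepFun Z P := hind.comp (fun _ => Prod.fst) fun _ => measurable_fst
  have hidZ : ∀ i, P.map (Z i) = P.map (Z 0) := by
    intro i
    have h1 : ∀ i, P.map (Z i) = (P.map fun ω => (Z i ω, X i ω)).map Prod.fst := fun i => by
      rw [Measure.map_map measurable_fst ((hZ i).prodMk (hX i))]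
      rfl
    rw [h1, h1 0, hid]
  obtain ⟨C, hmom⟩ := exists_ae_condDistrib_moments P (hZ 0) (hX 0) hX₀ hX₁ hXX₀ hXX₁ hd
  obtain ⟨vmin, hvmin, hv⟩ := exists_pos_le_glue hd.var_control_lower hd.var_treated_lower
  have hmean : ∀ᵐ z ∂(P.map (Z 0)), z ∈ Set.Ioo (-κ₀) κ₀ → |glue μm μp z| ≤ 1 + C := by
    filter_upwards [hmom] with z hz hzU
    obtain ⟨h1, h2, h3, _⟩ := hz hzU
    rw [← h3]
    exact abs_integral_le_of_fourth_moment _ h1 h2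
  -- Order `p + 1` serves the main fit and order `q` the pilot fit; `p + 1 ≤ q` keeps both within
  -- the available smoothness.
  obtain ⟨M₁, hM₁, hfp, hgp⟩ := exists_design_expansion P hd hmean (d := p + 1) (by omega)
  obtain ⟨M₂, _, hfq, hgq⟩ := exists_design_expansion P hd hmean (d := q) hS
  obtain ⟨D, c, hD, hc, hGp⟩ :=
    exists_tendsto_goodSet P Z hZ hindZ hidZ hκ₀ hκ hd.density p h hh hhκ hnh
  obtain ⟨D', c', hD', hc', hGq⟩ :=
    exists_tendsto_goodSet P Z hZ hindZ hidZ hκ₀ hκ hd.density q b hb hbκ hnb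
  have hle₁ : ∀ {r x : ℝ} {k : ℕ}, r ≤ M₁ * |x| ^ k → r ≤ max M₁ M₂ * |x| ^ k := fun hr =>
    hr.trans (mul_le_mul_of_nonneg_right (le_max_left _ _) (by positivity))
  have hle₂ : ∀ {r x : ℝ} {k : ℕ}, r ≤ M₂ * |x| ^ k → r ≤ max M₁ M₂ * |x| ^ k := fun hr =>
    hr.trans (mul_le_mul_of_nonneg_right (le_max_right _ _) (by positivity))
  obtain ⟨C', hC', hbound⟩ := exists_tauWeight_bounds hK hν hpq hD hc hD' hc'
    (hM₁.trans (le_max_left M₁ M₂)) (κ₀ := κ₀) (glue μm μp)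
    (fun k => iteratedDeriv k μp 0 / (k ! : ℝ)) (fun k => iteratedDeriv k μm 0 / (k ! : ℝ))
    (fun x hx hx' => hle₁ (hfp x hx hx')) (fun x hx hx' => hle₂ (hfq x hx hx'))
    (fun x hx hx' => hle₁ (hgp x hx hx')) (fun x hx hx' => hle₂ (hgq x hx hx'))
  have hτ : (ν ! : ℝ) * (iteratedDeriv ν μp 0 / (ν ! : ℝ) - iteratedDeriv ν μm 0 / (ν ! : ℝ))
      = estimand ν (glue μm μp) := by
    rw [estimand_glue hκ₀ hd.smooth_control hd.smooth_treated (show ν ≤ S by omega)]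
    have : (ν ! : ℝ) ≠ 0 := by positivity
    field_simp
  simp only [hτ] at hbound
  have hs : Measurable ((Set.Ioo (-κ₀) κ₀).indicator (glue sm sp)) :=
    measurable_indicator_glue measurableSet_Ioo hd.cont_var_control hd.cont_var_treated
  -- The condition `0 < n` empties the event for the empty sample, where the bounds fail; this is
  -- invisible in the limit.
  set G : ∀ n : ℕ, Set (Fin n → ℝ) := fun n =>
    {_z | 0 < n} ∩ (goodSet κ p D c (h n) ∩ goodSet κ q D' c' (b n)) with hG
  have hGlim : Tendsto (fun n => (P {ω | (fun i : Fin n => Z i ω) ∉ G n}).toReal) atTop (𝓝 0) := by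
    have hsum := hGp.add hGq
    rw [add_zero] at hsum
    refine squeeze_zero' (Eventually.of_forall fun n => ENNReal.toReal_nonneg) ?_ hsum
    filter_upwards [eventually_gt_atTop 0] with n hn
    refine le_trans (measureReal_mono (s₂ := {ω | (fun i : Fin n => Z i ω) ∉ goodSet κ p D c (h n)}
      ∪ {ω | (fun i : Fin n => Z i ω) ∉ goodSet κ q D' c' (b n)}) fun ω hω => ?_)
      (measureReal_union_le _ _)
    by_contra hnot
    rw [Set.mem_union, not_or] at hnot
    exact hω ⟨hn, not_not.mp hnot.1, not_not.mp hnot.2⟩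
  have hη : Tendsto (fun n : ℕ => C' * (Real.sqrt (n * min (h n) (b n)))⁻¹) atTop (𝓝 0) := by
    simpa using (tendsto_inv_atTop_zero.comp
      (Real.tendsto_sqrt_atTop.comp hrate)).const_mul C'
  have hδ : Tendsto (fun n : ℕ => C' * (Real.sqrt (n * min (h n) (b n) ^ (2 * p + 3))
      * (h n + b n ^ (q - p)))) atTop (𝓝 0) := by
    have h1 : Tendsto (fun n : ℕ => 2 * Real.sqrt ((n : ℝ)
        * min (h n ^ (2 * p + 3)) (b n ^ (2 * p + 3))
        * max (h n ^ 2) (b n ^ (2 * (q - p))))) atTop (𝓝 0) := by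
      have := (Real.continuous_sqrt.tendsto 0).comp hrate_bias
      rw [Real.sqrt_zero] at this
      simpa using this.const_mul 2
    have h2 := squeeze_zero (fun n => mul_nonneg (Real.sqrt_nonneg _)
      (by have := hh n; have := hb n; positivity))
      (fun n => sqrt_mul_bandwidth_le (p := p) (q := q) n (hh n) (hb n)) h1
    simpa using h2.const_mul C'
  have key := tendsto_charFun_studentized P Z X hZ hX hind hid (Set.Ioo (-κ₀) κ₀) (glue μm μp)
    (glue sm sp) hvmin hv hmom (fun n z i => tauWeight K ν p q (h n) (b n) z i)
    (fun n i => measurable_tauWeight hK.measurable ν p q (h n) (b n) i)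
    (fun n z i hi => abs_lt.mp ((abs_le_of_tauWeight_ne_zero hK (hh n) (hb n) hi).trans_lt
      (hsmall n)))
    (fun n z => varBC K (glue sm sp) ν p q (h n) (b n) z)
    (fun n => measurable_varBC hK hs hν (hh n) (hb n) (hsmall n))
    (fun n z => varBC_eq_sum _ _ _ _ _ hν _ _ (hh n) (hb n) z) (estimand ν (glue μm μp)) G
    (fun n => (MeasurableSet.const _).inter
      ((measurableSet_goodSet _ _ _ _ _).inter (measurableSet_goodSet _ _ _ _ _)))
    hGlim _ _ (fun n => by positivity)
    (fun n => by have := hh n; have := hb n; have := lt_min this (hb n); positivity) hη hδ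
    (fun n z hz => (hbound n (h n) (b n) z hz.1 (hh n) (hb n) (hhκ n) (hbκ n) hz.2.1 hz.2.2).1)
    (fun n z hz => (hbound n (h n) (b n) z hz.1 (hh n) (hb n) (hhκ n) (hbκ n) hz.2.1 hz.2.2).2.1)
    (fun n z hz => (hbound n (h n) (b n) z hz.1 (hh n) (hb n) (hhκ n) (hbκ n) hz.2.1 hz.2.2).2.2) t
  simpa only [tStat, tauBC_eq_sum K ν p q hν hpq _ _ (hh _)] using key
end DiDC

end

/-! ### Convergence in distribution -/

theorem theorem1 {Ω : Type*} [MeasurableSpace Ω] (P : Measure Ω) [IsProbabilityMeasure P]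
    (Z : ℕ → Ω → ℝ) (Y : ℕ → Fin 2 → Fin 2 → Fin 2 → Ω → ℝ)
    (hsample : DiDC.IsRandomSample P Z Y)
    (ν p q S : ℕ) (hνp : ν ≤ p) (hpq : p < q) (hS : q + 1 ≤ S)
    (κ₀ : ℝ) (μm μp sm sp : ℝ → ℝ)
    (hdesign : DiDC.IsSmoothDesign P (Z 0) (DiDC.deltaY Z Y 0) (DiDC.deltaYControl Y 0)
      (DiDC.deltaYTreated Y 0) κ₀ S μm μp sm sp)
    (K : ℝ → ℝ) (κ : ℝ) (hK : DiDC.IsKernel K κ)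
    (h b : ℕ → ℝ) (hh : ∀ n, 0 < h n) (hb : ∀ n, 0 < b n)
    (hsmall : ∀ n, κ * max (h n) (b n) < κ₀)
    (hrate : Tendsto (fun n : ℕ => (n : ℝ) * min (h n) (b n)) atTop atTop)
    (hrate_bias : Tendsto (fun n : ℕ =>
      (n : ℝ) * min (h n ^ (2 * p + 3)) (b n ^ (2 * p + 3))
        * max (h n ^ 2) (b n ^ (2 * (q - p)))) atTop (𝓝 0)) :
    TendstoInDistribution
      (fun (n : ℕ) (ω : Ω) =>
        DiDC.tStat K (DiDC.glue sm sp) (DiDC.estimand ν (DiDC.glue μm μp)) ν p q (h n) (b n)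
          (fun i : Fin n => Z i ω) (fun i : Fin n => DiDC.deltaY Z Y i ω))
      atTop (id : ℝ → ℝ) (fun _ => P) (gaussianReal 0 1) := by
  have hZ : ∀ i, Measurable (Z i) := fun i => DiDC.measurable_datum_fst (hsample.measurable i)
  have hY : ∀ i t d₀ d₁, Measurable (Y i t d₀ d₁) := fun i =>
    DiDC.measurable_datum_snd (hsample.measurable i)
  have hpair : ∀ i, (fun ω => (Z i ω, DiDC.deltaY Z Y i ω))
      = DiDC.observedPair ∘ DiDC.datum Z Y i := fun i =>
    funext fun ω => (DiDC.observedPair_datum Z Y i ω).symm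
  have hX : ∀ i, Measurable (DiDC.deltaY Z Y i) := fun i => by
    have h1 := DiDC.measurable_observedPair.comp (hsample.measurable i)
    rw [← hpair] at h1
    exact h1.snd
  have hind : iIndepFun (fun i ω => (Z i ω, DiDC.deltaY Z Y i ω)) P := by
    rw [show (fun i ω => (Z i ω, DiDC.deltaY Z Y i ω))
      = fun i => DiDC.observedPair ∘ DiDC.datum Z Y i from funext hpair]
    exact hsample.indep.comp (fun _ => DiDC.observedPair) fun _ => DiDC.measurable_observedPair
  have hid : ∀ i, P.map (fun ω => (Z i ω, DiDC.deltaY Z Y i ω))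
      = P.map (fun ω => (Z 0 ω, DiDC.deltaY Z Y 0 ω)) := fun i => by
    rw [hpair, hpair]
    exact ((hsample.identDistrib i).comp DiDC.measurable_observedPair).map_eq
  have hs := DiDC.measurable_indicator_glue (s := Set.Ioo (-κ₀) κ₀) measurableSet_Ioo
    hdesign.cont_var_control hdesign.cont_var_treated
  refine ⟨fun n => (DiDC.measurable_tStat hK hs _ hνp hpq (hh n) (hb n) (hsmall n) hZ
    hX).aemeasurable, measurable_id.aemeasurable, ?_⟩
  -- Lévy's continuity theorem reduces the claim to pointwise convergence of characteristic
  -- functions.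
  refine ProbabilityMeasure.tendsto_iff_tendsto_charFun.2 fun t => ?_
  have key := DiDC.tendsto_charFun_tStat P Z (DiDC.deltaY Z Y) hZ hX hind hid
    ((hY 0 1 0 0).sub (hY 0 0 0 0)) ((hY 0 1 1 1).sub (hY 0 0 1 0))
    (fun ω hω => by rw [DiDC.deltaY_eq, if_neg hω.not_ge]; rfl)
    (fun ω hω => by rw [DiDC.deltaY_eq, if_pos hω]; rfl) hνp hpq hS hdesign hK hh hb hsmall hrate
    hrate_bias t
  have hlim : charFun ((gaussianReal 0 1).map (id : ℝ → ℝ)) t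
      = (Real.exp (-(t ^ 2 / 2)) : ℂ) := by
    rw [Measure.map_id, charFun_gaussianReal]
    push_cast
    congr 1
    simp
  exact hlim ▸ key
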